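/- **Model.** Let $Q,L\ge 1$ be fixed. In the latent block model (LBM), the latent variables are $Z=(Z_1,\dots,Z_n)$ i.i.d. with distribution $\alpha$ on $\{1,\dots,Q\}$ and, independently, $W=(W_1,\dots,W_m)$ i.i.d. with distribution $\beta$ on $\{1,\dots,L\}$; the configurations are all $(z,w)\in\mathcal U=\{1,\dots,Q\}^n\times\{1,\dots,L\}^m$, and $I=\{1,\dots,n\}\times\{1,\dots,m\}$. In the stochastic block model (SBM), $m=n$, $L=Q$, $\beta=\alpha$, $W=Z$, $\mathcal U=\{(z,z)\}$, and $I$ is $\{(i,j)\}$, $\{i\ne j\}$, or, for undirected graphs (symmetric parameter matrices), $\{i\le j\}$ or $\{i<j\}$. Given $(Z,W)$ the observations $X_{ij}$, $(i,j)\in I$, are independent, and given $(Z_i,W_j)=(q,l)$ the law of $X_{ij}$ is the zero-inflated law $F(\xi_n\pi_{ql},\gamma_{ql})$, where $F(p,\gamma)=p\,\tilde f(\cdot;\gamma)+(1-p)\delta_0$. Here $\{\tilde f(\cdot;\gamma):\gamma\in\Gamma\}$ are probability densities, of laws without an atom at $0$, with respect to a $\sigma$-finite measure. The parameter is $\theta=(\alpha,\beta,\pi,\gamma)$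 with $\pi\in\Pi_{QL}\subset\Pi^{Q\times L}$, $\Pi\subset[a,1-a]$, $a\in(0,1/2)$, $\gamma\in\Gamma_{QL}\subset\Gamma^{Q\times L}$ and $\alpha_q\ge\alpha_{\min}>0$, $\beta_l\ge\beta_{\min}>0$. The weight parameters $\gamma$ do not depend on $n$. $\theta^\star$ is the true parameter, $P^\star$ the law under it, $\tilde D(\gamma\|\gamma')$ is the Kullback–Leibler divergence of the laws with densities $\tilde f(\cdot;\gamma),\tilde f(\cdot;\gamma')$, and $p_\theta(z,w)$ is the posterior probability $P_\theta((Z,W)=(z,w)\mid X)$, given by Bayes' formula. **Assumptions.** 1. (Identifiability) $\gamma\in\Gamma$ is determined by the law with density $\tilde f(\cdot;\gamma)$; for all parameters, no two rows and no two columns of the matrix $((\pi_{ql},\gamma_{ql}))_{q,l}$ are equal. 2. (Symmetries) $\Sigma$ is a subgroup of the group of relabellings $(s,t)$ of the row and column groups (of the form $(s,s)$ in SBM); every $(s,t)\in\Sigma$ leaves every $(\pi,\gamma)\in\Pi_{QL}\times\Gamma_{QL}$ invariant, i.e. $(\pi,\gamma)_{s(q)t(l)}=(\pi,\gamma)_{ql}$,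 and a relabelling outside $\Sigma$ leaves none invariant. 3. $\sup_{\gamma,\gamma'\in\Gamma}\tilde D(\gamma\|\gamma')<\infty$. 4. For some $\tilde L_0>0$, all $\gamma,\gamma'\in\Gamma_{QL}$ and all $q,l,q',l'$, the integral exists and $\big|\int\log\frac{\tilde f(x;\gamma_{ql})}{\tilde f(x;\gamma'_{ql})}\tilde f(x;\gamma_{q'l'})dx\big|\le\tilde L_0\|\gamma-\gamma'\|_\infty$. 5. (Strengthened concentration) For $\gamma\in\Gamma_{QL}$ and blocks $e,e'\in\{1,\dots,Q\}\times\{1,\dots,L\}$ let $\tilde Y=\log\frac{\tilde f(\cdot;\gamma_e)}{\tilde f(\cdot;\gamma_{e'})}+\text{const}$, centered under the density $\tilde f(\cdot;\gamma^\star_e)$, and let $M(\lambda)$ be the supremum over $\gamma,e,e'$ and over both signs of $E_{\gamma^\star_e}[e^{\pm\lambda\tilde Y}]$. There is an interval $I\subset(0,\infty)$ such that $\sup_{\lambda\in I}(\lambda x-M(\lambda)+1)>0$ for every $x>0$. 6. $m_n\le n$, $m_n\to\infty$, $\xi_n\in(0,1]$, $\xi_n\to0$, $\log n/(m_n\xi_n)\to0$.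 **Notation.** $\mu_{\min}=\alpha_{\min}\wedge\beta_{\min}$; $\alpha_{\max},\beta_{\max}$ are the largest values of the $\alpha_q$, $\beta_l$ over the parameter set; $K=\log\frac{\alpha_{\max}}{\alpha_{\min}}\vee\log\frac{\beta_{\max}}{\beta_{\min}}$; $L_0=1/a+\tilde L_0$; $C_n=2\sup\{D(F(\xi_n p,g)\,\|\,F(\xi_n p',g')):p,p'\in\Pi,\ g,g'\in\Gamma\}$; and $$c=\frac{\mu_{\min}^2}{16}\min_{e,e':\,(\pi^\star_e,\gamma^\star_e)\ne(\pi^\star_{e'},\gamma^\star_{e'})}\Big\{\tfrac12\big(\tfrac a{1-a}\big)^2\tfrac{(\pi^\star_e-\pi^\star_{e'})^2}{\pi^\star_e}+a\,\tilde D(\gamma^\star_e\|\gamma^\star_{e'})\Big\}.$$ For $u,v\in\mathcal U$ write $u\sim v$ if $u=(s,t)v$ for some $(s,t)\in\Sigma$. $\|\cdot\|_0$ counts the nonzero coordinates. $\|(z,w)-(z',w')\|_0$ means $\|z-z'\|_0+\|w-w'\|_0$ in LBM and $\|z-z'\|_0$ in SBM. Put $\kappa_n=\xi_n(c-2L_0\eta)$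 and $a_n=ne^{-\kappa_nm_n+K}+m_ne^{-\kappa_nn+K}$, $b_n=ne^{-C_nm_n-K}+m_ne^{-C_nn-K}$ (LBM), $a_n=ne^{-2n\kappa_n+K}$, $b_n=ne^{-2C_nn-K}$ (SBM). **Statement.** If $Q\ge 2$ or $L\ge 2$ then $c>0$. If any two blocks differ in their $\pi^\star$ if and only if they differ in their $\gamma^\star$, then $c\ge\mu_{\min}^2(c_{\min}+a\kappa_{\min})/16$, where $c_{\min}$ is the minimum of $\frac12(\frac a{1-a})^2(\pi^\star_e-\pi^\star_{e'})^2/\pi^\star_e$ over $\pi^\star_e\ne\pi^\star_{e'}$ and $\kappa_{\min}$ that of $\tilde D(\gamma^\star_e\|\gamma^\star_{e'})$ over $\gamma^\star_e\neq\gamma^\star_{e'}$ (a minimum over no pairs being read as $0$). Let $0<\eta<c/(2L_0)$. Then $a_n\to0$, $b_n\to0$, and there are $\varepsilon_n>0$ with $\sum_n\varepsilon_n<\infty$ and, for all $n$ and all $\gamma\in\Gamma_{QL}$ with $\|\gamma-\gamma^\star\|_\infty\le\eta$, an event $\Omega_1=\Omega_{1,n}(\gamma)$ with $P^\star(\Omega_1)\ge1-\varepsilon_n$,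 such that on $\Omega_1$, simultaneously for all $(\alpha,\beta)$ and all $\pi\in\Pi_{QL}$ with $\|(\pi,\gamma)-(\pi^\star,\gamma^\star)\|_\infty\le\eta$, the parameter $\theta=(\alpha,\beta,\pi,\gamma)$ satisfies the following. (i) For all $(z,w)\in\mathcal U$ the posterior probability is positive, and for all $(s,t)\in\Sigma$, $$\xi_n\big(c-2L_0\|(\pi,\gamma)-(\pi^\star,\gamma^\star)\|_\infty\big)(m_nr_1+nr_2)-K\|(s(Z),t(W))-(z,w)\|_0\le\log\frac{p_\theta(s(Z),t(W))}{p_\theta(z,w)}\le C_n(m_nr_1+nr_2)+K\|(s(Z),t(W))-(z,w)\|_0,$$ where $r_1=\|Z-\tilde s(z)\|_0$, $r_2=\|W-\tilde t(w)\|_0$ for any $(\tilde s,\tilde t)\in\Sigma$ that minimizes $\|Z-\tilde s(z)\|_0+\|W-\tilde t(w)\|_0$. (ii) If $\Sigma$ is trivial, $p_\theta(Z,W)\ge1-a_ne^{a_n}$, and, if $Q\ge2$, $p_\theta(Z,W)\le(1+b_ne^{b_n})^{-1}$. (iii) In general, $p_\theta(\{u:u\sim(Z,W)\})\ge1-|\Sigma|a_ne^{a_n}$,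 and, if $Q\ge2$, $p_\theta(\{u:u\sim(Z,W)\})\le(1+|\Sigma|b_ne^{b_n})^{-1}$. (iv) If $K=0$, (iii) holds and moreover $p_\theta(Z,W)=|\Sigma|^{-1}p_\theta(\{u:u\sim(Z,W)\})$. Finally, if $\Sigma$ is trivial and $\hat\theta_n$ are (possibly data-dependent) parameter values with $(\hat\pi_n,\hat\gamma_n)\to(\pi^\star,\gamma^\star)$, then for all large $n$, on $\Omega_{1,n}(\hat\gamma_n)$, every maximizer $(\hat Z,\hat W)$ of $p_{\hat\theta_n}$ over $\mathcal U$ makes no error: $\|(\hat Z,\hat W)-(Z,W)\|_0=0$. -/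

import Mathlib

open MeasureTheory Filter Topology
open scoped ENNReal

/-- The graphs allowed in the stochastic block model. -/
inductive GraphKind where
  | directedLoops
  | directedNoLoops
  | undirectedLoops
  | undirectedNoLoops

/-- The pairs of nodes at which an entry is observed (in the undirected case `X i j = X j i`, so
that only one orientation is recorded). -/
def GraphKind.Observed {n : ℕ} : GraphKind → Fin n → Fin n → Prop
  | .directedLoops, _, _ => True
  | .directedNoLoops, i, j => i ≠ j
  | .undirectedLoops, i, j => i ≤ j
  | .undirectedNoLoops, i, j => i < j

def GraphKind.IsUndirected : GraphKind → Prop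
  | .directedLoops => False
  | .directedNoLoops => False
  | .undirectedLoops => True
  | .undirectedNoLoops => True

/-- The two sorts of models: the latent block model (`Q` row groups, `L` column groups, an
`n × m n` array), and the stochastic block model (`L = Q`, `m n = n`, one latent vector). -/
inductive Design (Q : ℕ) : ℕ → (ℕ → ℕ) → Type where
  | lbm (L : ℕ) (m : ℕ → ℕ) : Design Q L m
  | sbm (g : GraphKind) : Design Q Q (fun n => n)

/-- Pairs `(z, w)` of a row labelling and a column labelling. -/
abbrev LabelPair (Q L n m : ℕ) : Type := (Fin n → Fin Q) × (Fin m → Fin L)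

namespace Design

variable {Q L : ℕ} {m : ℕ → ℕ}

/-- The index set `I` of the observed entries. -/
noncomputable def cells (D : Design Q L m) (n : ℕ) : Finset (Fin n × Fin (m n)) := by
  classical
  exact match D with
    | .lbm _ _ => Finset.univ
    | .sbm g => Finset.univ.filter fun p : Fin n × Fin n => g.Observed p.1 p.2

/-- The set `U` of latent configurations: all pairs `(z, w)` in the latent block model, the pairs
`(z, z)` in the stochastic block model. -/
noncomputable def configs (D : Design Q L m) (n : ℕ) : Finset (LabelPair Q L n (m n)) := by
  classical
  exact match D with
    | .lbm _ _ => Finset.univ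
    | .sbm _ => Finset.univ.filter fun u : LabelPair Q Q n n => u.1 = u.2

/-- Group proportions: `α = β` in the stochastic block model. -/
def Tied (D : Design Q L m) (α : Fin Q → ℝ) (β : Fin L → ℝ) : Prop :=
  match D, β with
  | .lbm _ _, _ => True
  | .sbm _, β => α = β

/-- The probability `μ(z, w)` of a configuration. -/
noncomputable def prior (D : Design Q L m) (n : ℕ) (α : Fin Q → ℝ) (β : Fin L → ℝ)
    (u : LabelPair Q L n (m n)) : ℝ :=
  match D, β, u with
  | .lbm _ m, β, u => (∏ i, α (u.1 i)) * ∏ j : Fin (m n), β (u.2 j)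
  | .sbm _, _, u => ∏ i, α (u.1 i)

/-- Undirected graphs have symmetric parameter matrices. -/
def Compatible (D : Design Q L m) {T : Type*} (M : Fin Q → Fin L → T) : Prop :=
  match D, M with
  | .lbm _ _, _ => True
  | .sbm g, M => g.IsUndirected → ∀ q l, M q l = M l q

/-- The group of all admissible relabellings of the groups: all pairs `(s, t)` in the latent block
model, the pairs `(s, s)` in the stochastic block model. -/
def relabellings (D : Design Q L m) : Subgroup (Equiv.Perm (Fin Q) × Equiv.Perm (Fin L)) :=
  match D with
  | .lbm _ _ => ⊤
  | .sbm _ => ((MonoidHom.id (Equiv.Perm (Fin Q))).prod (MonoidHom.id (Equiv.Perm (Fin Q)))).range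

/-- The `ℓ₀` discrepancy of two configurations: `‖z - z'‖₀ + ‖w - w'‖₀` in the latent block model,
`‖z - z'‖₀` in the stochastic block model. -/
def ham (D : Design Q L m) (n : ℕ) (u v : LabelPair Q L n (m n)) : ℕ :=
  match D, u, v with
  | .lbm _ _, u, v => hammingDist u.1 v.1 + hammingDist u.2 v.2
  | .sbm _, u, v => hammingDist u.1 v.1

/-- `n e^{-κ m + K} + m e^{-κ n + K}` in the latent block model, `n e^{-2 κ n + K}` in the
stochastic block model. -/
noncomputable def rate (D : Design Q L m) (n : ℕ) (κ K : ℝ) : ℝ :=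
  match D with
  | .lbm _ m => n * Real.exp (-(κ * m n) + K) + m n * Real.exp (-(κ * n) + K)
  | .sbm _ => n * Real.exp (-(2 * κ * n) + K)

end Design

/-- The pair `(s, t)` acts on a configuration by `(s(z), t(w))`. -/
def relabel {Q L n m : ℕ} (g : Equiv.Perm (Fin Q) × Equiv.Perm (Fin L))
    (u : LabelPair Q L n m) : LabelPair Q L n m :=
  (fun i => g.1 (u.1 i), fun j => g.2 (u.2 j))

/-- The permuted matrix with entries `M (s q) (t l)`. -/
def permuteMatrix {Q L : ℕ} {T : Type*} (g : Equiv.Perm (Fin Q) × Equiv.Perm (Fin L))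
    (M : Fin Q → Fin L → T) : Fin Q → Fin L → T :=
  fun q l => M (g.1 q) (g.2 l)

/-- The data of a sequence of zero-inflated weighted block models with a vanishing density:
the block `(q, l)` has distribution `ξ n * π q l` times the law with density `f (γ q l)`, plus
`1 - ξ n * π q l` times the Dirac mass at `0`.  No property is assumed here. -/
structure WeightedModel (𝓧 E : Type*) [MeasurableSpace 𝓧] where
  /-- numbers of row and of column groups -/
  Q : ℕ
  L : ℕ
  /-- number of columns, as a function of the number of rows -/
  m : ℕ → ℕ
  /-- latent block model or stochastic block model -/
  design : Design Q L m
  /-- dominating measure and densities of the nonzero weights -/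
  base : Measure 𝓧
  f : E → 𝓧 → ℝ
  /-- sets of the entries, and sets of the parameter matrices -/
  PiSet : Set ℝ
  GammaSet : Set E
  PiMat : Set (Fin Q → Fin L → ℝ)
  GammaMat : Set (Fin Q → Fin L → E)
  /-- the group of symmetries of the parameter set -/
  Sig : Subgroup (Equiv.Perm (Fin Q) × Equiv.Perm (Fin L))
  /-- lower bounds for the group proportions -/
  αmin : ℝ
  βmin : ℝ
  /-- the bound with `PiSet ⊆ [a, 1 - a]`, and the Lipschitz constant of the weights -/
  a : ℝ
  Ltil : ℝ
  /-- the sparsity sequence -/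
  ξ : ℕ → ℝ
  /-- the true parameter -/
  αs : Fin Q → ℝ
  βs : Fin L → ℝ
  πs : Fin Q → Fin L → ℝ
  γs : Fin Q → Fin L → E

namespace WeightedModel

variable {𝓧 E : Type*} [MeasurableSpace 𝓧]

/-! ### The model -/

/-- Configurations `(z, w)` for `n` rows. -/
abbrev Config (S : WeightedModel 𝓧 E) (n : ℕ) : Type := LabelPair S.Q S.L n (S.m n)

/-- Arrays of observations for `n` rows. -/
abbrev Data (S : WeightedModel 𝓧 E) (n : ℕ) : Type _ := {p // p ∈ S.design.cells n} → 𝓧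

/-- The group proportions `(α, β)` of the parameter set. -/
def proportions (S : WeightedModel 𝓧 E) : Set ((Fin S.Q → ℝ) × (Fin S.L → ℝ)) :=
  {p | (∀ q, S.αmin ≤ p.1 q) ∧ ∑ q, p.1 q = 1 ∧ (∀ l, S.βmin ≤ p.2 l) ∧ ∑ l, p.2 l = 1 ∧
    S.design.Tied p.1 p.2}

/-- The law of a nonzero weight. -/
noncomputable def weightLaw (S : WeightedModel 𝓧 E) (g : E) : Measure 𝓧 :=
  S.base.withDensity fun x => ENNReal.ofReal (S.f g x)

/-- The zero-inflated law `p f(·; g) + (1 - p) δ₀`. -/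
noncomputable def mixLaw [Zero 𝓧] (S : WeightedModel 𝓧 E) (p : ℝ) (g : E) : Measure 𝓧 :=
  ENNReal.ofReal p • S.weightLaw g + ENNReal.ofReal (1 - p) • Measure.dirac 0

open scoped Classical in
/-- The density of `mixLaw p g` with respect to the sum of the Dirac mass at `0` and of the
restriction of the base measure to the nonzero points. -/
noncomputable def mixDensity [Zero 𝓧] (S : WeightedModel 𝓧 E) (p : ℝ) (g : E) (x : 𝓧) : ℝ :=
  if x = 0 then 1 - p else p * S.f g x

/-- Law of the observations given the configuration `u`: independent entries, the entry `(i, j)`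
having the law of the block `(z i, w j)`. -/
noncomputable def dataLaw [Zero 𝓧] (S : WeightedModel 𝓧 E) (n : ℕ)
    (π : Fin S.Q → Fin S.L → ℝ) (γ : Fin S.Q → Fin S.L → E) (u : S.Config n) :
    Measure (S.Data n) :=
  Measure.pi fun p =>
    S.mixLaw (S.ξ n * π (u.1 p.1.1) (u.2 p.1.2)) (γ (u.1 p.1.1) (u.2 p.1.2))

/-- Joint law of the latent configuration and of the observations at the true parameter. -/
noncomputable def trueLaw [Zero 𝓧] (S : WeightedModel 𝓧 E) (n : ℕ) :
    Measure (S.Config n × S.Data n) :=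
  ∑ u ∈ S.design.configs n, ENNReal.ofReal (S.design.prior n S.αs S.βs u) •
    (Measure.dirac u).prod (S.dataLaw n S.πs S.γs u)

/-- Likelihood of the observations given the configuration `u`. -/
noncomputable def likelihood [Zero 𝓧] (S : WeightedModel 𝓧 E) (n : ℕ)
    (π : Fin S.Q → Fin S.L → ℝ) (γ : Fin S.Q → Fin S.L → E) (X : S.Data n) (u : S.Config n) : ℝ :=
  ∏ p, S.mixDensity (S.ξ n * π (u.1 p.1.1) (u.2 p.1.2)) (γ (u.1 p.1.1) (u.2 p.1.2)) (X p)

/-- A parameter `((α, β), (π, γ))`. -/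
abbrev Param (S : WeightedModel 𝓧 E) : Type _ :=
  ((Fin S.Q → ℝ) × (Fin S.L → ℝ)) × ((Fin S.Q → Fin S.L → ℝ) × (Fin S.Q → Fin S.L → E))

/-- The parameter set, for the unscaled `π`. -/
def params (S : WeightedModel 𝓧 E) : Set S.Param :=
  S.proportions ×ˢ (S.PiMat ×ˢ S.GammaMat)

/-- The posterior probability of the configuration `u` given the observations `X`, under the
parameter `θ`, by Bayes' formula. -/
noncomputable def posterior [Zero 𝓧] (S : WeightedModel 𝓧 E) (n : ℕ) (θ : S.Param)
    (X : S.Data n) (u : S.Config n) : ℝ :=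
  S.design.prior n θ.1.1 θ.1.2 u * S.likelihood n θ.2.1 θ.2.2 X u /
    ∑ v ∈ S.design.configs n, S.design.prior n θ.1.1 θ.1.2 v * S.likelihood n θ.2.1 θ.2.2 X v

/-- `u` and `v` are equivalent: `u = (s(z'), t(w'))` with `v = (z', w')` and `(s, t) ∈ Sig`. -/
def Equivalent (S : WeightedModel 𝓧 E) {n : ℕ} (u v : S.Config n) : Prop :=
  ∃ g ∈ S.Sig, relabel g v = u

open scoped Classical in
/-- Posterior probability of the class of all configurations equivalent to `u`. -/
noncomputable def classPosterior [Zero 𝓧] (S : WeightedModel 𝓧 E) (n : ℕ) (θ : S.Param)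
    (X : S.Data n) (u : S.Config n) : ℝ :=
  ∑ v ∈ S.design.configs n with S.Equivalent v u, S.posterior n θ X v

/-- `g ∈ Sig` attains the distance `d(u, v)` between (classes of) configurations. -/
def Attains (S : WeightedModel 𝓧 E) {n : ℕ} (u v : S.Config n)
    (g : Equiv.Perm (Fin S.Q) × Equiv.Perm (Fin S.L)) : Prop :=
  g ∈ S.Sig ∧ ∀ h ∈ S.Sig,
    hammingDist u.1 (relabel g v).1 + hammingDist u.2 (relabel g v).2 ≤
      hammingDist u.1 (relabel h v).1 + hammingDist u.2 (relabel h v).2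

/-- `m r₁ + n r₂`, where `r₁ = ‖z - z'‖₀` and `r₂ = ‖w - w'‖₀`
(this is `2 n r₁` in the stochastic block model). -/
def weight (S : WeightedModel 𝓧 E) {n : ℕ} (u v : S.Config n) : ℕ :=
  S.m n * hammingDist u.1 v.1 + n * hammingDist u.2 v.2

/-! ### The constants -/

noncomputable def αmax (S : WeightedModel 𝓧 E) : ℝ :=
  sSup {x | ∃ p ∈ S.proportions, ∃ q, x = p.1 q}

noncomputable def βmax (S : WeightedModel 𝓧 E) : ℝ :=
  sSup {x | ∃ p ∈ S.proportions, ∃ l, x = p.2 l}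

noncomputable def μmin (S : WeightedModel 𝓧 E) : ℝ := min S.αmin S.βmin

noncomputable def K (S : WeightedModel 𝓧 E) : ℝ :=
  max (Real.log (S.αmax / S.αmin)) (Real.log (S.βmax / S.βmin))

/-- Kullback-Leibler divergence between the laws of two nonzero weights. -/
noncomputable def weightKL (S : WeightedModel 𝓧 E) (g g' : E) : ℝ≥0∞ :=
  InformationTheory.klDiv (S.weightLaw g) (S.weightLaw g')

/-- `½ (a / (1 - a))² (p - p')² / p`, where `p` and `p'` are the entries of the true `π` at the
blocks `e` and `e'`. -/
noncomputable def sparsityGap (S : WeightedModel 𝓧 E) (e e' : Fin S.Q × Fin S.L) : ℝ :=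
  1 / 2 * (S.a / (1 - S.a)) ^ 2 * ((S.πs e.1 e.2 - S.πs e'.1 e'.2) ^ 2 / S.πs e.1 e.2)

/-- The divergence between the laws of the weights of the blocks `e` and `e'`. -/
noncomputable def weightGap (S : WeightedModel 𝓧 E) (e e' : Fin S.Q × Fin S.L) : ℝ :=
  (S.weightKL (S.γs e.1 e.2) (S.γs e'.1 e'.2)).toReal

noncomputable def cMin (S : WeightedModel 𝓧 E) : ℝ :=
  sInf {x | ∃ e e' : Fin S.Q × Fin S.L, S.πs e.1 e.2 ≠ S.πs e'.1 e'.2 ∧ x = S.sparsityGap e e'}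

noncomputable def κMin (S : WeightedModel 𝓧 E) : ℝ :=
  sInf {x | ∃ e e' : Fin S.Q × Fin S.L, S.γs e.1 e.2 ≠ S.γs e'.1 e'.2 ∧ x = S.weightGap e e'}

/-- The separation of the blocks: the minimum of `sparsityGap + a * weightGap` over the pairs of
blocks with different parameters. -/
noncomputable def separation (S : WeightedModel 𝓧 E) : ℝ :=
  sInf {x | ∃ e e' : Fin S.Q × Fin S.L,
    (S.πs e.1 e.2, S.γs e.1 e.2) ≠ (S.πs e'.1 e'.2, S.γs e'.1 e'.2) ∧
      x = S.sparsityGap e e' + S.a * S.weightGap e e'}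

noncomputable def c (S : WeightedModel 𝓧 E) : ℝ := S.μmin ^ 2 * S.separation / 16

noncomputable def L0 (S : WeightedModel 𝓧 E) : ℝ := S.a⁻¹ + S.Ltil

/-- The largest divergence between two of the zero-inflated laws at density `ξ n`. -/
noncomputable def κMax [Zero 𝓧] (S : WeightedModel 𝓧 E) (n : ℕ) : ℝ :=
  (⨆ p ∈ S.PiSet, ⨆ p' ∈ S.PiSet, ⨆ g ∈ S.GammaSet, ⨆ g' ∈ S.GammaSet,
    InformationTheory.klDiv (S.mixLaw (S.ξ n * p) g) (S.mixLaw (S.ξ n * p') g')).toReal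

noncomputable def C [Zero 𝓧] (S : WeightedModel 𝓧 E) (n : ℕ) : ℝ := 2 * S.κMax n

/-- The bound `a_{n,m}`, for parameters at distance at most `η` from the true one. -/
noncomputable def aSeq (S : WeightedModel 𝓧 E) (η : ℝ) (n : ℕ) : ℝ :=
  S.design.rate n (S.ξ n * (S.c - 2 * S.L0 * η)) S.K

/-- The bound `b_{n,m}`. -/
noncomputable def bSeq [Zero 𝓧] (S : WeightedModel 𝓧 E) (n : ℕ) : ℝ :=
  S.design.rate n (S.C n) (-S.K)

/-! ### The assumptions -/

/-- The parameter sets, and the place of the true parameter. -/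
structure IsParametrized (S : WeightedModel 𝓧 E) : Prop where
  αmin_pos : 0 < S.αmin
  βmin_pos : 0 < S.βmin
  a_pos : 0 < S.a
  a_lt : S.a < 1 / 2
  PiSet_subset : S.PiSet ⊆ Set.Icc S.a (1 - S.a)
  PiMat_mem : ∀ π ∈ S.PiMat, ∀ q l, π q l ∈ S.PiSet
  GammaMat_mem : ∀ γ ∈ S.GammaMat, ∀ q l, γ q l ∈ S.GammaSet
  PiMat_compatible : ∀ π ∈ S.PiMat, S.design.Compatible π
  GammaMat_compatible : ∀ γ ∈ S.GammaMat, S.design.Compatible γ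
  true_mem : ((S.αs, S.βs), (S.πs, S.γs)) ∈ S.params

/-- The functions `f g` are probability densities, of laws without an atom at `0` (that is, on the
real line, with a distribution function that is continuous at `0`). -/
structure HasDensities [Zero 𝓧] (S : WeightedModel 𝓧 E) : Prop where
  measurable : ∀ g ∈ S.GammaSet, Measurable (S.f g)
  nonneg : ∀ g ∈ S.GammaSet, ∀ x, 0 ≤ S.f g x
  prob : ∀ g ∈ S.GammaSet, IsProbabilityMeasure (S.weightLaw g)
  no_atom : ∀ g ∈ S.GammaSet, S.weightLaw g {0} = 0

/-- The weights are identifiable from their law, and no two rows and no two columns of the matrix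
of the parameters `(π, γ)` are equal. -/
structure IsIdentifiable (S : WeightedModel 𝓧 E) : Prop where
  law_injective : Set.InjOn S.weightLaw S.GammaSet
  rows : ∀ π ∈ S.PiMat, ∀ γ ∈ S.GammaMat, ∀ q q', q ≠ q' →
    ∃ l, (π q l, γ q l) ≠ (π q' l, γ q' l)
  columns : ∀ π ∈ S.PiMat, ∀ γ ∈ S.GammaMat, ∀ l l', l ≠ l' →
    ∃ q, (π q l, γ q l) ≠ (π q l', γ q l')

/-- `Sig` is the group of the relabellings that leave the parameters invariant. -/
structure HasSymmetries (S : WeightedModel 𝓧 E) : Prop where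
  le : S.Sig ≤ S.design.relabellings
  invariant : ∀ g ∈ S.Sig, ∀ π ∈ S.PiMat, ∀ γ ∈ S.GammaMat,
    permuteMatrix g π = π ∧ permuteMatrix g γ = γ
  maximal : ∀ g ∈ S.design.relabellings, g ∉ S.Sig → ∀ π ∈ S.PiMat, ∀ γ ∈ S.GammaMat,
    ¬(permuteMatrix g π = π ∧ permuteMatrix g γ = γ)

/-- The divergences between the laws of the weights are bounded. -/
def HasBoundedKL (S : WeightedModel 𝓧 E) : Prop :=
  (⨆ g ∈ S.GammaSet, ⨆ g' ∈ S.GammaSet, S.weightKL g g') < ⊤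

/-- The log-likelihood ratio of two weights. -/
noncomputable def logRatio (S : WeightedModel 𝓧 E) (g g' : E) (x : 𝓧) : ℝ :=
  Real.log (S.f g x / S.f g' x)

/-- The Lipschitz condition on the densities of the weights. -/
def IsLipschitz [NormedAddCommGroup E] (S : WeightedModel 𝓧 E) : Prop :=
  0 < S.Ltil ∧ ∀ γ ∈ S.GammaMat, ∀ γ' ∈ S.GammaMat, ∀ q l q' l',
    Integrable (S.logRatio (γ q l) (γ' q l)) (S.weightLaw (γ q' l')) ∧
    |∫ x, S.logRatio (γ q l) (γ' q l) x ∂(S.weightLaw (γ q' l'))| ≤ S.Ltil * ‖γ - γ'‖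

/-- The log-likelihood ratio of the weights of the blocks `e` and `e'` under the parameter `γ`,
centered under the true law of the block `e`. -/
noncomputable def centeredLogRatio (S : WeightedModel 𝓧 E) (γ : Fin S.Q → Fin S.L → E)
    (e e' : Fin S.Q × Fin S.L) (x : 𝓧) : ℝ :=
  S.logRatio (γ e.1 e.2) (γ e'.1 e'.2) x -
    ∫ y, S.logRatio (γ e.1 e.2) (γ e'.1 e'.2) y ∂(S.weightLaw (S.γs e.1 e.2))

/-- The largest exponential moment at `λ` of the variables `Y` and `-Y`, where `Y` runs through the
centered log-likelihood ratios.  The law of an observation in the block `e`, given that it is not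
`0`, is `weightLaw (γs e)`. -/
noncomputable def expMoment (S : WeightedModel 𝓧 E) (lam : ℝ) : ℝ≥0∞ :=
  ⨆ γ ∈ S.GammaMat, ⨆ e : Fin S.Q × Fin S.L, ⨆ e' : Fin S.Q × Fin S.L,
    max (∫⁻ x, ENNReal.ofReal (Real.exp (lam * S.centeredLogRatio γ e e' x))
          ∂(S.weightLaw (S.γs e.1 e.2)))
        (∫⁻ x, ENNReal.ofReal (Real.exp (lam * -S.centeredLogRatio γ e e' x))
          ∂(S.weightLaw (S.γs e.1 e.2)))

/-- The rate function `sup_{λ ∈ I} (λ x - expMoment λ + 1)`. -/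
noncomputable def rateFunction (S : WeightedModel 𝓧 E) (I : Set ℝ) (x : ℝ) : EReal :=
  ⨆ lam ∈ I, (((lam * x + 1 : ℝ) : EReal) - (S.expMoment lam : EReal))

/-- The strengthened concentration assumption on the weights. -/
def HasConcentration (S : WeightedModel 𝓧 E) : Prop :=
  ∃ I : Set ℝ, I.OrdConnected ∧ I ⊆ Set.Ioi 0 ∧ ∀ x : ℝ, 0 < x → 0 < S.rateFunction I x

/-- The asymptotic setup. -/
structure IsSparse (S : WeightedModel 𝓧 E) : Prop where
  m_le : ∀ n, S.m n ≤ n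
  m_tendsto : Tendsto S.m atTop atTop
  ξ_pos : ∀ n, 0 < S.ξ n
  ξ_le : ∀ n, S.ξ n ≤ 1
  ξ_tendsto : Tendsto S.ξ atTop (𝓝 0)
  log_div : Tendsto (fun n : ℕ => Real.log n / (S.m n * S.ξ n)) atTop (𝓝 0)

/-! ### The conclusions at one configuration `u` and one array of observations `X` -/

/-- The two-sided bound for the log-ratio of posterior probabilities. -/
def RatioBounds [Zero 𝓧] [NormedAddCommGroup E] (S : WeightedModel 𝓧 E) (n : ℕ) (θ : S.Param)
    (u : S.Config n) (X : S.Data n) : Prop :=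
  ∀ v ∈ S.design.configs n, 0 < S.posterior n θ X v ∧
    ∀ g ∈ S.Sig, ∀ h, S.Attains u v h →
      S.ξ n * (S.c - 2 * S.L0 * ‖θ.2 - (S.πs, S.γs)‖) * S.weight u (relabel h v)
          - S.K * S.design.ham n (relabel g u) v
        ≤ Real.log (S.posterior n θ X (relabel g u) / S.posterior n θ X v) ∧
      Real.log (S.posterior n θ X (relabel g u) / S.posterior n θ X v)
        ≤ S.C n * S.weight u (relabel h v) + S.K * S.design.ham n (relabel g u) v

/-- The posterior probability of `u`, when there are no symmetries. -/
def TrivialBounds [Zero 𝓧] (S : WeightedModel 𝓧 E) (η : ℝ) (n : ℕ) (θ : S.Param)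
    (u : S.Config n) (X : S.Data n) : Prop :=
  1 - S.aSeq η n * Real.exp (S.aSeq η n) ≤ S.posterior n θ X u ∧
    (2 ≤ S.Q → S.posterior n θ X u ≤ (1 + S.bSeq n * Real.exp (S.bSeq n))⁻¹)

/-- The posterior probability of the class of `u`. -/
def ClassBounds [Zero 𝓧] (S : WeightedModel 𝓧 E) (η : ℝ) (n : ℕ) (θ : S.Param)
    (u : S.Config n) (X : S.Data n) : Prop :=
  1 - Nat.card S.Sig * (S.aSeq η n * Real.exp (S.aSeq η n)) ≤ S.classPosterior n θ X u ∧
    (2 ≤ S.Q → S.classPosterior n θ X u ≤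
      (1 + Nat.card S.Sig * (S.bSeq n * Real.exp (S.bSeq n)))⁻¹)

/-- All the configurations equivalent to `u` are equally likely. -/
def IsUniformOnClass [Zero 𝓧] (S : WeightedModel 𝓧 E) (n : ℕ) (θ : S.Param)
    (u : S.Config n) (X : S.Data n) : Prop :=
  S.posterior n θ X u = 1 / Nat.card S.Sig * S.classPosterior n θ X u

/-- `v` is a maximum a posteriori configuration. -/
def IsMAP [Zero 𝓧] (S : WeightedModel 𝓧 E) (n : ℕ) (θ : S.Param) (X : S.Data n)
    (v : S.Config n) : Prop :=
  v ∈ S.design.configs n ∧ ∀ v' ∈ S.design.configs n, S.posterior n θ X v' ≤ S.posterior n θ X v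

end WeightedModel

/-! ### Sums over labellings -/

/-! The log-likelihood ratio of the true configuration `u` against a competitor `v` is a sum over
the observed cells whose blocks differ, and there are at most `wt u v`, that is `m r₁ + n r₂`, of
these. The proof controls its mean and its fluctuations on the scale `ξ * wt`, uniformly in `v`, and
then sums the posterior ratios over all `v`.

Mean. A cell with different true block parameters contributes at least `ξ * separation`. Replacing
the true parameter by one at distance `d` costs at most `2 ξ L0 d` at each changed cell
(`blockMean_ge`), and no cell contributes more than `κMax` (`cellMean_le_κMax`). When all classes of
`u` are large and `v` is optimally relabelled, a fixed proportion of `wt` cells is separated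
(`card_separated_ge`). The combinatorial core is `exists_relabelling_of_card_diffCells_lt`: since
the rows and the columns of the parameter matrix are distinct, two labellings whose arrays differ in
few cells differ by a symmetry of the matrix, up to few errors.

Fluctuations. The log-ratio minus its mean splits into centered counts of nonzero entries with
bounded coefficients, and centered weight log-ratios counted at nonzero entries only
(`cellRatio_eq`). Zero inflation makes every exponential moment of the form `exp (O(ξ))`, so
Chernoff bounds each deviation of size `δ ξ wt` by `exp (-h ξ wt)`. The union over `v` factorizes
over rows and columns (`sum_exp_wt_le`) and is polynomially small because `log n = o(m ξ)`. The
random terms involve `γ` but neither `π` nor the proportions, so one event serves all of these at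
once.

Posterior. Changing one label changes the prior by a factor at most `exp K`. Summing the ratios over
all inequivalent configurations gives `a exp a`. In the other direction, the neighbours obtained by
changing one row label already carry enough mass for the bound with `b exp b`.

Constants. The mean is at least `28/25 c` on the scale `ξ wt`, the deviations take `3/50 c`, and the
last `3/50 c` above `c` absorbs the factor `Q + L`. The upper bound is proved with `3/4 C`, and the
rest of `C` absorbs `n` and the square of the number of symmetries. -/

theorem prod_ite_eq_pow_hammingDist {ι T : Type*} [Fintype ι] [DecidableEq T] (z z' : ι → T)
    (x : ℝ) : ∏ i, (if z i = z' i then 1 else x) = x ^ hammingDist z z' := by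
  rw [hammingDist, ← Finset.prod_const, Finset.prod_filter]
  exact Finset.prod_congr rfl fun i _ => by by_cases h : z i = z' i <;> simp [h]

theorem sum_prod_labelling {n k : ℕ} (f : Fin n → Fin k → ℝ) :
    ∑ z : Fin n → Fin k, ∏ i, f i (z i) = ∏ i, ∑ q, f i q := by
  rw [Finset.prod_univ_sum, Fintype.piFinset_univ]

/-- The sum factorizes over the indices; each one contributes `1 + (k - 1) x`, which is at most `exp
(k x)`. All sums over configurations below reduce to this. -/
theorem sum_pow_hammingDist_le {n k : ℕ} (z : Fin n → Fin k) {x : ℝ} (hx : 0 ≤ x) :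
    ∑ z' : Fin n → Fin k, x ^ hammingDist z z' ≤ Real.exp (k * (n * x)) := by
  have h : ∀ i, ∑ q, (if z i = q then 1 else x) ≤ Real.exp (k * x) := fun i => by
    calc ∑ q, (if z i = q then 1 else x) ≤ ∑ q, ((if z i = q then 1 else 0) + x) :=
          Finset.sum_le_sum fun q _ => by split_ifs <;> linarith
      _ = k * x + 1 := by simp [Finset.sum_add_distrib]; ring
      _ ≤ _ := Real.add_one_le_exp _
  calc ∑ z' : Fin n → Fin k, x ^ hammingDist z z'
      = ∏ i, ∑ q, (if z i = q then 1 else x) := by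
        rw [← sum_prod_labelling]
        exact Finset.sum_congr rfl fun z' _ => (prod_ite_eq_pow_hammingDist z z' x).symm
    _ ≤ ∏ _i : Fin n, Real.exp (k * x) :=
        Finset.prod_le_prod
          (fun i _ => Finset.sum_nonneg fun q _ => by split_ifs <;> linarith) fun i _ => h i
    _ = _ := by
        rw [Finset.prod_const, Finset.card_univ, Fintype.card_fin, ← Real.exp_nat_mul]
        ring_nf

theorem prod_le_prod_mul_pow_hammingDist {ι T : Type*} [Fintype ι] [DecidableEq T] (p : T → ℝ)
    (hp : ∀ q, 0 ≤ p q) {r : ℝ} (h : ∀ q q', p q ≤ p q' * r) (z z' : ι → T) :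
    ∏ i, p (z i) ≤ (∏ i, p (z' i)) * r ^ hammingDist z z' := by
  rw [← prod_ite_eq_pow_hammingDist, ← Finset.prod_mul_distrib]
  refine Finset.prod_le_prod (fun i _ => hp _) fun i _ => ?_
  split_ifs with hz
  · simp [hz]
  · exact h _ _

/-- The number of the indices with the label `q`. -/
def labelCount {n k : ℕ} (z : Fin n → Fin k) (q : Fin k) : ℕ :=
  (Finset.univ.filter fun i => z i = q).card

theorem prod_ite_eq_pow_labelCount {n k : ℕ} (z : Fin n → Fin k) (q : Fin k) (x : ℝ) :
    ∏ i, (if z i = q then x else 1) = x ^ labelCount z q := by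
  rw [labelCount, ← Finset.prod_const, Finset.prod_filter]

/-- Lower deviations of the number of indices with a given label. -/
theorem sum_prod_labelCount_lt_le {n k : ℕ} (p : Fin k → ℝ) (hp : ∀ q, 0 ≤ p q)
    (hsum : ∑ q, p q = 1) (q : Fin k) {μ : ℝ} (hμ : 0 ≤ μ) (hq : μ ≤ p q) :
    ∑ z : Fin n → Fin k with (labelCount z q : ℝ) < 19 / 20 * μ * n, ∏ i, p (z i) ≤
      Real.exp (-(μ * n / 2000)) := by
  -- With the tilt `1/50` the moment gains `49/2500` per unit of `μ n` and the threshold costs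
  -- `19/1000`. The difference `3/5000` exceeds `1/2000`.
  set l : ℝ := 1 / 50 with hl
  have hel : Real.exp (-l) ≤ 50 / 51 := by
    rw [Real.exp_neg]
    have := Real.add_one_le_exp l
    exact inv_le_of_inv_le₀ (by norm_num) (by rw [hl] at this ⊢; linarith)
  have step : ∀ z : Fin n → Fin k, (labelCount z q : ℝ) < 19 / 20 * μ * n →
      ∏ i, p (z i) ≤ Real.exp (l * (19 / 20 * μ * n)) *
        ∏ i, p (z i) * (if z i = q then Real.exp (-l) else 1) := fun z hz => by
    rw [Finset.prod_mul_distrib, prod_ite_eq_pow_labelCount, ← Real.exp_nat_mul, mul_left_comm,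
      ← Real.exp_add]
    refine le_mul_of_one_le_right (Finset.prod_nonneg fun i _ => hp _) (Real.one_le_exp ?_)
    rw [hl]; nlinarith
  have hone : ∑ q', p q' * (if q' = q then Real.exp (-l) else 1) ≤ Real.exp (-((49 / 2500) * μ)) := by
    have : ∑ q', p q' * (if q' = q then Real.exp (-l) else 1) =
        1 - p q * (1 - Real.exp (-l)) := by
      have h1 := hsum
      rw [← Finset.add_sum_erase _ p (Finset.mem_univ q)] at h1
      rw [← Finset.add_sum_erase _ _ (Finset.mem_univ q), if_pos rfl,
        Finset.sum_congr rfl (g := p) fun x hx => by rw [if_neg (Finset.ne_of_mem_erase hx), mul_one]]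
      linarith
    rw [this]
    refine le_trans ?_ (Real.add_one_le_exp _)
    have : (49 / 2500 : ℝ) ≤ 1 - Real.exp (-l) := by
      linarith
    nlinarith
  have hnn : ∀ q', 0 ≤ p q' * (if q' = q then Real.exp (-l) else 1) := fun q' =>
    mul_nonneg (hp _) (by split_ifs <;> positivity)
  calc _ ≤ ∑ z : Fin n → Fin k with (labelCount z q : ℝ) < 19 / 20 * μ * n,
        Real.exp (l * (19 / 20 * μ * n)) *
          ∏ i, p (z i) * (if z i = q then Real.exp (-l) else 1) :=
        Finset.sum_le_sum fun z hz => step z (Finset.mem_filter.1 hz).2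
    _ ≤ ∑ z : Fin n → Fin k, Real.exp (l * (19 / 20 * μ * n)) *
          ∏ i, p (z i) * (if z i = q then Real.exp (-l) else 1) :=
        Finset.sum_le_sum_of_subset_of_nonneg (Finset.filter_subset _ _) fun z _ _ =>
          mul_nonneg (Real.exp_nonneg _) (Finset.prod_nonneg fun i _ => hnn _)
    _ = Real.exp (l * (19 / 20 * μ * n)) *
          (∑ q', p q' * (if q' = q then Real.exp (-l) else 1)) ^ n := by
        rw [← Finset.mul_sum,
          sum_prod_labelling fun _ q' => p q' * (if q' = q then Real.exp (-l) else 1)]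
        simp
    _ ≤ Real.exp (l * (19 / 20 * μ * n)) * Real.exp (-((49 / 2500) * μ)) ^ n := by
        gcongr
        exact Finset.sum_nonneg fun q' _ => hnn q'
    _ = Real.exp (l * (19 / 20 * μ * n) + n * -((49 / 2500) * μ)) := by
        rw [← Real.exp_nat_mul, Real.exp_add]
    _ ≤ _ := by
        apply Real.exp_le_exp.2
        rw [hl]
        have : 0 ≤ μ * n := by positivity
        nlinarith

/-! ### Recovering a relabelling from an array with few differences -/

/-- Cells at which two pairs of labellings have different entries. -/
def diffCells {n m Q L : ℕ} {T : Type*} [DecidableEq T] (A : Fin Q → Fin L → T)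
    (u v : LabelPair Q L n m) : Finset (Fin n × Fin m) :=
  Finset.univ.filter fun p => A (u.1 p.1) (u.2 p.2) ≠ A (v.1 p.1) (v.2 p.2)

/-- In each column class take the column with the fewest differences. Since classes are large, these
columns together have differences in fewer than a third of `τ n` rows, the set `B`. A row outside
`B` reproduces a full row of `A` along the representatives, so the labels of `v` there define maps
`s` and `t` with `A (s q) (t l) = A q l`; distinctness of rows and columns makes both injective.
Rows outside `B` follow `s`, and a column that does not follow `t` disagrees on nearly a whole row
class, so such columns are few. -/
theorem exists_relabelling_of_card_diffCells_lt {n m Q L : ℕ} {T : Type*} [DecidableEq T]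
    (A : Fin Q → Fin L → T) (hrow : ∀ q q', q ≠ q' → ∃ l, A q l ≠ A q' l)
    (hcol : ∀ l l', l ≠ l' → ∃ q, A q l ≠ A q l') (u v : LabelPair Q L n m) {τ : ℝ} (hτ : 0 < τ)
    (hn : 0 < n) (hm : 0 < m) (hu1 : ∀ q, τ * n ≤ labelCount u.1 q)
    (hu2 : ∀ l, τ * m ≤ labelCount u.2 l)
    (hN : 3 * ((diffCells A u v).card : ℝ) < τ ^ 2 * (n * m)) :
    ∃ g : Equiv.Perm (Fin Q) × Equiv.Perm (Fin L), permuteMatrix g A = A ∧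
      (∀ q, 3 * hammingDist v.1 (relabel g u).1 < labelCount u.1 q) ∧
      (∀ l, 2 * hammingDist v.2 (relabel g u).2 < labelCount u.2 l) ∧
      τ * m * hammingDist v.1 (relabel g u).1 ≤ (diffCells A u v).card ∧
      2 * (τ * n * hammingDist v.2 (relabel g u).2) ≤ 3 * (diffCells A u v).card := by
  classical
  have hn' : (0 : ℝ) < n := by exact_mod_cast hn
  have hm' : (0 : ℝ) < m := by exact_mod_cast hm
  set N : ℝ := ((diffCells A u v).card : ℝ) with hNdef
  -- a representative column in each class
  let c : Fin L → Fin m → Finset (Fin n) := fun l j =>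
    Finset.univ.filter fun i => A (u.1 i) l ≠ A (v.1 i) (v.2 j)
  have hne : ∀ l, (Finset.univ.filter fun j => u.2 j = l).Nonempty := fun l => by
    rw [← Finset.card_pos]
    have := hu2 l
    have h2 : (0 : ℝ) < labelCount u.2 l := lt_of_lt_of_le (by positivity) this
    exact_mod_cast h2
  choose J hJmem hJmin using fun l => Finset.exists_min_image _ (fun j => (c l j).card) (hne l)
  have hJ : ∀ l, u.2 (J l) = l := fun l => (Finset.mem_filter.1 (hJmem l)).2
  have hcount : ∑ j, (c (u.2 j) j).card = (diffCells A u v).card := by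
    rw [diffCells, Finset.card_filter, ← Finset.univ_product_univ, Finset.sum_product_right]
    refine Finset.sum_congr rfl fun j _ => ?_
    rw [Finset.card_filter]
  have hsum : τ * m * ∑ l, ((c l (J l)).card : ℝ) ≤ N := by
    rw [hNdef, ← hcount, Finset.mul_sum]
    push_cast
    rw [← Finset.sum_fiberwise (s := Finset.univ) (g := u.2)]
    refine Finset.sum_le_sum fun l _ => ?_
    calc τ * m * ((c l (J l)).card : ℝ) ≤ labelCount u.2 l * ((c l (J l)).card : ℝ) := by
          gcongr; exact hu2 l
      _ = ∑ j with u.2 j = l, ((c l (J l)).card : ℝ) := by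
          rw [Finset.sum_const, nsmul_eq_mul]; rfl
      _ ≤ _ := Finset.sum_le_sum fun j hj => by
          have h1 := hJmin l j hj
          rw [(Finset.mem_filter.1 hj).2]
          exact_mod_cast h1
  let B : Finset (Fin n) := Finset.univ.biUnion fun l => c l (J l)
  have hB : τ * m * (B.card : ℝ) ≤ N := by
    refine le_trans ?_ hsum
    gcongr
    exact_mod_cast Finset.card_biUnion_le
  -- The factor 3 leaves at least two thirds of every row class outside `B`; this gives both a good
  -- representative row and the count in a bad column.
  have hB3 : 3 * (B.card : ℝ) < τ * n := by
    have : τ * m * (3 * (B.card : ℝ)) < τ * m * (τ * n) := by nlinarith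
    exact lt_of_mul_lt_mul_left this (by positivity)
  have hgood : ∀ i, i ∉ B → ∀ l, A (u.1 i) l = A (v.1 i) (v.2 (J l)) := fun i hi l => by
    by_contra h
    exact hi (Finset.mem_biUnion.2 ⟨l, Finset.mem_univ _, Finset.mem_filter.2 ⟨Finset.mem_univ _, h⟩⟩)
  have hrep : ∀ q, ∃ i, i ∉ B ∧ u.1 i = q := fun q => by
    by_contra! h
    have h1 : (Finset.univ.filter fun i => u.1 i = q) ⊆ B := fun i hi => by
      by_contra hiB
      exact h i hiB (Finset.mem_filter.1 hi).2
    have h2 : (labelCount u.1 q : ℝ) ≤ B.card := by exact_mod_cast Finset.card_le_card h1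
    have := hu1 q
    have hB0 : (0 : ℝ) ≤ B.card := by positivity
    linarith
  choose I hIB hI using hrep
  let s : Fin Q → Fin Q := fun q => v.1 (I q)
  let t : Fin L → Fin L := fun l => v.2 (J l)
  have hst : ∀ q l, A q l = A (s q) (t l) := fun q l => by
    have := hgood (I q) (hIB q) l
    rwa [hI] at this
  have hs : Function.Injective s := fun q q' h => by
    by_contra hne'
    obtain ⟨l, hl⟩ := hrow q q' hne'
    exact hl (by rw [hst q l, hst q' l, h])
  have ht : Function.Injective t := fun l l' h => by
    by_contra hne'
    obtain ⟨q, hq⟩ := hcol l l' hne'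
    exact hq (by rw [hst q l, hst q l', h])
  have htsurj := Finite.injective_iff_surjective.1 ht
  have hssurj := Finite.injective_iff_surjective.1 hs
  let g : Equiv.Perm (Fin Q) × Equiv.Perm (Fin L) :=
    (Equiv.ofBijective s ⟨hs, hssurj⟩, Equiv.ofBijective t ⟨ht, htsurj⟩)
  have hrowgood : ∀ i, i ∉ B → v.1 i = s (u.1 i) := fun i hi => by
    by_contra hne'
    obtain ⟨l, hl⟩ := hrow _ _ hne'
    obtain ⟨l', rfl⟩ := htsurj l
    exact hl (by rw [← hst, hgood i hi])
  have hR1 : hammingDist v.1 (relabel g u).1 ≤ B.card := by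
    refine Finset.card_le_card fun i hi => ?_
    by_contra hiB
    exact (Finset.mem_filter.1 hi).2 (hrowgood i hiB)
  have hR1' : ((hammingDist v.1 (relabel g u).1 : ℕ) : ℝ) ≤ B.card := by exact_mod_cast hR1
  -- a bad column has many differences
  have hbadcol : ∀ j, v.2 j ≠ (relabel g u).2 j →
      2 * (τ * n) ≤ 3 * ((c (u.2 j) j).card : ℝ) := fun j hj => by
    obtain ⟨q', hq'⟩ := hcol _ _ hj
    obtain ⟨q, rfl⟩ := hssurj q'
    have hsub : (Finset.univ.filter fun i => u.1 i = q) ⊆ B ∪ c (u.2 j) j := fun i hi => by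
      rw [Finset.mem_union]
      by_contra! h
      have hi' := (Finset.mem_filter.1 hi).2
      have h2 : A (u.1 i) (u.2 j) = A (v.1 i) (v.2 j) := by
        by_contra h3
        exact h.2 (Finset.mem_filter.2 ⟨Finset.mem_univ _, h3⟩)
      rw [hrowgood i h.1, hi'] at h2
      apply hq'
      rw [← h2]
      exact hst q (u.2 j)
    have h1 : (labelCount u.1 q : ℝ) ≤ B.card + (c (u.2 j) j).card := by
      exact_mod_cast (Finset.card_le_card hsub).trans (Finset.card_union_le _ _)
    have := hu1 q
    linarith
  have hR2 : 2 * (τ * n * hammingDist v.2 (relabel g u).2) ≤ 3 * N := by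
    rw [hNdef, ← hcount]
    push_cast
    calc 2 * (τ * n * (hammingDist v.2 (relabel g u).2 : ℝ))
        = ∑ j with v.2 j ≠ (relabel g u).2 j, 2 * (τ * n) := by
          rw [Finset.sum_const, nsmul_eq_mul, hammingDist]; ring
      _ ≤ ∑ j with v.2 j ≠ (relabel g u).2 j, 3 * ((c (u.2 j) j).card : ℝ) :=
          Finset.sum_le_sum fun j hj => hbadcol j (Finset.mem_filter.1 hj).2
      _ ≤ ∑ j, 3 * ((c (u.2 j) j).card : ℝ) :=
          Finset.sum_le_sum_of_subset_of_nonneg (Finset.filter_subset _ _) fun j _ _ => mul_nonneg (by norm_num) (Nat.cast_nonneg _)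
      _ = _ := by rw [Finset.mul_sum]
  refine ⟨g, ?_, fun q => ?_, fun l => ?_, ?_, hR2⟩
  · funext q l
    exact (hst q l).symm
  · have := hu1 q
    have h1 : ((3 * hammingDist v.1 (relabel g u).1 : ℕ) : ℝ) < labelCount u.1 q := by
      push_cast; linarith
    exact_mod_cast h1
  · have := hu2 l
    have h2 : τ * n * (2 * (hammingDist v.2 (relabel g u).2 : ℝ)) < τ * n * (τ * m) := by
      nlinarith
    have h3 := lt_of_lt_of_le (lt_of_mul_lt_mul_left h2 (by positivity)) this
    exact_mod_cast h3
  · refine le_trans ?_ hB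
    gcongr

/-! ### Relabellings of configurations -/

theorem relabel_mul {Q L n m : ℕ} (g h : Equiv.Perm (Fin Q) × Equiv.Perm (Fin L))
    (u : LabelPair Q L n m) : relabel (g * h) u = relabel g (relabel h u) := rfl

theorem relabel_one {Q L n m : ℕ} (u : LabelPair Q L n m) :
    relabel (1 : Equiv.Perm (Fin Q) × Equiv.Perm (Fin L)) u = u := rfl

theorem relabel_inv_relabel {Q L n m : ℕ} (g : Equiv.Perm (Fin Q) × Equiv.Perm (Fin L))
    (u : LabelPair Q L n m) : relabel g⁻¹ (relabel g u) = u := by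
  rw [← relabel_mul, inv_mul_cancel, relabel_one]

theorem relabel_relabel_inv {Q L n m : ℕ} (g : Equiv.Perm (Fin Q) × Equiv.Perm (Fin L))
    (u : LabelPair Q L n m) : relabel g (relabel g⁻¹ u) = u := by
  rw [← relabel_mul, mul_inv_cancel, relabel_one]

theorem relabel_injective {Q L n m : ℕ} (g : Equiv.Perm (Fin Q) × Equiv.Perm (Fin L)) :
    Function.Injective (relabel g : LabelPair Q L n m → LabelPair Q L n m) :=
  Function.LeftInverse.injective (relabel_inv_relabel g)

theorem hammingDist_relabel_fst {Q L n m : ℕ} (g : Equiv.Perm (Fin Q) × Equiv.Perm (Fin L))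
    (u v : LabelPair Q L n m) :
    hammingDist (relabel g u).1 (relabel g v).1 = hammingDist u.1 v.1 :=
  hammingDist_comp (fun _ => g.1) fun _ => g.1.injective

theorem hammingDist_relabel_snd {Q L n m : ℕ} (g : Equiv.Perm (Fin Q) × Equiv.Perm (Fin L))
    (u v : LabelPair Q L n m) :
    hammingDist (relabel g u).2 (relabel g v).2 = hammingDist u.2 v.2 :=
  hammingDist_comp (fun _ => g.2) fun _ => g.2.injective

theorem hammingDist_inv_relabel_fst {Q L n m : ℕ} (g : Equiv.Perm (Fin Q) × Equiv.Perm (Fin L))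
    (u v : LabelPair Q L n m) :
    hammingDist u.1 (relabel g⁻¹ v).1 = hammingDist v.1 (relabel g u).1 := by
  rw [← hammingDist_relabel_fst g, relabel_relabel_inv, hammingDist_comm]

theorem hammingDist_inv_relabel_snd {Q L n m : ℕ} (g : Equiv.Perm (Fin Q) × Equiv.Perm (Fin L))
    (u v : LabelPair Q L n m) :
    hammingDist u.2 (relabel g⁻¹ v).2 = hammingDist v.2 (relabel g u).2 := by
  rw [← hammingDist_relabel_snd g, relabel_relabel_inv, hammingDist_comm]

theorem permuteMatrix_apply_relabel {Q L n m : ℕ} {T : Type*}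
    (g : Equiv.Perm (Fin Q) × Equiv.Perm (Fin L))
    {A : Fin Q → Fin L → T} (h : permuteMatrix g A = A) (u : LabelPair Q L n m) (i : Fin n)
    (j : Fin m) : A ((relabel g u).1 i) ((relabel g u).2 j) = A (u.1 i) (u.2 j) :=
  congrFun (congrFun h (u.1 i)) (u.2 j)

theorem diffCells_relabel {Q L n m : ℕ} {T : Type*} [DecidableEq T]
    (g : Equiv.Perm (Fin Q) × Equiv.Perm (Fin L))
    {A : Fin Q → Fin L → T} (h : permuteMatrix g A = A) (u v : LabelPair Q L n m) :
    diffCells A u (relabel g v) = diffCells A u v :=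
  Finset.filter_congr fun p _ => by rw [permuteMatrix_apply_relabel g h]

/-- Agreement of two relabellings from the number of errors, in one coordinate. -/
theorem perm_eq_or_hammingDist_lt {n k : ℕ} (s s' : Equiv.Perm (Fin k)) (x y : Fin n → Fin k)
    (h : ∀ q, 2 * hammingDist y (fun i => s (x i)) < labelCount x q) :
    s = s' ∨ hammingDist y (fun i => s (x i)) < hammingDist y (fun i => s' (x i)) := by
  rw [or_iff_not_imp_left]
  intro hne
  obtain ⟨q, hq⟩ : ∃ q, s q ≠ s' q := by
    by_contra! h'
    exact hne (Equiv.ext h')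
  -- On a class where the two permutations differ, every index is an error of one of them.
  have hsub : (Finset.univ.filter fun i => x i = q) ⊆
      (Finset.univ.filter fun i => y i ≠ s (x i)) ∪ Finset.univ.filter fun i => y i ≠ s' (x i) := by
    intro i hi
    have hi := (Finset.mem_filter.1 hi).2
    rw [Finset.mem_union]
    by_contra! hh
    simp only [Finset.mem_filter, Finset.mem_univ, true_and, not_not, hi] at hh
    exact hq (hh.1.symm.trans hh.2)
  have h1 : labelCount x q ≤ hammingDist y (fun i => s (x i)) + hammingDist y (fun i => s' (x i)) :=
    (Finset.card_le_card hsub).trans (Finset.card_union_le _ _)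
  have := h q
  omega

/-! ### Observed cells separated by two configurations -/

namespace Design

variable {Q L : ℕ} {m : ℕ → ℕ}

/-- All classes have at least the proportion `τ` of the rows and of the columns. -/
def Balanced (τ : ℝ) {n m : ℕ} (u : LabelPair Q L n m) : Prop :=
  (∀ q, τ * n ≤ labelCount u.1 q) ∧ ∀ l, τ * m ≤ labelCount u.2 l

theorem relabel_mem_configs (D : Design Q L m) {n : ℕ}
    {g : Equiv.Perm (Fin Q) × Equiv.Perm (Fin L)} (hg : g ∈ D.relabellings)
    {u : LabelPair Q L n (m n)} (hu : u ∈ D.configs n) : relabel g u ∈ D.configs n := by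
  cases D with
  | lbm => simp [configs]
  | sbm G =>
    obtain ⟨s, rfl⟩ := hg
    simp only [configs, Finset.mem_filter, Finset.mem_univ, true_and] at hu ⊢
    simp [relabel, hu]

theorem ham_relabel (D : Design Q L m) {n : ℕ} (g : Equiv.Perm (Fin Q) × Equiv.Perm (Fin L))
    (u v : LabelPair Q L n (m n)) : D.ham n (relabel g u) (relabel g v) = D.ham n u v := by
  cases D with
  | lbm => simp only [ham, hammingDist_relabel_fst, hammingDist_relabel_snd]
  | sbm G => exact hammingDist_relabel_fst g u v

theorem ham_self (D : Design Q L m) {n : ℕ} (u : LabelPair Q L n (m n)) : D.ham n u u = 0 := by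
  cases D <;> simp [ham]

theorem ham_comm (D : Design Q L m) {n : ℕ} (u v : LabelPair Q L n (m n)) :
    D.ham n u v = D.ham n v u := by
  cases D <;> simp [ham, hammingDist_comm]

theorem ham_relabel_inv (D : Design Q L m) {n : ℕ} (g : Equiv.Perm (Fin Q) × Equiv.Perm (Fin L))
    (u v : LabelPair Q L n (m n)) : D.ham n (relabel g⁻¹ u) v = D.ham n u (relabel g v) := by
  rw [← ham_relabel D g, relabel_relabel_inv]

/-- `m r₁ + n r₂`. -/
def wt (_D : Design Q L m) {n : ℕ} (u v : LabelPair Q L n (m n)) : ℕ :=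
  m n * hammingDist u.1 v.1 + n * hammingDist u.2 v.2

/-- The observed cells at which the blocks of two configurations differ. -/
noncomputable def changed (D : Design Q L m) {n : ℕ} (u v : LabelPair Q L n (m n)) :
    Finset {p // p ∈ D.cells n} :=
  Finset.univ.filter fun p => (u.1 p.1.1, u.2 p.1.2) ≠ (v.1 p.1.1, v.2 p.1.2)

open scoped Classical in
/-- The observed cells at which the entries of a matrix differ. -/
noncomputable def separated (D : Design Q L m) {T : Type*} (A : Fin Q → Fin L → T) {n : ℕ}
    (u v : LabelPair Q L n (m n)) : Finset {p // p ∈ D.cells n} :=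
  Finset.univ.filter fun p => A (u.1 p.1.1) (u.2 p.1.2) ≠ A (v.1 p.1.1) (v.2 p.1.2)

open scoped Classical in
theorem mem_separated (D : Design Q L m) {T : Type*} (A : Fin Q → Fin L → T) {n : ℕ}
    (u v : LabelPair Q L n (m n)) (p : {p // p ∈ D.cells n}) : p ∈ D.separated A u v ↔
      A (u.1 p.1.1) (u.2 p.1.2) ≠ A (v.1 p.1.1) (v.2 p.1.2) := by
  rw [separated, Finset.mem_filter]
  exact and_iff_right (Finset.mem_univ _)

theorem card_changed_le (D : Design Q L m) {n : ℕ} (u v : LabelPair Q L n (m n)) :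
    (D.changed u v).card ≤ D.wt u v := by
  classical
  have h : (D.changed u v).map (Function.Embedding.subtype _) ⊆
      ((Finset.univ.filter fun i => u.1 i ≠ v.1 i) ×ˢ Finset.univ) ∪
        (Finset.univ ×ˢ Finset.univ.filter fun j => u.2 j ≠ v.2 j) := by
    intro p hp
    obtain ⟨p', hp', rfl⟩ := Finset.mem_map.1 hp
    have := (Finset.mem_filter.1 hp').2
    simp only [Finset.mem_union, Finset.mem_product, Finset.mem_filter, Finset.mem_univ, true_and,
      and_true, Function.Embedding.subtype_apply]
    by_contra! h'
    exact this (Prod.ext h'.1 h'.2)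
  have h2 := (Finset.card_le_card h).trans (Finset.card_union_le _ _)
  rw [Finset.card_map, Finset.card_product, Finset.card_product, Finset.card_univ,
    Finset.card_univ, Fintype.card_fin, Fintype.card_fin] at h2
  refine h2.trans (le_of_eq ?_)
  rw [wt, mul_comm]; rfl

open scoped Classical in
theorem separated_subset_changed (D : Design Q L m) {T : Type*} (A : Fin Q → Fin L → T) {n : ℕ}
    (u v : LabelPair Q L n (m n)) : D.separated A u v ⊆ D.changed u v := fun p hp => by
  refine Finset.mem_filter.2 ⟨Finset.mem_univ _, fun h => (Finset.mem_filter.1 hp).2 ?_⟩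
  rw [Prod.mk.injEq] at h
  rw [h.1, h.2]

open scoped Classical in
/-- Any configuration is separated from a balanced one, up to symmetries, by a proportion of the
cells. -/
theorem card_diffCells_ge (D : Design Q L m) {T : Type*} (A : Fin Q → Fin L → T)
    (hrow : ∀ q q', q ≠ q' → ∃ l, A q l ≠ A q' l) (hcol : ∀ l l', l ≠ l' → ∃ q, A q l ≠ A q l')
    (Sig : Subgroup (Equiv.Perm (Fin Q) × Equiv.Perm (Fin L)))
    (hinv : ∀ g ∈ Sig, permuteMatrix g A = A)
    (hSig : ∀ g ∈ D.relabellings, permuteMatrix g A = A → g ∈ Sig) {n : ℕ}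
    (u v : LabelPair Q L n (m n)) (hu : u ∈ D.configs n) (hv : v ∈ D.configs n) {τ : ℝ}
    (hτ : 0 < τ) (hτ1 : τ ≤ 1) (hn : 0 < n) (hm : 0 < m n) (hbal : Balanced τ u)
    (h : Equiv.Perm (Fin Q) × Equiv.Perm (Fin L))
    (hSh : h ∈ Sig) (hmin : ∀ g ∈ Sig,
      hammingDist u.1 (relabel h v).1 + hammingDist u.2 (relabel h v).2 ≤
      hammingDist u.1 (relabel g v).1 + hammingDist u.2 (relabel g v).2) :
    τ ^ 2 * D.wt u (relabel h v) ≤ 6 * ((diffCells A u v).card : ℝ) := by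
  have hn' : (0 : ℝ) < n := by exact_mod_cast hn
  have hm' : (0 : ℝ) < m n := by exact_mod_cast hm
  by_cases hN : 3 * ((diffCells A u v).card : ℝ) < τ ^ 2 * (n * m n)
  · obtain ⟨g, hgA, h1, h2, hR1, hR2⟩ := exists_relabelling_of_card_diffCells_lt A hrow hcol u v
      hτ hn hm hbal.1 hbal.2 hN
    have hgD : g ∈ D.relabellings := by
      cases D with
      | lbm => trivial
      | sbm G =>
        refine ⟨g.1, Prod.ext rfl ?_⟩
        change g.1 = g.2
        ext q
        simp only [configs, Finset.mem_filter, Finset.mem_univ, true_and] at hu hv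
        -- The row errors fill less than a third of the class and the column errors less than half,
        -- so some node of the class is correct in both coordinates. Both labellings are diagonal,
        -- so the two permutations agree on that class.
        obtain ⟨i, hi, hiR1, hiR2⟩ : ∃ i, u.1 i = q ∧ v.1 i = (relabel g u).1 i ∧
            v.2 i = (relabel g u).2 i := by
          by_contra! hcon
          have hsub : (Finset.univ.filter fun i => u.1 i = q) ⊆
              (Finset.univ.filter fun i => v.1 i ≠ (relabel g u).1 i) ∪
                Finset.univ.filter fun i => v.2 i ≠ (relabel g u).2 i := by
            intro i hi
            have hi := (Finset.mem_filter.1 hi).2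
            rw [Finset.mem_union, Finset.mem_filter, Finset.mem_filter]
            by_contra! hh
            simp only [Finset.mem_univ, forall_const] at hh
            exact hcon i hi hh.1 hh.2
          have h3 : labelCount u.1 q ≤ hammingDist v.1 (relabel g u).1 +
              hammingDist v.2 (relabel g u).2 :=
            (Finset.card_le_card hsub).trans (Finset.card_union_le _ _)
          have h4 := h1 q
          have h5 := h2 q
          rw [← hu] at h5
          omega
        have : g.1 (u.1 i) = g.2 (u.1 i) := by
          have h3 : g.1 (u.1 i) = v.1 i := hiR1.symm
          rw [h3, hv, hiR2, hu]
          rfl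
        rw [← hi, this]
    have hg : g ∈ Sig := hSig g hgD hgA
    -- Any relabelling other than the one found makes strictly more errors in a coordinate where it
    -- differs and no fewer in the other, so the minimizer is unique.
    have hh : h = g⁻¹ := by
      have hm1 := hmin g⁻¹ (inv_mem hg)
      have i1 := hammingDist_inv_relabel_fst h⁻¹ u v
      have i2 := hammingDist_inv_relabel_snd h⁻¹ u v
      rw [inv_inv] at i1 i2
      rw [i1, i2, hammingDist_inv_relabel_fst g u, hammingDist_inv_relabel_snd g u] at hm1
      have e1 := perm_eq_or_hammingDist_lt g.1 h⁻¹.1 u.1 v.1 fun q => lt_of_le_of_lt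
        (Nat.mul_le_mul_right _ (by norm_num)) (h1 q)
      have e2 := perm_eq_or_hammingDist_lt g.2 h⁻¹.2 u.2 v.2 h2
      have k1 : hammingDist v.1 (relabel g u).1 ≤ hammingDist v.1 (relabel h⁻¹ u).1 := by
        rcases e1 with e | e
        · simp only [relabel, e]; exact le_rfl
        · exact e.le
      have k2 : hammingDist v.2 (relabel g u).2 ≤ hammingDist v.2 (relabel h⁻¹ u).2 := by
        rcases e2 with e | e
        · simp only [relabel, e]; exact le_rfl
        · exact e.le
      have f1 : ¬ hammingDist v.1 (relabel g u).1 < hammingDist v.1 (relabel h⁻¹ u).1 := by omega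
      have f2 : ¬ hammingDist v.2 (relabel g u).2 < hammingDist v.2 (relabel h⁻¹ u).2 := by omega
      have e1' : g.1 = h⁻¹.1 := e1.resolve_right f1
      have e2' : g.2 = h⁻¹.2 := e2.resolve_right f2
      rw [Prod.ext e1' e2', inv_inv]
    rw [hh, wt, hammingDist_inv_relabel_fst, hammingDist_inv_relabel_snd]
    push_cast
    set N : ℝ := ((diffCells A u v).card : ℝ)
    have hN0 : 0 ≤ N := by positivity
    have a1 : τ * (τ * m n * hammingDist v.1 (relabel g u).1) ≤ 1 * N :=
      mul_le_mul hτ1 hR1 (by positivity) (by norm_num)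
    have a2 : τ * (2 * (τ * n * hammingDist v.2 (relabel g u).2)) ≤ 1 * (3 * N) :=
      mul_le_mul hτ1 hR2 (by positivity) (by norm_num)
    nlinarith
  -- Here at least `τ² n m / 3` cells differ, while the weight never exceeds `2 n m`; this is the
  -- source of the factor 6.
  · have h1 : hammingDist u.1 (relabel h v).1 ≤ n := by
      simpa using hammingDist_le_card_fintype (x := u.1) (y := (relabel h v).1)
    have h2 : hammingDist u.2 (relabel h v).2 ≤ m n := by
      simpa using hammingDist_le_card_fintype (x := u.2) (y := (relabel h v).2)
    have h3 : D.wt u (relabel h v) ≤ 2 * (n * m n) := by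
      rw [wt]
      nlinarith
    have h4 : (D.wt u (relabel h v) : ℝ) ≤ 2 * (n * m n) := by exact_mod_cast h3
    have h5 : τ ^ 2 * D.wt u (relabel h v) ≤ τ ^ 2 * (2 * (n * m n)) := by gcongr
    linarith

open scoped Classical in
-- In the latent block model every cell is observed. In the stochastic block model a differing cell
-- off the diagonal is observed itself or, by symmetry of the matrix, through its mirror image, so
-- at most a factor 2 is lost. Differing diagonal cells are at most as many as mislabelled nodes,
-- which is negligible once `50 ≤ μ² n`.
theorem card_separated_ge (D : Design Q L m) {T : Type*} (A : Fin Q → Fin L → T)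
    (hrow : ∀ q q', q ≠ q' → ∃ l, A q l ≠ A q' l) (hcol : ∀ l l', l ≠ l' → ∃ q, A q l ≠ A q l')
    (Sig : Subgroup (Equiv.Perm (Fin Q) × Equiv.Perm (Fin L)))
    (hinv : ∀ g ∈ Sig, permuteMatrix g A = A)
    (hSig : ∀ g ∈ D.relabellings, permuteMatrix g A = A → g ∈ Sig) (hA : D.Compatible A) {n : ℕ}
    (u v : LabelPair Q L n (m n)) (hu : u ∈ D.configs n) (hv : v ∈ D.configs n) {μ : ℝ}
    (hμ : 0 < μ) (hμ1 : μ ≤ 1) (hn : 0 < n) (hm : 0 < m n) (hμn : 50 ≤ μ ^ 2 * n)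
    (hbal : Balanced (19 / 20 * μ) u)
    (h : Equiv.Perm (Fin Q) × Equiv.Perm (Fin L))
    (hSh : h ∈ Sig) (hSh' : h ∈ D.relabellings) (hmin : ∀ g ∈ Sig,
      hammingDist u.1 (relabel h v).1 + hammingDist u.2 (relabel h v).2 ≤
      hammingDist u.1 (relabel g v).1 + hammingDist u.2 (relabel g v).2) :
    7 / 100 * μ ^ 2 * D.wt u (relabel h v) ≤ ((D.separated A u (relabel h v)).card : ℝ) := by
  have key := card_diffCells_ge D A hrow hcol Sig hinv hSig u v hu hv (τ := 19 / 20 * μ)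
    (by positivity) (by linarith) hn hm hbal h hSh hmin
  rw [← diffCells_relabel h (hinv h hSh)] at key
  have hv' : relabel h v ∈ D.configs n := relabel_mem_configs D hSh' hv
  generalize relabel h v = v' at key hv' ⊢
  have hw : (0 : ℝ) ≤ μ ^ 2 * D.wt u v' := by positivity
  cases D with
  | lbm =>
    have h1 : (diffCells A u v').card ≤ ((Design.lbm L m).separated A u v').card := by
      refine Finset.card_le_card_of_surjOn Subtype.val fun p hp => ?_
      exact ⟨⟨p, by simp [cells]⟩,
        Finset.mem_filter.2 ⟨Finset.mem_univ _, (Finset.mem_filter.1 hp).2⟩, rfl⟩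
    have h2 : ((diffCells A u v').card : ℝ) ≤ ((Design.lbm L m).separated A u v').card := by
      exact_mod_cast h1
    nlinarith
  | sbm G =>
    set S := ((Design.sbm G).separated A u v').map (Function.Embedding.subtype _) with hS
    simp only [configs, Finset.mem_filter, Finset.mem_univ, true_and] at hu hv'
    have memS : ∀ i j, G.Observed i j → A (u.1 i) (u.2 j) ≠ A (v'.1 i) (v'.2 j) →
        ((i, j) : Fin n × Fin n) ∈ S := fun i j hG hij => Finset.mem_map.2
      ⟨⟨(i, j), by simpa [cells] using hG⟩, Finset.mem_filter.2 ⟨Finset.mem_univ _, hij⟩, rfl⟩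
    have hsub : diffCells A u v' ⊆ (S ∪ S.map (Equiv.prodComm _ _).toEmbedding) ∪
        (Finset.univ.filter fun i => u.1 i ≠ v'.1 i).image fun i => (i, i) := by
      rintro ⟨i, j⟩ hp
      have hp : A (u.1 i) (u.2 j) ≠ A (v'.1 i) (v'.2 j) := (Finset.mem_filter.1 hp).2
      rw [Finset.mem_union, Finset.mem_union]
      by_cases hij : i = j
      · right
        subst hij
        refine Finset.mem_image.2 ⟨i, Finset.mem_filter.2 ⟨Finset.mem_univ _, fun hi => hp ?_⟩, rfl⟩
        rw [← hu, ← hv', hi]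
      · left
        by_cases hG : G.Observed i j
        · exact Or.inl (memS i j hG hp)
        · right
          have hU : G.IsUndirected ∧ G.Observed j i := by
            cases G <;> simp only [GraphKind.Observed, GraphKind.IsUndirected, not_true_eq_false,
              not_not, not_le, not_lt, true_and] at hG ⊢
            · exact absurd hG hij
            · exact hG.le
            · exact lt_of_le_of_ne hG (Ne.symm hij)
          refine Finset.mem_map.2 ⟨(j, i), memS j i hU.2 ?_, rfl⟩
          have hsymm : ∀ q l, A q l = A l q := hA hU.1
          rw [hsymm, hsymm (v'.1 j), ← hu, ← hv', hu, hv']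
          rw [← hu, ← hv'] at hp ⊢
          exact hp
    have h1 := (Finset.card_le_card hsub).trans ((Finset.card_union_le _ _).trans
      (add_le_add (Finset.card_union_le _ _) Finset.card_image_le))
    rw [Finset.card_map, hS, Finset.card_map, Finset.card_map] at h1
    change _ ≤ _ + _ + hammingDist u.1 v'.1 at h1
    have hr : (Design.sbm G).wt u v' = 2 * n * hammingDist u.1 v'.1 := by
      rw [wt, ← hu, ← hv']; ring
    have h2 : ((diffCells A u v').card : ℝ) ≤ ((Design.sbm G).separated A u v').card +
        ((Design.sbm G).separated A u v').card + hammingDist u.1 v'.1 := by exact_mod_cast h1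
    rw [hr] at key ⊢
    push_cast at key ⊢
    have h3 : (0 : ℝ) ≤ hammingDist u.1 v'.1 := by positivity
    -- With `r` mislabelled nodes, `wt = 2 n r` and `6 r ≤ 3/50 μ² wt`. The resulting constant
    -- `(361/400 - 3/50) / 12 = 337/4800` just exceeds `7/100`.
    have h4 : 50 * (hammingDist u.1 v'.1 : ℝ) ≤ μ ^ 2 * n * hammingDist u.1 v'.1 := by gcongr
    nlinarith

/-! ### Sums over configurations -/

/-- Both `wt` and `ham` are additive over the mislabelled rows and columns, so the sum over all
configurations factorizes, and the factor for each mislabelled index is the exponential occurring in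
`rate`. The subtracted 1 is the term `v = u`. With `K = 0` this is the union bound for the event;
with the true `K` it bounds the posterior mass of the other classes. -/
theorem sum_exp_wt_le (D : Design Q L m) {n : ℕ} {u : LabelPair Q L n (m n)} (hu : u ∈ D.configs n)
    (κ K : ℝ) :
    ∑ v ∈ D.configs n with v ≠ u, Real.exp (-(κ * D.wt u v) + K * D.ham n u v) ≤
      Real.exp ((Q + L) * D.rate n κ K) - 1 := by
  classical
  have h0 : ∑ v ∈ D.configs n with v ≠ u, Real.exp (-(κ * D.wt u v) + K * D.ham n u v) + 1 =
      ∑ v ∈ D.configs n, Real.exp (-(κ * D.wt u v) + K * D.ham n u v) := by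
    rw [← Finset.sum_filter_add_sum_filter_not (D.configs n) (fun v => v ≠ u)]
    congr 1
    have : (D.configs n).filter (fun v => ¬ v ≠ u) = {u} := by
      ext v
      simp only [Finset.mem_filter, not_not, Finset.mem_singleton]
      exact ⟨fun h => h.2, fun h => ⟨h ▸ hu, h⟩⟩
    rw [this, Finset.sum_singleton, ham_self]
    simp [wt]
  rw [le_sub_iff_add_le, h0]
  cases D with
  | lbm =>
    set x := Real.exp (-(κ * m n) + K)
    set y := Real.exp (-(κ * n) + K)
    have hterm : ∀ v : LabelPair Q L n (m n),
        Real.exp (-(κ * (Design.lbm L m).wt u v) + K * (Design.lbm L m).ham n u v) =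
          x ^ hammingDist u.1 v.1 * y ^ hammingDist u.2 v.2 := fun v => by
      rw [← Real.exp_nat_mul, ← Real.exp_nat_mul, ← Real.exp_add, wt, ham]
      push_cast
      ring_nf
    have hx : 0 ≤ x := Real.exp_nonneg _
    have hy : 0 ≤ y := Real.exp_nonneg _
    simp only [hterm]
    simp only [configs]
    rw [← Finset.univ_product_univ, Finset.sum_product]
    change ∑ z, ∑ w, x ^ hammingDist u.1 z * y ^ hammingDist u.2 w ≤ _
    rw [← Finset.sum_mul_sum]
    refine (mul_le_mul (sum_pow_hammingDist_le u.1 hx) (sum_pow_hammingDist_le u.2 hy)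
      (Finset.sum_nonneg fun _ _ => by positivity) (Real.exp_nonneg _)).trans ?_
    rw [← Real.exp_add]
    apply Real.exp_le_exp.2
    rw [rate]
    have e1 : 0 ≤ (n : ℝ) * x := by positivity
    have e2 : 0 ≤ (m n : ℝ) * y := by positivity
    have e3 : 0 ≤ (Q : ℝ) * (m n * y) := by positivity
    have e4 : 0 ≤ (L : ℝ) * (n * x) := by positivity
    nlinarith
  | sbm G =>
    set x := Real.exp (-(2 * κ * n) + K)
    have hx : 0 ≤ x := Real.exp_nonneg _
    have hbij : ∑ v ∈ (Design.sbm G).configs n,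
        Real.exp (-(κ * (Design.sbm G).wt u v) + K * (Design.sbm G).ham n u v) =
        ∑ z : Fin n → Fin Q, x ^ hammingDist u.1 z := by
      refine Finset.sum_bij' (fun v _ => v.1) (fun z _ => (z, z)) (fun _ _ => Finset.mem_univ _)
        (fun z _ => by simp [configs]) (fun v hv => ?_) (fun _ _ => rfl) fun v hv => ?_
      · simp only [configs, Finset.mem_filter, Finset.mem_univ, true_and] at hv
        exact Prod.ext rfl hv
      · simp only [configs, Finset.mem_filter, Finset.mem_univ, true_and] at hv hu
        rw [← Real.exp_nat_mul, wt, ham, ← hu, ← hv]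
        push_cast
        ring_nf
    rw [hbij]
    refine (sum_pow_hammingDist_le u.1 hx).trans (Real.exp_le_exp.2 ?_)
    rw [rate]
    have e1 : 0 ≤ (Q : ℝ) * (n * x) := by positivity
    linarith

end Design

/-! ### Elementary inequalities -/

/-- For `t ≤ 1` use `log (1/t) ≥ 2 (1 - t) / (1 + t)`. For `t ≥ 1`, `log t ≤ sinh (log t)` leaves
`(t - 1)² / (2 t)`, and `r² ≤ r ≤ 1/t`. -/
theorem half_sq_le_sub_one_sub_log {t r : ℝ} (ht : 0 < t) (hr : 0 ≤ r) (hr1 : r ≤ 1)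
    (htr : r * t ≤ 1) : 1 / 2 * r ^ 2 * (t - 1) ^ 2 ≤ t - 1 - Real.log t := by
  have hsq := sq_nonneg (t - 1)
  rcases le_total t 1 with h | h
  · have h1 : 0 ≤ 1 / t - 1 := by rw [sub_nonneg, le_div_iff₀ ht]; linarith
    have h2 := Real.le_log_one_add_of_nonneg h1
    rw [add_sub_cancel, one_div, Real.log_inv] at h2
    have h3 : 2 * (t⁻¹ - 1) / (t⁻¹ - 1 + 2) = 2 * (1 - t) / (1 + t) := by
      field_simp
      ring
    rw [h3] at h2
    have h4 : (1 - t) ^ 2 / 2 ≤ 2 * (1 - t) / (1 + t) - (1 - t) := by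
      have h5 : 2 * (1 - t) / (1 + t) - (1 - t) = (1 - t) ^ 2 / (1 + t) := by
        field_simp
        ring
      rw [h5]
      gcongr
      linarith
    have h6 : 1 / 2 * r ^ 2 * (t - 1) ^ 2 ≤ 1 / 2 * 1 * (t - 1) ^ 2 := by
      gcongr
      exact pow_le_one₀ hr hr1
    nlinarith
  · have h1 := Real.self_le_sinh_iff.2 (Real.log_nonneg h)
    rw [Real.sinh_eq, Real.exp_neg, Real.exp_log ht] at h1
    have h2 : t - 1 - (t - t⁻¹) / 2 = (t - 1) ^ 2 * t⁻¹ / 2 := by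
      field_simp
      ring
    have h3 : r ^ 2 ≤ t⁻¹ := by
      have : r ≤ t⁻¹ := by
        rw [← one_div, le_div_iff₀ ht]
        exact htr
      nlinarith
    have h4 : (t - 1) ^ 2 * r ^ 2 ≤ (t - 1) ^ 2 * t⁻¹ := by gcongr
    nlinarith

/-- The part of the log-likelihood ratio that comes from the presence of the entries. -/
noncomputable def presenceMean (ξ p x y : ℝ) : ℝ :=
  ξ * p * Real.log (x / y) + (1 - ξ * p) * Real.log ((1 - ξ * x) / (1 - ξ * y))

section Presence

variable {a ξ : ℝ}

theorem one_sub_mul_mem (ha : 0 < a) (hξ : 0 < ξ) (hξ1 : ξ ≤ 1) {x : ℝ}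
    (hx : x ∈ Set.Icc a (1 - a)) : a ≤ 1 - ξ * x ∧ 1 - ξ * x ≤ 1 := by
  have h1 := hx.1
  have h2 := hx.2
  have : 0 < x := by linarith
  constructor <;> nlinarith

/-- This is a Bernoulli divergence. By `log x ≤ x - 1` the absence term is at least `ξ (q - p)`, and
what remains is `ξ p (t - 1 - log t)` with `t = q / p`: the bound is of order `ξ`, not `ξ²`. -/
theorem presenceMean_self_ge (ha : 0 < a) (ha2 : a < 1 / 2) (hξ : 0 < ξ) (hξ1 : ξ ≤ 1) {p q : ℝ}
    (hp : p ∈ Set.Icc a (1 - a)) (hq : q ∈ Set.Icc a (1 - a)) :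
    ξ * (1 / 2 * (a / (1 - a)) ^ 2 * ((p - q) ^ 2 / p)) ≤ presenceMean ξ p p q := by
  have hp0 : 0 < p := lt_of_lt_of_le ha hp.1
  have hq0 : 0 < q := lt_of_lt_of_le ha hq.1
  have ha1 : 0 < 1 - a := by linarith
  obtain ⟨hp1, -⟩ := one_sub_mul_mem ha hξ hξ1 hp
  obtain ⟨hq1, -⟩ := one_sub_mul_mem ha hξ hξ1 hq
  have hp2 : 0 < 1 - ξ * p := by linarith
  have hq2 : 0 < 1 - ξ * q := by linarith
  have h1 : ξ * q - ξ * p ≤ - ((1 - ξ * p) * -Real.log ((1 - ξ * p) / (1 - ξ * q))) := by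
    have := Real.log_le_sub_one_of_pos (div_pos hq2 hp2)
    rw [← inv_div, Real.log_inv] at this
    have h2 := mul_le_mul_of_nonneg_left this hp2.le
    have h3 : (1 - ξ * p) * (((1 - ξ * p) / (1 - ξ * q))⁻¹ - 1) = ξ * p - ξ * q := by
      field_simp
      ring
    rw [h3] at h2
    linarith
  -- The choice `r = a / (1 - a)` is admissible since `q ≤ 1 - a` and `p ≥ a`.
  have h4 := half_sq_le_sub_one_sub_log (t := q / p) (r := a / (1 - a)) (div_pos hq0 hp0)
    (by positivity) (by rw [div_le_one ha1]; linarith) (by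
      rw [div_mul_div_comm, div_le_one (by positivity)]
      nlinarith [hp.1, hq.2])
  rw [← inv_div p q, Real.log_inv] at h4
  have h5 := mul_le_mul_of_nonneg_left h4 (mul_pos hξ hp0).le
  have h6 : ξ * p * (1 / 2 * (a / (1 - a)) ^ 2 * ((p / q)⁻¹ - 1) ^ 2) =
      ξ * (1 / 2 * (a / (1 - a)) ^ 2 * ((p - q) ^ 2 / p)) := by
    field_simp
    ring
  have h7 : ξ * p * ((p / q)⁻¹ - 1 - -Real.log (p / q)) =
      ξ * q - ξ * p + ξ * p * Real.log (p / q) := by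
    field_simp
    ring
  rw [h6, h7] at h5
  rw [presenceMean]
  linarith

/-- One of the two logarithms is nonnegative, according to the order of `x` and `y`. The other is
bounded by `log t ≥ 1 - 1/t`, and it carries a factor `ξ` in either case: as the probability of
presence, or through the difference of the absence probabilities. -/
theorem presenceMean_ge (ha : 0 < a) (hξ : 0 < ξ) (hξ1 : ξ ≤ 1) {p x y : ℝ}
    (hp : p ∈ Set.Icc a (1 - a)) (hx : x ∈ Set.Icc a (1 - a)) (hy : y ∈ Set.Icc a (1 - a)) :
    -(ξ * (a⁻¹ * |x - y|)) ≤ presenceMean ξ p x y := by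
  have hx0 : 0 < x := lt_of_lt_of_le ha hx.1
  have hy0 : 0 < y := lt_of_lt_of_le ha hy.1
  obtain ⟨hp1, hp2⟩ := one_sub_mul_mem ha hξ hξ1 hp
  obtain ⟨hx1, -⟩ := one_sub_mul_mem ha hξ hξ1 hx
  obtain ⟨hy1, -⟩ := one_sub_mul_mem ha hξ hξ1 hy
  have hp0 : 0 ≤ p := ha.le.trans hp.1
  have hp3 : p ≤ 1 := by linarith [hp.2]
  rw [presenceMean]
  rcases le_total y x with h | h
  · have h1 : 0 ≤ ξ * p * Real.log (x / y) :=
      mul_nonneg (by positivity) (Real.log_nonneg ((one_le_div hy0).2 h))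
    have h2 := Real.one_sub_inv_le_log_of_pos (x := (1 - ξ * x) / (1 - ξ * y))
      (div_pos (by linarith) (by linarith))
    have h3 : 1 - ((1 - ξ * x) / (1 - ξ * y))⁻¹ = -(ξ * (x - y) / (1 - ξ * x)) := by
      have : 1 - ξ * x ≠ 0 := by linarith
      rw [inv_div]
      field_simp
      ring
    have h4 : ξ * (x - y) / (1 - ξ * x) ≤ ξ * (x - y) / a :=
      div_le_div_of_nonneg_left (mul_nonneg hξ.le (sub_nonneg.2 h)) ha hx1
    have h5 : 0 ≤ ξ * (x - y) / a :=
      div_nonneg (mul_nonneg hξ.le (sub_nonneg.2 h)) ha.le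
    rw [abs_of_nonneg (sub_nonneg.2 h), show ξ * (a⁻¹ * (x - y)) = ξ * (x - y) / a by ring]
    rw [h3] at h2
    nlinarith
  · have h1 : 0 ≤ (1 - ξ * p) * Real.log ((1 - ξ * x) / (1 - ξ * y)) := by
      refine mul_nonneg (by linarith) (Real.log_nonneg ((one_le_div (by linarith)).2 ?_))
      nlinarith
    have h2 := Real.one_sub_inv_le_log_of_pos (x := x / y) (div_pos hx0 hy0)
    have h3 : 1 - (x / y)⁻¹ = -((y - x) / x) := by
      rw [inv_div]
      field_simp
      ring
    have h4 : (y - x) / x ≤ (y - x) / a := div_le_div_of_nonneg_left (sub_nonneg.2 h) ha hx.1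
    have h5 : 0 ≤ (y - x) / a := div_nonneg (sub_nonneg.2 h) ha.le
    rw [abs_of_nonpos (sub_nonpos.2 h), show ξ * (a⁻¹ * -(x - y)) = ξ * ((y - x) / a) by ring]
    rw [h3] at h2
    have h6 : ξ * p * -((y - x) / a) ≤ ξ * p * Real.log (x / y) :=
      mul_le_mul_of_nonneg_left (by linarith) (by positivity)
    have h7 : ξ * p * ((y - x) / a) ≤ ξ * 1 * ((y - x) / a) := by gcongr
    linarith

theorem presenceMean_decomp (ha : 0 < a) (hξ : 0 < ξ) (hξ1 : ξ ≤ 1) {p x y z : ℝ}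
    (hx : x ∈ Set.Icc a (1 - a)) (hy : y ∈ Set.Icc a (1 - a)) (hz : z ∈ Set.Icc a (1 - a)) :
    presenceMean ξ p x z = presenceMean ξ p x y + presenceMean ξ p y z := by
  have hx0 : x ≠ 0 := (lt_of_lt_of_le ha hx.1).ne'
  have hy0 : y ≠ 0 := (lt_of_lt_of_le ha hy.1).ne'
  have hz0 : z ≠ 0 := (lt_of_lt_of_le ha hz.1).ne'
  have hx1 : 1 - ξ * x ≠ 0 := (lt_of_lt_of_le ha (one_sub_mul_mem ha hξ hξ1 hx).1).ne'
  have hy1 : 1 - ξ * y ≠ 0 := (lt_of_lt_of_le ha (one_sub_mul_mem ha hξ hξ1 hy).1).ne'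
  have hz1 : 1 - ξ * z ≠ 0 := (lt_of_lt_of_le ha (one_sub_mul_mem ha hξ hξ1 hz).1).ne'
  simp only [presenceMean, Real.log_div hx0 hz0, Real.log_div hx0 hy0, Real.log_div hy0 hz0,
    Real.log_div hx1 hz1, Real.log_div hx1 hy1, Real.log_div hy1 hz1]
  ring

theorem abs_log_div_le (ha : 0 < a) {x y : ℝ} (hx : a ≤ x) (hx1 : x ≤ 1) (hy : a ≤ y)
    (hy1 : y ≤ 1) : |Real.log (x / y)| ≤ -Real.log a := by
  rw [Real.log_div (by linarith) (by linarith), abs_le]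
  have h1 := Real.log_le_log ha hx
  have h2 := Real.log_le_log ha hy
  have h3 := Real.log_nonpos (by linarith) hx1
  have h4 := Real.log_nonpos (by linarith) hy1
  constructor <;> linarith

end Presence

/-! ### Divergences -/

namespace WeightedModel

variable {𝓧 E : Type*} [MeasurableSpace 𝓧] {S : WeightedModel 𝓧 E}

theorem weightKL_ne_top (hKL : S.HasBoundedKL) {g g' : E} (hg : g ∈ S.GammaSet)
    (hg' : g' ∈ S.GammaSet) : S.weightKL g g' ≠ ⊤ := by
  refine (lt_of_le_of_lt ?_ hKL).ne
  exact le_iSup₂_of_le g hg (le_iSup₂_of_le g' hg' le_rfl)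

theorem weightKL_toReal_le (hKL : S.HasBoundedKL) {g g' : E} (hg : g ∈ S.GammaSet)
    (hg' : g' ∈ S.GammaSet) : (S.weightKL g g').toReal ≤
      (⨆ g ∈ S.GammaSet, ⨆ g' ∈ S.GammaSet, S.weightKL g g').toReal :=
  ENNReal.toReal_mono hKL.ne (le_iSup₂_of_le g hg (le_iSup₂_of_le g' hg' le_rfl))

theorem weightLaw_ac (hKL : S.HasBoundedKL) {g g' : E} (hg : g ∈ S.GammaSet)
    (hg' : g' ∈ S.GammaSet) : S.weightLaw g ≪ S.weightLaw g' :=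
  (InformationTheory.klDiv_ne_top_iff.1 (weightKL_ne_top hKL hg hg')).1

/-- Finite divergences in both directions make all weight laws mutually absolutely continuous, so
the logarithms of density ratios are meaningful under every law of the family. -/
theorem ae_density_pos [Zero 𝓧] (hdens : S.HasDensities) (hKL : S.HasBoundedKL) {g g' : E}
    (hg : g ∈ S.GammaSet) (hg' : g' ∈ S.GammaSet) : ∀ᵐ x ∂S.weightLaw g, 0 < S.f g' x := by
  refine (weightLaw_ac hKL hg hg').ae_le ?_
  refine (ae_withDensity_iff (hdens.measurable g' hg').ennreal_ofReal).2 ?_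
  exact Eventually.of_forall fun x hx => by
    by_contra h
    exact hx (ENNReal.ofReal_of_nonpos (not_lt.1 h))

/-- The chain rule for Radon-Nikodym derivatives through the base measure; it connects the explicit
densities with `klDiv`. -/
theorem logRatio_ae_eq_llr [Zero 𝓧] (hbase : SigmaFinite S.base) (hdens : S.HasDensities)
    (hKL : S.HasBoundedKL) {g g' : E} (hg : g ∈ S.GammaSet) (hg' : g' ∈ S.GammaSet) :
    S.logRatio g g' =ᵐ[S.weightLaw g] llr (S.weightLaw g) (S.weightLaw g') := by
  have := hdens.prob g hg
  have := hdens.prob g' hg'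
  have hac : S.weightLaw g ≪ S.base := withDensity_absolutelyContinuous _ _
  have h1 := hac.ae_le (Measure.rnDeriv_mul_rnDeriv (κ := S.base) (weightLaw_ac hKL hg hg'))
  have h2 := hac.ae_le
    (Measure.rnDeriv_withDensity S.base (hdens.measurable g hg).ennreal_ofReal)
  have h3 := hac.ae_le
    (Measure.rnDeriv_withDensity S.base (hdens.measurable g' hg').ennreal_ofReal)
  filter_upwards [h1, h2, h3, ae_density_pos hdens hKL hg hg', ae_density_pos hdens hKL hg hg]
    with x h1 h2 h3 h4 h5
  change _ * (S.weightLaw g').rnDeriv S.base x = _ at h1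
  rw [show (S.weightLaw g').rnDeriv S.base x = ENNReal.ofReal (S.f g' x) from h3,
    show (S.weightLaw g).rnDeriv S.base x = ENNReal.ofReal (S.f g x) from h2] at h1
  have h6 := congrArg ENNReal.toReal h1
  rw [ENNReal.toReal_mul, ENNReal.toReal_ofReal h4.le, ENNReal.toReal_ofReal h5.le] at h6
  rw [logRatio, llr, ← h6, mul_div_cancel_right₀ _ h4.ne']

theorem integrable_logRatio_self [Zero 𝓧] (hbase : SigmaFinite S.base) (hdens : S.HasDensities)
    (hKL : S.HasBoundedKL) {g g' : E} (hg : g ∈ S.GammaSet) (hg' : g' ∈ S.GammaSet) :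
    Integrable (S.logRatio g g') (S.weightLaw g) :=
  (integrable_congr (logRatio_ae_eq_llr hbase hdens hKL hg hg')).2
    (InformationTheory.klDiv_ne_top_iff.1 (weightKL_ne_top hKL hg hg')).2

theorem integral_logRatio_self [Zero 𝓧] (hbase : SigmaFinite S.base) (hdens : S.HasDensities)
    (hKL : S.HasBoundedKL) {g g' : E} (hg : g ∈ S.GammaSet) (hg' : g' ∈ S.GammaSet) :
    ∫ x, S.logRatio g g' x ∂S.weightLaw g = (S.weightKL g g').toReal := by
  have := hdens.prob g hg
  have := hdens.prob g' hg'
  rw [integral_congr_ae (logRatio_ae_eq_llr hbase hdens hKL hg hg'), weightKL,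
    InformationTheory.toReal_klDiv_of_measure_eq (weightLaw_ac hKL hg hg') (by simp)]

theorem logRatio_symm (g g' : E) (x : 𝓧) : S.logRatio g g' x = -S.logRatio g' g x := by
  rw [logRatio, logRatio, ← Real.log_inv, inv_div]

theorem logRatio_ae_decomp [Zero 𝓧] (hdens : S.HasDensities) (hKL : S.HasBoundedKL) {g₀ g g' g'' : E}
    (h₀ : g₀ ∈ S.GammaSet) (hg : g ∈ S.GammaSet) (hg' : g' ∈ S.GammaSet) (hg'' : g'' ∈ S.GammaSet) :
    S.logRatio g g'' =ᵐ[S.weightLaw g₀] fun x => S.logRatio g g' x + S.logRatio g' g'' x := by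
  filter_upwards [ae_density_pos hdens hKL h₀ hg, ae_density_pos hdens hKL h₀ hg',
    ae_density_pos hdens hKL h₀ hg''] with x h1 h2 h3
  rw [logRatio, logRatio, logRatio, Real.log_div h1.ne' h3.ne', Real.log_div h1.ne' h2.ne',
    Real.log_div h2.ne' h3.ne']
  ring

/-- The mean of a log-likelihood ratio as a difference of divergences. -/
theorem integral_logRatio [Zero 𝓧] (hbase : SigmaFinite S.base) (hdens : S.HasDensities)
    (hKL : S.HasBoundedKL) {g₀ g g' : E} (h₀ : g₀ ∈ S.GammaSet) (hg : g ∈ S.GammaSet)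
    (hg' : g' ∈ S.GammaSet) :
    ∫ x, S.logRatio g g' x ∂S.weightLaw g₀ =
      (S.weightKL g₀ g').toReal - (S.weightKL g₀ g).toReal := by
  rw [integral_congr_ae (logRatio_ae_decomp hdens hKL h₀ hg h₀ hg'),
    ← integral_logRatio_self hbase hdens hKL h₀ hg', ← integral_logRatio_self hbase hdens hKL h₀ hg]
  simp_rw [logRatio_symm g g₀]
  have h1 : Integrable (fun x => -S.logRatio g₀ g x) (S.weightLaw g₀) :=
    (integrable_logRatio_self hbase hdens hKL h₀ hg).neg
  rw [integral_add h1 (integrable_logRatio_self hbase hdens hKL h₀ hg'), integral_neg]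
  ring

theorem mem_Icc_of_mem_PiSet (hpar : S.IsParametrized) {p : ℝ} (hp : p ∈ S.PiSet) :
    p ∈ Set.Icc S.a (1 - S.a) := hpar.PiSet_subset hp

theorem mul_mem_Ioo (hpar : S.IsParametrized) {ξ p : ℝ} (hξ : 0 < ξ) (hξ1 : ξ ≤ 1)
    (hp : p ∈ S.PiSet) : 0 < ξ * p ∧ ξ * p < 1 := by
  have h := mem_Icc_of_mem_PiSet hpar hp
  have h1 := one_sub_mul_mem hpar.a_pos hξ hξ1 h
  have h2 := hpar.a_pos
  exact ⟨mul_pos hξ (lt_of_lt_of_le h2 h.1), by linarith [h1.1]⟩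

theorem presenceMean_le_of_mem (hpar : S.IsParametrized) {ξ p x y : ℝ} (hξ : 0 < ξ) (hξ1 : ξ ≤ 1)
    (hp : p ∈ S.PiSet) (hx : x ∈ S.PiSet) (hy : y ∈ S.PiSet) :
    presenceMean ξ p x y ≤ 2 * -Real.log S.a := by
  have ha := hpar.a_pos
  have ha2 := hpar.a_lt
  have hx' := mem_Icc_of_mem_PiSet hpar hx
  have hy' := mem_Icc_of_mem_PiSet hpar hy
  have h1 := (abs_le.1 (abs_log_div_le ha hx'.1 (by linarith [hx'.2]) hy'.1
    (by linarith [hy'.2]))).2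
  have hx2 := one_sub_mul_mem ha hξ hξ1 hx'
  have hy2 := one_sub_mul_mem ha hξ hξ1 hy'
  have h2 := (abs_le.1 (abs_log_div_le ha hx2.1 hx2.2 hy2.1 hy2.2)).2
  obtain ⟨h3, h4⟩ := mul_mem_Ioo hpar hξ hξ1 hp
  have h5 : 0 ≤ -Real.log S.a := by
    have := Real.log_nonpos ha.le (by linarith)
    linarith
  rw [presenceMean]
  nlinarith

variable [Zero 𝓧]

theorem weightLaw_ae_ne_zero (hdens : S.HasDensities) {g : E} (hg : g ∈ S.GammaSet) :
    ∀ᵐ x ∂S.weightLaw g, x ≠ 0 := by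
  rw [ae_iff]
  simpa using hdens.no_atom g hg

theorem isProbabilityMeasure_mixLaw (hdens : S.HasDensities) {g : E} (hg : g ∈ S.GammaSet) {p : ℝ}
    (hp : 0 ≤ p) (hp1 : p ≤ 1) : IsProbabilityMeasure (S.mixLaw p g) := by
  have := hdens.prob g hg
  refine ⟨?_⟩
  simp only [mixLaw, Measure.add_apply, Measure.smul_apply, measure_univ, smul_eq_mul, mul_one]
  rw [← ENNReal.ofReal_add hp (by linarith), add_sub_cancel, ENNReal.ofReal_one]

variable [MeasurableSingletonClass 𝓧]

/-- The weight laws do not charge 0, so the density with respect to the other mixture can be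
computed separately at the atom and away from it. -/
theorem mixLaw_eq_withDensity (hdens : S.HasDensities) (hKL : S.HasBoundedKL) {g g' : E}
    (hg : g ∈ S.GammaSet) (hg' : g' ∈ S.GammaSet) {p p' : ℝ} (hp' : 0 < p')
    (hp1' : p' < 1) {F : 𝓧 → ℝ≥0∞} (hF0 : F 0 = ENNReal.ofReal ((1 - p) / (1 - p')))
    (hF : ∀ x, x ≠ 0 → F x = ENNReal.ofReal (p / p') *
      (S.weightLaw g).rnDeriv (S.weightLaw g') x) :
    S.mixLaw p g = (S.mixLaw p' g').withDensity F := by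
  have := hdens.prob g hg
  have := hdens.prob g' hg'
  have hW : (S.weightLaw g').withDensity F = ENNReal.ofReal (p / p') • S.weightLaw g := by
    rw [withDensity_congr_ae (g := ENNReal.ofReal (p / p') •
      (S.weightLaw g).rnDeriv (S.weightLaw g')), withDensity_smul _ (Measure.measurable_rnDeriv _ _),
      Measure.withDensity_rnDeriv_eq _ _ (weightLaw_ac hKL hg hg')]
    filter_upwards [weightLaw_ae_ne_zero hdens hg'] with x hx
    rw [hF x hx]; rfl
  have hd : (Measure.dirac (0 : 𝓧)).withDensity F =
      ENNReal.ofReal ((1 - p) / (1 - p')) • Measure.dirac 0 := by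
    rw [withDensity_congr_ae (g := fun _ => ENNReal.ofReal ((1 - p) / (1 - p'))),
      withDensity_const]
    rw [ae_dirac_eq]
    exact hF0
  have h1 : 0 < 1 - p' := by linarith
  rw [mixLaw, mixLaw, withDensity_add_measure, withDensity_smul_measure, withDensity_smul_measure, hW,
    hd, smul_smul, smul_smul, ← ENNReal.ofReal_mul hp'.le, ← ENNReal.ofReal_mul h1.le,
    mul_div_cancel₀ _ hp'.ne', mul_div_cancel₀ _ h1.ne']

theorem integral_mixLaw {g : E} {p : ℝ} (hp : 0 ≤ p) (hp1 : p ≤ 1) {G : 𝓧 → ℝ}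
    (hG : Integrable G (S.weightLaw g)) : Integrable G (S.mixLaw p g) ∧
      ∫ x, G x ∂S.mixLaw p g = p * ∫ x, G x ∂S.weightLaw g + (1 - p) * G 0 := by
  have h1 : Integrable G (ENNReal.ofReal p • S.weightLaw g) :=
    hG.smul_measure ENNReal.ofReal_ne_top
  have h2 : Integrable G (ENNReal.ofReal (1 - p) • Measure.dirac (0 : 𝓧)) :=
    (integrable_dirac (by simp)).smul_measure ENNReal.ofReal_ne_top
  refine ⟨h1.add_measure h2, ?_⟩
  rw [mixLaw, integral_add_measure h1 h2, integral_smul_measure, integral_smul_measure,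
    integral_dirac, ENNReal.toReal_ofReal hp, ENNReal.toReal_ofReal (by linarith), smul_eq_mul,
    smul_eq_mul]

/-- The divergence between two zero-inflated laws. -/
theorem klDiv_mixLaw (hdens : S.HasDensities) (hKL : S.HasBoundedKL) {g g' : E}
    (hg : g ∈ S.GammaSet) (hg' : g' ∈ S.GammaSet) {p p' : ℝ} (hp : 0 < p) (hp1 : p < 1)
    (hp' : 0 < p') (hp1' : p' < 1) :
    InformationTheory.klDiv (S.mixLaw p g) (S.mixLaw p' g') ≠ ⊤ ∧
    (InformationTheory.klDiv (S.mixLaw p g) (S.mixLaw p' g')).toReal =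
      p * Real.log (p / p') + (1 - p) * Real.log ((1 - p) / (1 - p')) +
        p * (S.weightKL g g').toReal := by
  classical
  have := hdens.prob g hg
  have := hdens.prob g' hg'
  have := isProbabilityMeasure_mixLaw hdens hg hp.le hp1.le
  have := isProbabilityMeasure_mixLaw hdens hg' hp'.le hp1'.le
  set r := (S.weightLaw g).rnDeriv (S.weightLaw g')
  set F : 𝓧 → ℝ≥0∞ := fun x => if x = 0 then ENNReal.ofReal ((1 - p) / (1 - p')) else
    ENNReal.ofReal (p / p') * r x with hFdef
  have hF0 : F 0 = ENNReal.ofReal ((1 - p) / (1 - p')) := if_pos rfl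
  have hFx : ∀ x, x ≠ 0 → F x = ENNReal.ofReal (p / p') * r x := fun x hx => if_neg hx
  have hFm : Measurable F := Measurable.ite (measurableSet_singleton 0) measurable_const
    ((Measure.measurable_rnDeriv _ _).const_mul _)
  have heq := mixLaw_eq_withDensity hdens hKL hg hg' hp' hp1' hF0 hFx
  have hac : S.mixLaw p g ≪ S.mixLaw p' g' := by
    rw [heq]; exact withDensity_absolutelyContinuous _ _
  have hllr : llr (S.mixLaw p g) (S.mixLaw p' g') =ᵐ[S.mixLaw p g]
      fun x => Real.log (F x).toReal := by
    have h1 := Measure.rnDeriv_withDensity (S.mixLaw p' g') hFm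
    rw [← heq] at h1
    filter_upwards [hac.ae_le h1] with x hx
    rw [llr, hx]
  have hW : (fun x => Real.log (F x).toReal) =ᵐ[S.weightLaw g]
      fun x => Real.log (p / p') + llr (S.weightLaw g) (S.weightLaw g') x := by
    have hacW := weightLaw_ac hKL hg hg'
    filter_upwards [weightLaw_ae_ne_zero hdens hg, Measure.rnDeriv_pos hacW,
      hacW.ae_le (Measure.rnDeriv_lt_top (S.weightLaw g) (S.weightLaw g'))] with x hx h1 h2
    rw [hFx x hx, ENNReal.toReal_mul, ENNReal.toReal_ofReal (by positivity),
      Real.log_mul (by positivity) (ENNReal.toReal_pos h1.ne' h2.ne).ne', llr]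
  have hint : Integrable (llr (S.weightLaw g) (S.weightLaw g')) (S.weightLaw g) :=
    (InformationTheory.klDiv_ne_top_iff.1 (weightKL_ne_top hKL hg hg')).2
  have hWint : Integrable (fun x => Real.log (F x).toReal) (S.weightLaw g) :=
    (integrable_congr hW).2 ((integrable_const _).add hint)
  obtain ⟨h1, h2⟩ := integral_mixLaw hp.le hp1.le hWint
  refine ⟨InformationTheory.klDiv_ne_top hac ((integrable_congr hllr).2 h1), ?_⟩
  rw [InformationTheory.toReal_klDiv_of_measure_eq hac (by simp), integral_congr_ae hllr, h2,
    integral_congr_ae hW, integral_add (integrable_const _) hint, hF0, weightKL,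
    InformationTheory.toReal_klDiv_of_measure_eq (weightLaw_ac hKL hg hg') (by simp),
    ENNReal.toReal_ofReal (div_nonneg (by linarith) (by linarith))]
  simp only [integral_const, probReal_univ, smul_eq_mul, one_mul]
  ring

/-- The mean of the log-likelihood ratio of an observation under the law of density `ξ p` and
weight `g₀`, for the blocks with parameters `(x, g)` and `(x', g')`. -/
noncomputable def cellMean (S : WeightedModel 𝓧 E) (ξ p : ℝ) (g₀ : E) (x : ℝ) (g : E) (x' : ℝ)
    (g' : E) : ℝ :=
  presenceMean ξ p x x' + ξ * p * ∫ y, S.logRatio g g' y ∂S.weightLaw g₀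

theorem klDiv_mixLaw_toReal (hpar : S.IsParametrized) (hdens : S.HasDensities)
    (hKL : S.HasBoundedKL) {g g' : E} (hg : g ∈ S.GammaSet) (hg' : g' ∈ S.GammaSet) {ξ p p' : ℝ}
    (hξ : 0 < ξ) (hξ1 : ξ ≤ 1) (hp : p ∈ S.PiSet) (hp' : p' ∈ S.PiSet) :
    InformationTheory.klDiv (S.mixLaw (ξ * p) g) (S.mixLaw (ξ * p') g') ≠ ⊤ ∧
    (InformationTheory.klDiv (S.mixLaw (ξ * p) g) (S.mixLaw (ξ * p') g')).toReal =
      presenceMean ξ p p p' + ξ * p * (S.weightKL g g').toReal := by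
  obtain ⟨h1, h2⟩ := mul_mem_Ioo hpar hξ hξ1 hp
  obtain ⟨h3, h4⟩ := mul_mem_Ioo hpar hξ hξ1 hp'
  obtain ⟨h5, h6⟩ := klDiv_mixLaw hdens hKL hg hg' h1 h2 h3 h4
  refine ⟨h5, h6.trans ?_⟩
  rw [presenceMean, mul_div_mul_left _ _ hξ.ne']

/-- The largest divergence between the zero-inflated laws is finite. -/
theorem klDiv_mixLaw_le_κMax (hpar : S.IsParametrized) (hdens : S.HasDensities)
    (hKL : S.HasBoundedKL) (hsparse : S.IsSparse) (n : ℕ) {g g' : E} (hg : g ∈ S.GammaSet)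
    (hg' : g' ∈ S.GammaSet) {p p' : ℝ} (hp : p ∈ S.PiSet) (hp' : p' ∈ S.PiSet) :
    presenceMean (S.ξ n) p p p' + S.ξ n * p * (S.weightKL g g').toReal ≤ S.κMax n := by
  have hξ := hsparse.ξ_pos n
  have hξ1 := hsparse.ξ_le n
  rw [← (klDiv_mixLaw_toReal hpar hdens hKL hg hg' hξ hξ1 hp hp').2]
  -- `κMax` is a `toReal`, which would be 0 for an infinite supremum, so finiteness has to be
  -- checked. The uniform bound is `-2 log a` plus the largest weight divergence.
  refine ENNReal.toReal_mono (ne_of_lt ?_) ?_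
  · refine lt_of_le_of_lt (b := ENNReal.ofReal (2 * -Real.log S.a +
      (⨆ g ∈ S.GammaSet, ⨆ g' ∈ S.GammaSet, S.weightKL g g').toReal)) ?_ ENNReal.ofReal_lt_top
    refine iSup₂_le fun p hp => iSup₂_le fun p' hp' => iSup₂_le fun g hg => iSup₂_le fun g' hg' => ?_
    obtain ⟨h1, h2⟩ := klDiv_mixLaw_toReal hpar hdens hKL hg hg' hξ hξ1 hp hp'
    rw [← ENNReal.ofReal_toReal h1, h2]
    refine ENNReal.ofReal_le_ofReal ?_
    have h3 := presenceMean_le_of_mem hpar hξ hξ1 hp hp hp'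
    have h4 := weightKL_toReal_le hKL hg hg'
    obtain ⟨h5, h6⟩ := mul_mem_Ioo hpar hξ hξ1 hp
    have h7 : 0 ≤ (S.weightKL g g').toReal := ENNReal.toReal_nonneg
    nlinarith
  · exact le_iSup₂_of_le p hp <| le_iSup₂_of_le p' hp' <| le_iSup₂_of_le g hg <|
      le_iSup₂_of_le g' hg' le_rfl

/-- The mean of the log-ratio of `P` and `P'` under a third law `P₀` is `D(P₀‖P') - D(P₀‖P)`.
Dropping the subtracted divergence leaves one that `κMax` dominates. -/
theorem cellMean_le_κMax (hbase : SigmaFinite S.base) (hpar : S.IsParametrized)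
    (hdens : S.HasDensities)
    (hKL : S.HasBoundedKL) (hsparse : S.IsSparse) (n : ℕ) {g₀ g g' : E} (h₀ : g₀ ∈ S.GammaSet)
    (hg : g ∈ S.GammaSet) (hg' : g' ∈ S.GammaSet) {p x x' : ℝ} (hp : p ∈ S.PiSet)
    (hx : x ∈ S.PiSet) (hx' : x' ∈ S.PiSet) :
    S.cellMean (S.ξ n) p g₀ x g x' g' ≤ S.κMax n := by
  have hξ := hsparse.ξ_pos n
  have hξ1 := hsparse.ξ_le n
  have ha := hpar.a_pos
  refine le_trans ?_ (klDiv_mixLaw_le_κMax hpar hdens hKL hsparse n h₀ hg' hp hx')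
  have h1 := (klDiv_mixLaw_toReal hpar hdens hKL h₀ hg hξ hξ1 hp hx).2
  have h2 : 0 ≤ presenceMean (S.ξ n) p p x + S.ξ n * p * (S.weightKL g₀ g).toReal := by
    rw [← h1]; exact ENNReal.toReal_nonneg
  rw [cellMean, integral_logRatio hbase hdens hKL h₀ hg hg',
    presenceMean_decomp ha hξ hξ1 (p := p) (mem_Icc_of_mem_PiSet hpar hp)
      (mem_Icc_of_mem_PiSet hpar hx) (mem_Icc_of_mem_PiSet hpar hx')]
  linarith

end WeightedModel

/-! ### Mean log-likelihood ratios of blocks -/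

namespace WeightedModel

variable {𝓧 E : Type*} [MeasurableSpace 𝓧] {S : WeightedModel 𝓧 E}

theorem true_mem_PiSet (hpar : S.IsParametrized) (q : Fin S.Q) (l : Fin S.L) :
    S.πs q l ∈ S.PiSet := hpar.PiMat_mem _ hpar.true_mem.2.1 q l

theorem true_mem_GammaSet (hpar : S.IsParametrized) (q : Fin S.Q) (l : Fin S.L) :
    S.γs q l ∈ S.GammaSet := hpar.GammaMat_mem _ hpar.true_mem.2.2 q l

variable [Zero 𝓧]

/-- The mean of the log-likelihood ratio of an observation in the block `e`, for the blocks `e`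
and `e'`, under the parameter `(π, γ)`. -/
noncomputable def blockMean (S : WeightedModel 𝓧 E) (n : ℕ) (π : Fin S.Q → Fin S.L → ℝ)
    (γ : Fin S.Q → Fin S.L → E) (e e' : Fin S.Q × Fin S.L) : ℝ :=
  S.cellMean (S.ξ n) (S.πs e.1 e.2) (S.γs e.1 e.2) (π e.1 e.2) (γ e.1 e.2) (π e'.1 e'.2)
    (γ e'.1 e'.2)

/-- Pass from `(π, γ)` to the true parameter in each of the two blocks. At the truth the mean is a
divergence, at least `ξ` times the gap because the true `π` is at least `a`. Each of the two
replacements costs `ξ d / a` for the presence and `ξ Ltil d` for the weights, together `ξ L0 d`. -/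
theorem blockMean_ge [NormedAddCommGroup E] (hbase : SigmaFinite S.base) (hpar : S.IsParametrized)
    (hdens : S.HasDensities) (hKL : S.HasBoundedKL) (hLip : S.IsLipschitz) (hsparse : S.IsSparse)
    (n : ℕ) {π : Fin S.Q → Fin S.L → ℝ} {γ : Fin S.Q → Fin S.L → E} (hπ : π ∈ S.PiMat)
    (hγ : γ ∈ S.GammaMat) (e e' : Fin S.Q × Fin S.L) :
    S.ξ n * (S.sparsityGap e e' + S.a * S.weightGap e e') -
      2 * (S.ξ n * (S.L0 * ‖((π, γ) : _ × _) - (S.πs, S.γs)‖)) ≤ S.blockMean n π γ e e' := by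
  set d := ‖((π, γ) : _ × _) - (S.πs, S.γs)‖ with hd
  have ha := hpar.a_pos
  have hξ := hsparse.ξ_pos n
  have hξ1 := hsparse.ξ_le n
  have hdπ : ∀ q l, |π q l - S.πs q l| ≤ d := fun q l =>
    ((norm_le_pi_norm ((π - S.πs) q) l).trans (norm_le_pi_norm (π - S.πs) q)).trans
      (norm_fst_le ((π, γ) - (S.πs, S.γs)))
  have hdγ : ‖γ - S.γs‖ ≤ d := norm_snd_le ((π, γ) - (S.πs, S.γs))
  have mem : ∀ q l, π q l ∈ Set.Icc S.a (1 - S.a) := fun q l =>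
    mem_Icc_of_mem_PiSet hpar (hpar.PiMat_mem _ hπ q l)
  have mems : ∀ q l, S.πs q l ∈ Set.Icc S.a (1 - S.a) := fun q l =>
    mem_Icc_of_mem_PiSet hpar (true_mem_PiSet hpar q l)
  have memγ : ∀ q l, γ q l ∈ S.GammaSet := fun q l => hpar.GammaMat_mem _ hγ q l
  have memγs := true_mem_GammaSet hpar
  -- presence
  set p := S.πs e.1 e.2
  have hpres : presenceMean (S.ξ n) p (π e.1 e.2) (π e'.1 e'.2) =
      presenceMean (S.ξ n) p (π e.1 e.2) p + presenceMean (S.ξ n) p p (S.πs e'.1 e'.2) +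
        presenceMean (S.ξ n) p (S.πs e'.1 e'.2) (π e'.1 e'.2) := by
    rw [presenceMean_decomp ha hξ hξ1 (y := S.πs e'.1 e'.2) (mem _ _) (mems _ _) (mem _ _),
      presenceMean_decomp ha hξ hξ1 (y := p) (mem e.1 e.2) (mems _ _) (mems _ _)]
  have h1 : -(S.ξ n * (S.a⁻¹ * d)) ≤ presenceMean (S.ξ n) p (π e.1 e.2) p := by
    refine le_trans (neg_le_neg ?_) (presenceMean_ge ha hξ hξ1 (mems e.1 e.2) (mem _ _) (mems _ _))
    gcongr
    exact hdπ _ _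
  have h2 : -(S.ξ n * (S.a⁻¹ * d)) ≤
      presenceMean (S.ξ n) p (S.πs e'.1 e'.2) (π e'.1 e'.2) := by
    refine le_trans (neg_le_neg ?_) (presenceMean_ge ha hξ hξ1 (mems e.1 e.2) (mems _ _) (mem _ _))
    gcongr
    rw [abs_sub_comm]
    exact hdπ _ _
  have h3 := presenceMean_self_ge ha hpar.a_lt hξ hξ1 (mems e.1 e.2) (mems e'.1 e'.2)
  -- weights
  have hL0 : 0 ≤ S.Ltil := hLip.1.le
  -- The Lipschitz integrals are differences of divergences from the true law of block `e`, with the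
  -- true or the nearby weight parameter as second argument.
  have i1 := (hLip.2 S.γs hpar.true_mem.2.2 γ hγ e'.1 e'.2 e.1 e.2).2
  have i2 := (hLip.2 S.γs hpar.true_mem.2.2 γ hγ e.1 e.2 e.1 e.2).2
  rw [integral_logRatio hbase hdens hKL (memγs _ _) (memγs _ _) (memγ _ _),
    norm_sub_rev] at i1 i2
  have i3 : (S.weightKL (S.γs e.1 e.2) (S.γs e.1 e.2)).toReal = 0 := by
    have := hdens.prob _ (memγs e.1 e.2)
    simp [weightKL]
  rw [i3] at i2
  have h4 : S.weightGap e e' - 2 * (S.Ltil * d) ≤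
      ∫ y, S.logRatio (γ e.1 e.2) (γ e'.1 e'.2) y ∂S.weightLaw (S.γs e.1 e.2) := by
    rw [integral_logRatio hbase hdens hKL (memγs _ _) (memγ _ _) (memγ _ _), weightGap]
    have k1 := (abs_le.1 i1).1
    have k2 := (abs_le.1 i2).2
    have k3 : S.Ltil * ‖γ - S.γs‖ ≤ S.Ltil * d := by gcongr
    linarith
  have hp := mems e.1 e.2
  have hp0 : 0 < p := lt_of_lt_of_le ha hp.1
  have hp1 : p ≤ 1 := by linarith [hp.2]
  have hw : 0 ≤ S.weightGap e e' := ENNReal.toReal_nonneg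
  have hd0 : 0 ≤ S.Ltil * d := mul_nonneg hL0 (norm_nonneg _)
  have h5 := mul_le_mul_of_nonneg_left h4 (mul_pos hξ hp0).le
  have h6 : S.ξ n * (S.a * S.weightGap e e') ≤ S.ξ n * (p * S.weightGap e e') := by
    gcongr; exact hp.1
  have h7 : S.ξ n * (p * (S.Ltil * d)) ≤ S.ξ n * (1 * (S.Ltil * d)) := by
    gcongr
  rw [blockMean, cellMean, hpres, sparsityGap, L0]
  nlinarith

/-! ### Exponential moments -/

open scoped Classical in
/-- Indicator of the nonzero observations. -/
noncomputable def present (x : 𝓧) : ℝ := if x = 0 then 0 else 1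

variable [MeasurableSingletonClass 𝓧]

theorem measurable_present : Measurable (present : 𝓧 → ℝ) := by
  classical
  exact Measurable.ite (measurableSet_singleton 0) measurable_const measurable_const

theorem lintegral_mixLaw (S : WeightedModel 𝓧 E) (p : ℝ) (g : E) (F : 𝓧 → ℝ≥0∞) :
    ∫⁻ x, F x ∂S.mixLaw p g =
      ENNReal.ofReal p * ∫⁻ x, F x ∂S.weightLaw g + ENNReal.ofReal (1 - p) * F 0 := by
  rw [mixLaw, lintegral_add_measure, lintegral_smul_measure, lintegral_smul_measure,
    lintegral_dirac]
  rfl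

/-- Exponential moments of a function that is only counted at the nonzero observations. -/
theorem lintegral_exp_present_mul_le (hdens : S.HasDensities) {g : E} (hg : g ∈ S.GammaSet) {p M : ℝ}
    (hp : 0 ≤ p) (hp1 : p ≤ 1) (hM : 0 ≤ M) (lam : ℝ) (Y : 𝓧 → ℝ)
    (hY : ∫⁻ x, ENNReal.ofReal (Real.exp (lam * Y x)) ∂S.weightLaw g ≤ ENNReal.ofReal M) :
    ∫⁻ x, ENNReal.ofReal (Real.exp (lam * (present x * Y x))) ∂S.mixLaw p g ≤
      ENNReal.ofReal (Real.exp (p * (M - 1))) := by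
  have h1 : ∫⁻ x, ENNReal.ofReal (Real.exp (lam * (present x * Y x))) ∂S.weightLaw g =
      ∫⁻ x, ENNReal.ofReal (Real.exp (lam * Y x)) ∂S.weightLaw g := by
    refine lintegral_congr_ae ?_
    filter_upwards [weightLaw_ae_ne_zero hdens hg] with x hx
    simp [present, hx]
  rw [lintegral_mixLaw, h1]
  -- The zero observations contribute exactly `1 - p`, so the moment is at most `1 + p (M - 1)`. The
  -- factor `p` in the exponent is how sparsity enters the deviation bounds.
  calc _ ≤ ENNReal.ofReal p * ENNReal.ofReal M + ENNReal.ofReal (1 - p) * ENNReal.ofReal 1 := by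
        gcongr
        simp [present]
    _ = ENNReal.ofReal (p * M + (1 - p)) := by
        rw [← ENNReal.ofReal_mul hp, ← ENNReal.ofReal_mul (by linarith), mul_one,
          ← ENNReal.ofReal_add (by positivity) (by linarith)]
    _ ≤ _ := ENNReal.ofReal_le_ofReal (by
        have := Real.add_one_le_exp (p * (M - 1))
        linarith)

theorem exp_sub_one_sub_le_sq {x : ℝ} (hx : |x| ≤ 1) : Real.exp x - 1 - x ≤ x ^ 2 := by
  have := Real.abs_exp_sub_one_sub_id_le hx
  exact (le_abs_self _).trans this

/-- Exponential moments of the centered indicator of the nonzero observations. -/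
theorem lintegral_exp_present_sub_le (hdens : S.HasDensities) {g : E} (hg : g ∈ S.GammaSet) {p : ℝ}
    (hp : 0 ≤ p) (hp1 : p ≤ 1) {lam : ℝ} (hlam : |lam| ≤ 1) :
    ∫⁻ x, ENNReal.ofReal (Real.exp (lam * (present x - p))) ∂S.mixLaw p g ≤
      ENNReal.ofReal (Real.exp (p * lam ^ 2)) := by
  have := hdens.prob g hg
  have h := lintegral_exp_present_mul_le hdens hg hp hp1 (Real.exp_nonneg lam) lam (fun _ => 1)
    (by simp)
  have h1 : ∀ x : 𝓧, ENNReal.ofReal (Real.exp (lam * (present x - p))) =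
      ENNReal.ofReal (Real.exp (lam * (present x * 1))) * ENNReal.ofReal (Real.exp (-(lam * p))) := by
    intro x
    rw [← ENNReal.ofReal_mul (Real.exp_nonneg _), ← Real.exp_add]
    ring_nf
  simp_rw [h1]
  rw [lintegral_mul_const']
  · refine (mul_le_mul_left h _).trans ?_
    rw [← ENNReal.ofReal_mul (Real.exp_nonneg _), ← Real.exp_add]
    refine ENNReal.ofReal_le_ofReal (Real.exp_le_exp.2 ?_)
    have := exp_sub_one_sub_le_sq hlam
    nlinarith
  · exact ENNReal.ofReal_ne_top

end WeightedModel

/-! ### Exponential moments and the Chernoff bound for product measures -/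

theorem lintegral_pi_prod {ι X : Type*} [Fintype ι] [MeasurableSpace X] (μ : ι → Measure X)
    [∀ i, IsProbabilityMeasure (μ i)] (F : ι → X → ℝ≥0∞) (hF : ∀ i, Measurable (F i)) :
    ∫⁻ x, ∏ i, F i (x i) ∂Measure.pi μ = ∏ i, ∫⁻ x, F i x ∂μ i := by
  have hind := ProbabilityTheory.iIndepFun_pi (μ := μ) (X := F) fun i => (hF i).aemeasurable
  rw [ProbabilityTheory.lintegral_prod_eq_prod_lintegral_of_indepFun Finset.univ _ hind
    (fun i => (hF i).comp (measurable_pi_apply i))]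
  exact Finset.prod_congr rfl fun i _ =>
    (measurePreserving_eval μ i).lintegral_comp (hF i)

/-- The Chernoff bound for sums of functions of independent observations. -/
theorem chernoff_pi {ι X : Type*} [Fintype ι] [MeasurableSpace X] (μ : ι → Measure X)
    [∀ i, IsProbabilityMeasure (μ i)] (φ : ι → X → ℝ) (hφ : ∀ i, Measurable (φ i)) {lam : ℝ}
    (hlam : 0 ≤ lam) (s : ι → ℝ)
    (h : ∀ i, ∫⁻ x, ENNReal.ofReal (Real.exp (lam * φ i x)) ∂μ i ≤ ENNReal.ofReal (Real.exp (s i)))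
    (t : ℝ) :
    Measure.pi μ {x | t < ∑ i, φ i (x i)} ≤ ENNReal.ofReal (Real.exp (∑ i, s i - lam * t)) := by
  have hm : ∀ i, Measurable fun x => ENNReal.ofReal (Real.exp (lam * φ i x)) := fun i =>
    (Real.measurable_exp.comp ((hφ i).const_mul lam)).ennreal_ofReal
  have hprod : ∀ x : ι → X, ∏ i, ENNReal.ofReal (Real.exp (lam * φ i (x i))) =
      ENNReal.ofReal (Real.exp (lam * ∑ i, φ i (x i))) := fun x => by
    rw [← ENNReal.ofReal_prod_of_nonneg fun i _ => Real.exp_nonneg _, ← Real.exp_sum,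
      Finset.mul_sum]
  have hint : ∫⁻ x, ENNReal.ofReal (Real.exp (lam * ∑ i, φ i (x i))) ∂Measure.pi μ ≤
      ENNReal.ofReal (Real.exp (∑ i, s i)) := by
    simp_rw [← hprod]
    rw [lintegral_pi_prod μ _ hm, Real.exp_sum, ENNReal.ofReal_prod_of_nonneg fun i _ =>
      Real.exp_nonneg _]
    exact Finset.prod_le_prod' fun i _ => h i
  have hsub : {x : ι → X | t < ∑ i, φ i (x i)} ⊆
      {x | ENNReal.ofReal (Real.exp (lam * t)) ≤
        ENNReal.ofReal (Real.exp (lam * ∑ i, φ i (x i)))} := fun x hx =>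
    ENNReal.ofReal_le_ofReal (Real.exp_le_exp.2 (mul_le_mul_of_nonneg_left (le_of_lt hx) hlam))
  refine (measure_mono hsub).trans ((meas_ge_le_lintegral_div ?_ ?_ ENNReal.ofReal_ne_top).trans ?_)
  · exact (Real.measurable_exp.comp ((Finset.measurable_sum _ fun i _ =>
      (hφ i).comp (measurable_pi_apply i)).const_mul lam)).ennreal_ofReal.aemeasurable
  · simpa using Real.exp_pos _
  · rw [Real.exp_sub, ENNReal.ofReal_div_of_pos (Real.exp_pos _)]
    gcongr

/-! ### The prior distribution of the configurations -/

namespace Design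

variable {Q L : ℕ} {m : ℕ → ℕ}

theorem rate_nonneg (D : Design Q L m) (n : ℕ) (κ K : ℝ) : 0 ≤ D.rate n κ K := by
  cases D <;> simp only [rate] <;> positivity

theorem sum_prior (D : Design Q L m) (n : ℕ) {α : Fin Q → ℝ} {β : Fin L → ℝ} (hα1 : ∑ q, α q = 1)
    (hβ1 : ∑ l, β l = 1) : ∑ u ∈ D.configs n, D.prior n α β u = 1 := by
  cases D with
  | lbm =>
    simp only [configs, prior]
    rw [← Finset.univ_product_univ, Finset.sum_product]
    change ∑ z : Fin n → Fin Q, ∑ w : Fin (m n) → Fin L, (∏ i, α (z i)) * ∏ j, β (w j) = 1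
    rw [← Finset.sum_mul_sum, sum_prod_labelling fun _ => α, sum_prod_labelling fun _ => β]
    simp [hα1, hβ1]
  | sbm G =>
    have h : ∑ u ∈ (Design.sbm G).configs n, (Design.sbm G).prior n α β u =
        ∑ z : Fin n → Fin Q, ∏ i, α (z i) := by
      refine Finset.sum_bij' (fun v _ => v.1) (fun z _ => (z, z)) (fun _ _ => Finset.mem_univ _)
        (fun z _ => by simp [configs]) (fun v hv => ?_) (fun _ _ => rfl) fun v hv => rfl
      simp only [configs, Finset.mem_filter, Finset.mem_univ, true_and] at hv
      exact Prod.ext rfl hv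
    rw [h, sum_prod_labelling fun _ => α]
    simp [hα1]

theorem prior_nonneg (D : Design Q L m) (n : ℕ) {α : Fin Q → ℝ} {β : Fin L → ℝ} (hα : ∀ q, 0 ≤ α q)
    (hβ : ∀ l, 0 ≤ β l) (u : LabelPair Q L n (m n)) : 0 ≤ D.prior n α β u := by
  cases D with
  | lbm =>
    exact mul_nonneg (Finset.prod_nonneg fun i _ => hα _) (Finset.prod_nonneg fun i _ => hβ _)
  | sbm G => exact Finset.prod_nonneg fun i _ => hα _

theorem sum_prior_rows (D : Design Q L m) (n : ℕ) {α : Fin Q → ℝ} {β : Fin L → ℝ}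
    (hβ1 : ∑ l, β l = 1) (P : (Fin n → Fin Q) → Prop) [DecidablePred P] :
    ∑ u ∈ D.configs n with P u.1, D.prior n α β u = ∑ z with P z, ∏ i, α (z i) := by
  cases D with
  | lbm =>
    simp only [configs, prior]
    rw [Finset.sum_filter, Finset.sum_filter, ← Finset.univ_product_univ, Finset.sum_product]
    refine Finset.sum_congr rfl fun z _ => ?_
    change (∑ w : Fin (m n) → Fin L, if P z then (∏ i, α (z i)) * ∏ j, β (w j) else 0) = _
    split_ifs
    · rw [← Finset.mul_sum, sum_prod_labelling fun _ => β]
      simp [hβ1]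
    · simp
  | sbm G =>
    refine Finset.sum_bij' (fun v _ => v.1) (fun z _ => (z, z)) (fun v hv => ?_)
      (fun z hz => ?_) (fun v hv => ?_) (fun _ _ => rfl) fun v hv => rfl
    · exact Finset.mem_filter.2 ⟨Finset.mem_univ _, (Finset.mem_filter.1 hv).2⟩
    · exact Finset.mem_filter.2 ⟨by simp [configs], (Finset.mem_filter.1 hz).2⟩
    · simp only [configs, Finset.mem_filter, Finset.mem_univ, true_and] at hv
      exact Prod.ext rfl hv.1

/-- The column labels have marginal law `β`. In the stochastic block model the prior is written with
`α` only, and `Tied` identifies the two. -/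
theorem sum_prior_columns (D : Design Q L m) (n : ℕ) {α : Fin Q → ℝ} {β : Fin L → ℝ}
    (hα1 : ∑ q, α q = 1) (hT : D.Tied α β) (P : (Fin (m n) → Fin L) → Prop) [DecidablePred P] :
    ∑ u ∈ D.configs n with P u.2, D.prior n α β u = ∑ w with P w, ∏ j, β (w j) := by
  cases D with
  | lbm =>
    simp only [configs, prior]
    rw [Finset.sum_filter, Finset.sum_filter, ← Finset.univ_product_univ, Finset.sum_product_right]
    refine Finset.sum_congr rfl fun w _ => ?_
    change (∑ z : Fin n → Fin Q, if P w then (∏ i, α (z i)) * ∏ j, β (w j) else 0) = _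
    split_ifs
    · rw [← Finset.sum_mul, sum_prod_labelling fun _ => α]
      simp [hα1]
    · simp
  | sbm G =>
    have hαβ : α = β := hT
    subst hαβ
    refine Finset.sum_bij' (fun v _ => v.1) (fun z _ => (z, z)) (fun v hv => ?_)
      (fun z hz => ?_) (fun v hv => ?_) (fun _ _ => rfl) fun v hv => rfl
    · simp only [configs, Finset.mem_filter, Finset.mem_univ, true_and] at hv
      exact Finset.mem_filter.2 ⟨Finset.mem_univ _, by rw [hv.1]; exact hv.2⟩
    · exact Finset.mem_filter.2 ⟨by simp [configs], (Finset.mem_filter.1 hz).2⟩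
    · simp only [configs, Finset.mem_filter, Finset.mem_univ, true_and] at hv
      exact Prod.ext rfl hv.1

open scoped Classical in
/-- Configurations are balanced with a large probability. -/
theorem sum_prior_not_balanced_le (D : Design Q L m) (n : ℕ) {α : Fin Q → ℝ} {β : Fin L → ℝ}
    (hα1 : ∑ q, α q = 1) (hβ1 : ∑ l, β l = 1) (hT : D.Tied α β) {μ : ℝ} (hμ : 0 ≤ μ)
    (hα : ∀ q, μ ≤ α q) (hβ : ∀ l, μ ≤ β l) :
    ∑ u ∈ D.configs n with ¬ Balanced (19 / 20 * μ) u, D.prior n α β u ≤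
      Q * Real.exp (-(μ * n / 2000)) + L * Real.exp (-(μ * m n / 2000)) := by
  have hα0 : ∀ q, 0 ≤ α q := fun q => hμ.trans (hα q)
  have hβ0 : ∀ q, 0 ≤ β q := fun q => hμ.trans (hβ q)
  have hnn := fun u => D.prior_nonneg n hα0 hβ0 u
  have hf : ∀ (P : Prop) u, 0 ≤ if P then D.prior n α β u else 0 := fun P u => by
    split_ifs
    · exact hnn u
    · exact le_rfl
  calc _ ≤ ∑ u ∈ D.configs n,
          (∑ q, (if (labelCount u.1 q : ℝ) < 19 / 20 * μ * n then D.prior n α β u else 0) +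
            ∑ l, if (labelCount u.2 l : ℝ) < 19 / 20 * μ * m n then D.prior n α β u else 0) := by
        rw [Finset.sum_filter]
        refine Finset.sum_le_sum fun u _ => ?_
        have h1 : 0 ≤ ∑ q, if (labelCount u.1 q : ℝ) < 19 / 20 * μ * n then D.prior n α β u else 0 :=
          Finset.sum_nonneg fun q _ => hf _ u
        have h2 : 0 ≤ ∑ l, if (labelCount u.2 l : ℝ) < 19 / 20 * μ * m n then D.prior n α β u
            else 0 := Finset.sum_nonneg fun q _ => hf _ u
        by_cases hb : Balanced (19 / 20 * μ) u
        · rw [if_neg (not_not.2 hb)]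
          exact add_nonneg h1 h2
        · rw [if_pos hb]
          rw [Balanced, not_and_or] at hb
          push Not at hb
          rcases hb with ⟨q, hq⟩ | ⟨l, hl⟩
          · have := Finset.single_le_sum (f := fun q => if (labelCount u.1 q : ℝ) < 19 / 20 * μ * n
              then D.prior n α β u else 0) (fun q _ => hf _ u) (Finset.mem_univ q)
            rw [if_pos hq] at this
            linarith
          · have := Finset.single_le_sum (f := fun l => if (labelCount u.2 l : ℝ) <
              19 / 20 * μ * m n then D.prior n α β u else 0) (fun q _ => hf _ u)
              (Finset.mem_univ l)
            rw [if_pos hl] at this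
            linarith
    _ = ∑ q, ∑ u ∈ D.configs n with (labelCount u.1 q : ℝ) < 19 / 20 * μ * n, D.prior n α β u +
        ∑ l, ∑ u ∈ D.configs n with (labelCount u.2 l : ℝ) < 19 / 20 * μ * m n,
          D.prior n α β u := by
        rw [Finset.sum_add_distrib, Finset.sum_comm]
        congr 1
        · simp_rw [Finset.sum_filter]
        · rw [Finset.sum_comm]
          simp_rw [Finset.sum_filter]
    _ ≤ ∑ _q : Fin Q, Real.exp (-(μ * n / 2000)) + ∑ _l : Fin L, Real.exp (-(μ * m n / 2000)) := by
        gcongr with q _ l _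
        · rw [D.sum_prior_rows n hβ1 fun z => (labelCount z q : ℝ) < 19 / 20 * μ * n]
          exact sum_prod_labelCount_lt_le α hα0 hα1 q hμ (hα q)
        · rw [D.sum_prior_columns n hα1 hT fun w => (labelCount w l : ℝ) < 19 / 20 * μ * m n]
          exact sum_prod_labelCount_lt_le β hβ0 hβ1 l hμ (hβ l)
    _ = _ := by simp

end Design

/-! ### Deviations of the observations given the configuration -/

namespace WeightedModel

variable {𝓧 E : Type*} [MeasurableSpace 𝓧] {S : WeightedModel 𝓧 E}

theorem μmin_pos (hpar : S.IsParametrized) : 0 < S.μmin := lt_min hpar.αmin_pos hpar.βmin_pos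

/-- The block of a cell. -/
def block (S : WeightedModel 𝓧 E) {n : ℕ} (u : S.Config n) (p : {p // p ∈ S.design.cells n}) :
    Fin S.Q × Fin S.L := (u.1 p.1.1, u.2 p.1.2)

theorem mem_changed {n : ℕ} (u v : S.Config n) (p : {p // p ∈ S.design.cells n}) :
    p ∈ S.design.changed u v ↔ S.block u p ≠ S.block v p := by
  rw [Design.changed, Finset.mem_filter]
  exact and_iff_right (Finset.mem_univ _)

/-- A positive supremum is witnessed by one `lam`. The moment there is finite, since otherwise the
value would be `⊥`. Raising `M` to at least 1 is harmless because `lam * δ > 0`; it makes the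
exponent `M - 1` nonnegative. -/
theorem exists_lam_of_hasConcentration (hconc : S.HasConcentration) {δ : ℝ} (hδ : 0 < δ) :
    ∃ lam M : ℝ, 0 < lam ∧ 1 ≤ M ∧ 0 < lam * δ - (M - 1) ∧
      S.expMoment lam ≤ ENNReal.ofReal M := by
  obtain ⟨I, -, hI, hx⟩ := hconc
  have h := hx δ hδ
  rw [rateFunction] at h
  simp only [lt_iSup_iff] at h
  obtain ⟨lam, hlam, h⟩ := h
  have hlam0 : 0 < lam := hI hlam
  have hM : S.expMoment lam ≠ ⊤ := by
    intro htop
    rw [htop, EReal.coe_ennreal_top, EReal.sub_top] at h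
    simp at h
  lift S.expMoment lam to NNReal using hM with M hMeq
  refine ⟨lam, max M 1, hlam0, le_max_right _ _, ?_, ?_⟩
  · have h1 : (0 : ℝ) < lam * δ + 1 - M := by
      have h2 : ((M : ℝ≥0∞) : EReal) = ((M : ℝ) : EReal) := rfl
      rw [h2, ← EReal.coe_sub] at h
      exact_mod_cast h
    have h3 : 0 < lam * δ := by positivity
    rcases max_cases (M : ℝ) 1 with h | h <;> rw [h.1] <;> linarith
  · rw [← hMeq]
    calc (M : ℝ≥0∞) = ENNReal.ofReal M := by simp
      _ ≤ _ := ENNReal.ofReal_le_ofReal (le_max_left _ _)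

theorem lintegral_exp_centeredLogRatio_le {γ : Fin S.Q → Fin S.L → E} (hγ : γ ∈ S.GammaMat)
    (lam : ℝ) (e e' : Fin S.Q × Fin S.L) :
    ∫⁻ x, ENNReal.ofReal (Real.exp (lam * S.centeredLogRatio γ e e' x))
        ∂S.weightLaw (S.γs e.1 e.2) ≤ S.expMoment lam ∧
    ∫⁻ x, ENNReal.ofReal (Real.exp (lam * -S.centeredLogRatio γ e e' x))
        ∂S.weightLaw (S.γs e.1 e.2) ≤ S.expMoment lam := by
  have h : max (∫⁻ x, ENNReal.ofReal (Real.exp (lam * S.centeredLogRatio γ e e' x))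
        ∂S.weightLaw (S.γs e.1 e.2)) (∫⁻ x, ENNReal.ofReal (Real.exp (lam *
          -S.centeredLogRatio γ e e' x)) ∂S.weightLaw (S.γs e.1 e.2)) ≤ S.expMoment lam :=
    le_iSup₂_of_le γ hγ (le_iSup₂_of_le e e' le_rfl)
  exact ⟨(le_max_left _ _).trans h, (le_max_right _ _).trans h⟩

variable [Zero 𝓧]

/-- Deviation from its mean of the number of the nonzero observations at the cells with blocks `e`
and `e'` in two configurations. -/
noncomputable def countDev (S : WeightedModel 𝓧 E) {n : ℕ} (u v : S.Config n)
    (e e' : Fin S.Q × Fin S.L) (X : S.Data n) : ℝ :=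
  ∑ p, if S.block u p = e ∧ S.block v p = e' then present (X p) - S.ξ n * S.πs e.1 e.2 else 0

/-- The sum of the centered log-likelihood ratios of the nonzero observations. -/
noncomputable def weightDev (S : WeightedModel 𝓧 E) (γ : Fin S.Q → Fin S.L → E) {n : ℕ}
    (u v : S.Config n) (X : S.Data n) : ℝ :=
  ∑ p, if S.block u p = S.block v p then 0 else
    present (X p) * S.centeredLogRatio γ (S.block u p) (S.block v p) (X p)

/-- The arrays of observations at which all deviations from the means are small. -/
def regularData (S : WeightedModel 𝓧 E) (δ : ℝ) (n : ℕ) (γ : Fin S.Q → Fin S.L → E)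
    (u : S.Config n) : Set (S.Data n) :=
  {X | (∀ p, X p ≠ 0 → ∀ q l, 0 < S.f (γ q l) (X p)) ∧ ∀ v ∈ S.design.configs n,
    (∀ e e', e ≠ e' → S.countDev u v e e' X ≤ δ * S.ξ n * S.design.wt u v ∧
      -S.countDev u v e e' X ≤ δ * S.ξ n * S.design.wt u v) ∧
    S.weightDev γ u v X ≤ δ * S.ξ n * S.design.wt u v ∧
    -S.weightDev γ u v X ≤ δ * S.ξ n * S.design.wt u v}

theorem measurable_centeredLogRatio (hpar : S.IsParametrized) (hdens : S.HasDensities)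
    {γ : Fin S.Q → Fin S.L → E} (hγ : γ ∈ S.GammaMat) (e e' : Fin S.Q × Fin S.L) :
    Measurable (S.centeredLogRatio γ e e') :=
  (((hdens.measurable _ (hpar.GammaMat_mem _ hγ _ _)).div
    (hdens.measurable _ (hpar.GammaMat_mem _ hγ _ _))).log).sub_const _

theorem isProbabilityMeasure_cellLaw (hpar : S.IsParametrized) (hdens : S.HasDensities)
    (hsparse : S.IsSparse) (n : ℕ) (e : Fin S.Q × Fin S.L) :
    IsProbabilityMeasure (S.mixLaw (S.ξ n * S.πs e.1 e.2) (S.γs e.1 e.2)) := by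
  obtain ⟨h1, h2⟩ := mul_mem_Ioo hpar (hsparse.ξ_pos n) (hsparse.ξ_le n)
    (true_mem_PiSet hpar e.1 e.2)
  exact isProbabilityMeasure_mixLaw hdens (true_mem_GammaSet hpar _ _) h1.le h2.le

/-- Deviations of sums over the cells at which two configurations differ. -/
theorem dataLaw_deviation_le (hpar : S.IsParametrized) (hdens : S.HasDensities)
    (hsparse : S.IsSparse) {n : ℕ} (u v : S.Config n)
    (φ : {p // p ∈ S.design.cells n} → 𝓧 → ℝ) (hφ : ∀ p, Measurable (φ p))
    {lam b δ : ℝ} (hlam : 0 ≤ lam) (hb : 0 ≤ b)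
    (h0 : ∀ p, S.block u p = S.block v p → ∀ x, φ p x = 0)
    (h : ∀ p, ∫⁻ x, ENNReal.ofReal (Real.exp (lam * φ p x)) ∂S.mixLaw
      (S.ξ n * S.πs (S.block u p).1 (S.block u p).2) (S.γs (S.block u p).1 (S.block u p).2) ≤
        ENNReal.ofReal (Real.exp (S.ξ n * b))) :
    S.dataLaw n S.πs S.γs u {X | δ * S.ξ n * S.design.wt u v < ∑ p, φ p (X p)} ≤
      ENNReal.ofReal (Real.exp (-((lam * δ - b) * S.ξ n * S.design.wt u v))) := by
  have : ∀ p : {p // p ∈ S.design.cells n}, IsProbabilityMeasure (S.mixLaw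
      (S.ξ n * S.πs (u.1 p.1.1) (u.2 p.1.2)) (S.γs (u.1 p.1.1) (u.2 p.1.2))) := fun p =>
    isProbabilityMeasure_cellLaw hpar hdens hsparse n (S.block u p)
  have hξ := hsparse.ξ_pos n
  -- Only the changed cells contribute to the exponent, and there are at most `wt` of them, on the
  -- scale of the threshold.
  refine (chernoff_pi _ φ hφ hlam (fun p => if p ∈ S.design.changed u v then S.ξ n * b else 0)
    (fun p => ?_) _).trans (ENNReal.ofReal_le_ofReal (Real.exp_le_exp.2 ?_))
  · split_ifs with hp
    · exact h p
    · rw [mem_changed, not_not] at hp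
      simp [h0 p hp]
  · rw [← Finset.sum_filter, Finset.filter_mem_eq_inter, Finset.univ_inter, Finset.sum_const,
      nsmul_eq_mul]
    have h1 : ((S.design.changed u v).card : ℝ) ≤ S.design.wt u v := by
      exact_mod_cast S.design.card_changed_le u v
    have h2 : ((S.design.changed u v).card : ℝ) * (S.ξ n * b) ≤ S.design.wt u v * (S.ξ n * b) := by
      gcongr
    linarith

variable [MeasurableSingletonClass 𝓧]

theorem measurable_countDev {n : ℕ} (u v : S.Config n) (e e' : Fin S.Q × Fin S.L) :
    Measurable (S.countDev u v e e') := by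
  refine Finset.measurable_sum _ fun p _ => ?_
  split_ifs
  · exact (measurable_present.comp (measurable_pi_apply p)).sub_const _
  · exact measurable_const

theorem measurable_weightDev (hpar : S.IsParametrized) (hdens : S.HasDensities)
    {γ : Fin S.Q → Fin S.L → E} (hγ : γ ∈ S.GammaMat) {n : ℕ} (u v : S.Config n) :
    Measurable (S.weightDev γ u v) := by
  refine Finset.measurable_sum _ fun p _ => ?_
  split_ifs
  · exact measurable_const
  · exact (measurable_present.comp (measurable_pi_apply p)).mul
      ((measurable_centeredLogRatio hpar hdens hγ _ _).comp (measurable_pi_apply p))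

theorem measurableSet_regularData (hpar : S.IsParametrized) (hdens : S.HasDensities) (δ : ℝ)
    {γ : Fin S.Q → Fin S.L → E} (hγ : γ ∈ S.GammaMat) {n : ℕ} (u : S.Config n) :
    MeasurableSet (S.regularData δ n γ u) := by
  have hle : ∀ {F : S.Data n → ℝ} (t : ℝ), Measurable F → Measurable fun X => F X ≤ t :=
    fun t hF => measurableSet_setOfPred.1 (measurableSet_le hF measurable_const)
  refine measurableSet_setOfPred.2 (Measurable.and ?_ ?_)
  · refine Measurable.forall fun p => Measurable.imp ?_ (Measurable.forall fun q =>
      Measurable.forall fun l => ?_)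
    · have h : MeasurableSet {X : S.Data n | X p ∈ ({0} : Set 𝓧)ᶜ} :=
        (measurable_pi_apply p) (measurableSet_singleton (0 : 𝓧)).compl
      exact measurableSet_setOfPred.1 h
    · exact measurableSet_setOfPred.1 (measurableSet_lt measurable_const
        ((hdens.measurable _ (hpar.GammaMat_mem _ hγ q l)).comp (measurable_pi_apply p)))
  · refine Measurable.forall fun v => Measurable.forall fun _ => Measurable.and ?_
      (Measurable.and ?_ ?_)
    · exact Measurable.forall fun e => Measurable.forall fun e' => Measurable.forall fun _ =>
        (hle _ (measurable_countDev u v e e')).and (hle _ (measurable_countDev u v e e').neg)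
    · exact hle _ (measurable_weightDev hpar hdens hγ u v)
    · exact hle _ (measurable_weightDev hpar hdens hγ u v).neg

end WeightedModel

/-! ### Probability of the regular observations -/

namespace WeightedModel

variable {𝓧 E : Type*} [MeasurableSpace 𝓧] {S : WeightedModel 𝓧 E} [Zero 𝓧]
  [MeasurableSingletonClass 𝓧]

theorem ae_regular_density (hpar : S.IsParametrized) (hdens : S.HasDensities)
    (hKL : S.HasBoundedKL) (hsparse : S.IsSparse) {γ : Fin S.Q → Fin S.L → E}
    (hγ : γ ∈ S.GammaMat) {n : ℕ} (u : S.Config n) :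
    ∀ᵐ X ∂S.dataLaw n S.πs S.γs u, ∀ p, X p ≠ 0 → ∀ q l, 0 < S.f (γ q l) (X p) := by
  have : ∀ p : {p // p ∈ S.design.cells n}, IsProbabilityMeasure (S.mixLaw
      (S.ξ n * S.πs (u.1 p.1.1) (u.2 p.1.2)) (S.γs (u.1 p.1.1) (u.2 p.1.2))) := fun p =>
    isProbabilityMeasure_cellLaw hpar hdens hsparse n (S.block u p)
  rw [ae_all_iff]
  intro p
  refine Measure.tendsto_eval_ae_ae.eventually
    (p := fun x => x ≠ 0 → ∀ q l, 0 < S.f (γ q l) x) ?_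
  simp only [mixLaw]
  rw [ae_add_measure_iff]
  constructor
  · refine Measure.ae_smul_measure ?_ _
    have h : ∀ᵐ x ∂S.weightLaw (S.γs (u.1 p.1.1) (u.2 p.1.2)), ∀ q l, 0 < S.f (γ q l) x := by
      rw [ae_all_iff]; intro q
      rw [ae_all_iff]; intro l
      exact ae_density_pos hdens hKL (true_mem_GammaSet hpar _ _) (hpar.GammaMat_mem _ hγ q l)
    exact h.mono fun x hx _ => hx
  · refine Measure.ae_smul_measure ?_ _
    rw [ae_dirac_eq]
    exact fun h => absurd rfl h

/-- Each deviation event has an exponentially small probability. -/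
theorem exists_rate_deviation (hpar : S.IsParametrized) (hdens : S.HasDensities)
    (hsparse : S.IsSparse) (hconc : S.HasConcentration) {δ : ℝ} (hδ : 0 < δ) :
    ∃ h : ℝ, 0 < h ∧ ∀ n, ∀ u v : S.Config n,
      (∀ e e', e ≠ e' → ∀ sgn : ℝ, sgn = 1 ∨ sgn = -1 →
        S.dataLaw n S.πs S.γs u {X | δ * S.ξ n * S.design.wt u v < sgn * S.countDev u v e e' X} ≤
          ENNReal.ofReal (Real.exp (-(h * S.ξ n * S.design.wt u v)))) ∧
      ∀ γ ∈ S.GammaMat, ∀ sgn : ℝ, sgn = 1 ∨ sgn = -1 →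
        S.dataLaw n S.πs S.γs u {X | δ * S.ξ n * S.design.wt u v < sgn * S.weightDev γ u v X} ≤
          ENNReal.ofReal (Real.exp (-(h * S.ξ n * S.design.wt u v))) := by
  classical
  obtain ⟨lam, M, hlam, hM1, hpos, hM⟩ := exists_lam_of_hasConcentration hconc hδ
  -- For the presence indicators the exponent is `l δ - l²`, positive since `l ≤ δ / 2`; the cap at
  -- 1 is needed for the quadratic bound of the exponential.
  set l := min (δ / 2) 1 with hl
  have hl0 : 0 < l := lt_min (by positivity) one_pos
  have hlδ : l ≤ δ / 2 := min_le_left _ _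
  have hl1 : l ≤ 1 := min_le_right _ _
  have hpos' : 0 < l * δ - l ^ 2 := by nlinarith
  refine ⟨min (l * δ - l ^ 2) (lam * δ - (M - 1)), lt_min hpos' hpos, fun n u v =>
    ⟨fun e e' hee sgn hs => ?_, fun γ hγ sgn hs => ?_⟩⟩
  · have hξ := hsparse.ξ_pos n
    have hmono : ENNReal.ofReal (Real.exp (-((l * δ - l ^ 2) * S.ξ n * S.design.wt u v))) ≤
        ENNReal.ofReal (Real.exp (-(min (l * δ - l ^ 2) (lam * δ - (M - 1)) * S.ξ n *
          S.design.wt u v))) := by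
      gcongr
      exact min_le_left _ _
    refine le_trans ?_ hmono
    have key := dataLaw_deviation_le hpar hdens hsparse u v
      (fun p x => if S.block u p = e ∧ S.block v p = e' then
        sgn * (present x - S.ξ n * S.πs e.1 e.2) else 0) (fun p => ?_) (lam := l) (b := l ^ 2)
        (δ := δ) hl0.le (by positivity) (fun p hp x => ?_) (fun p => ?_)
    · have heq : ∀ X, sgn * S.countDev u v e e' X = ∑ p, (if S.block u p = e ∧ S.block v p = e'
          then sgn * (present (X p) - S.ξ n * S.πs e.1 e.2) else 0) := fun X => by
        rw [countDev, Finset.mul_sum]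
        exact Finset.sum_congr rfl fun p _ => by split_ifs <;> simp
      simp_rw [heq]
      exact key
    · split_ifs
      · exact (measurable_present.sub_const _).const_mul _
      · exact measurable_const
    · rw [if_neg]
      rintro ⟨rfl, rfl⟩
      exact hee hp
    · have := isProbabilityMeasure_cellLaw hpar hdens hsparse n (S.block u p)
      split_ifs with hp
      · rw [hp.1]
        obtain ⟨h1, h2⟩ := mul_mem_Ioo hpar hξ (hsparse.ξ_le n) (true_mem_PiSet hpar e.1 e.2)
        have habs : |l * sgn| ≤ 1 := by
          rcases hs with rfl | rfl
          · rw [mul_one, abs_of_pos hl0]; exact hl1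
          · rw [mul_neg_one, abs_neg, abs_of_pos hl0]; exact hl1
        have h3 := lintegral_exp_present_sub_le hdens (true_mem_GammaSet hpar e.1 e.2) h1.le h2.le habs
        simp only [mul_assoc] at h3 ⊢
        refine h3.trans (ENNReal.ofReal_le_ofReal (Real.exp_le_exp.2 ?_))
        have h4 : (l * sgn) ^ 2 = l ^ 2 := by rcases hs with rfl | rfl <;> ring
        rw [h4]
        have h5 : S.πs e.1 e.2 ≤ 1 := by
          have := mem_Icc_of_mem_PiSet hpar (true_mem_PiSet hpar e.1 e.2)
          linarith [this.2, hpar.a_pos]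
        have h6 : 0 ≤ l ^ 2 := by positivity
        have : S.πs e.1 e.2 * l ^ 2 ≤ 1 * l ^ 2 := by gcongr
        nlinarith
      · simp only [mul_zero, Real.exp_zero, ENNReal.ofReal_one, lintegral_const, measure_univ,
          mul_one]
        rw [ENNReal.one_le_ofReal]
        exact Real.one_le_exp (by positivity)
  · have hξ := hsparse.ξ_pos n
    have hmono : ENNReal.ofReal (Real.exp (-((lam * δ - (M - 1)) * S.ξ n * S.design.wt u v))) ≤
        ENNReal.ofReal (Real.exp (-(min (l * δ - l ^ 2) (lam * δ - (M - 1)) * S.ξ n *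
          S.design.wt u v))) := by
      gcongr
      exact min_le_right _ _
    refine le_trans ?_ hmono
    have key := dataLaw_deviation_le hpar hdens hsparse u v
      (fun p x => if S.block u p = S.block v p then 0 else
        present x * (sgn * S.centeredLogRatio γ (S.block u p) (S.block v p) x)) (fun p => ?_)
        (lam := lam) (b := M - 1)
        (δ := δ) hlam.le (by linarith) (fun p hp x => if_pos hp) (fun p => ?_)
    · have heq : ∀ X, sgn * S.weightDev γ u v X = ∑ p, (if S.block u p = S.block v p then 0 else
          present (X p) * (sgn * S.centeredLogRatio γ (S.block u p) (S.block v p) (X p))) :=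
        fun X => by
          rw [weightDev, Finset.mul_sum]
          exact Finset.sum_congr rfl fun p _ => by
            split_ifs
            · simp
            · ring
      simp_rw [heq]
      exact key
    · split_ifs
      · exact measurable_const
      · exact measurable_present.mul
          ((measurable_centeredLogRatio hpar hdens hγ _ _).const_mul _)
    · have := isProbabilityMeasure_cellLaw hpar hdens hsparse n (S.block u p)
      split_ifs with hp
      · simp only [mul_zero, Real.exp_zero, ENNReal.ofReal_one, lintegral_const, measure_univ,
          mul_one]
        rw [ENNReal.one_le_ofReal]
        exact Real.one_le_exp (mul_nonneg hξ.le (by linarith))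
      · obtain ⟨h1, h2⟩ := mul_mem_Ioo hpar hξ (hsparse.ξ_le n)
          (true_mem_PiSet hpar (S.block u p).1 (S.block u p).2)
        obtain ⟨e1, e2⟩ := lintegral_exp_centeredLogRatio_le hγ lam (S.block u p) (S.block v p)
        refine (lintegral_exp_present_mul_le hdens
          (true_mem_GammaSet hpar (S.block u p).1 (S.block u p).2) h1.le h2.le (by linarith) lam _
          (le_trans ?_ hM)).trans (ENNReal.ofReal_le_ofReal (Real.exp_le_exp.2 ?_))
        · rcases hs with rfl | rfl
          · simpa only [one_mul] using e1
          · simpa only [neg_one_mul] using e2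
        · have h5 : S.πs (S.block u p).1 (S.block u p).2 ≤ 1 := by
            have := mem_Icc_of_mem_PiSet hpar
              (true_mem_PiSet hpar (S.block u p).1 (S.block u p).2)
            linarith [this.2, hpar.a_pos]
          have h6 : S.ξ n * S.πs (S.block u p).1 (S.block u p).2 ≤ S.ξ n * 1 := by gcongr
          rw [mul_one] at h6
          exact mul_le_mul_of_nonneg_right h6 (by linarith)

/-- Regular observations have a large probability given the configuration. -/
theorem exists_rate_regularData (hpar : S.IsParametrized) (hdens : S.HasDensities)
    (hKL : S.HasBoundedKL) (hsparse : S.IsSparse) (hconc : S.HasConcentration) {δ : ℝ}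
    (hδ : 0 < δ) :
    ∃ h C : ℝ, 0 < h ∧ 0 ≤ C ∧ ∀ n, ∀ γ ∈ S.GammaMat, ∀ u ∈ S.design.configs n,
      1 - C * (Real.exp ((S.Q + S.L) * S.design.rate n (h * S.ξ n) 0) - 1) ≤
        (S.dataLaw n S.πs S.γs u).real (S.regularData δ n γ u) := by
  classical
  obtain ⟨h, hh, hdev⟩ := exists_rate_deviation hpar hdens hsparse hconc hδ
  set B := (Fin S.Q × Fin S.L) × (Fin S.Q × Fin S.L)
  -- Two signs for each pair of blocks, and two for the weights.
  refine ⟨h, (Fintype.card B * 2 + 2 : ℕ), hh, Nat.cast_nonneg _, fun n γ hγ u hu => ?_⟩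
  set μ := S.dataLaw n S.πs S.γs u with hμ
  have hpm : ∀ p : {p // p ∈ S.design.cells n}, IsProbabilityMeasure (S.mixLaw
      (S.ξ n * S.πs (u.1 p.1.1) (u.2 p.1.2)) (S.γs (u.1 p.1.1) (u.2 p.1.2))) := fun p =>
    isProbabilityMeasure_cellLaw hpar hdens hsparse n (S.block u p)
  have hprob : IsProbabilityMeasure μ := by
    rw [hμ, dataLaw]; infer_instance
  set x : S.Config n → ℝ := fun v => Real.exp (-(h * S.ξ n * S.design.wt u v)) with hx
  let bad : S.Config n → Set (S.Data n) := fun v =>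
    (⋃ b ∈ (Finset.univ : Finset B).filter (fun b => b.1 ≠ b.2),
      ({X | δ * S.ξ n * S.design.wt u v < 1 * S.countDev u v b.1 b.2 X} ∪
        {X | δ * S.ξ n * S.design.wt u v < -1 * S.countDev u v b.1 b.2 X})) ∪
    ({X | δ * S.ξ n * S.design.wt u v < 1 * S.weightDev γ u v X} ∪
        {X | δ * S.ξ n * S.design.wt u v < -1 * S.weightDev γ u v X})
  have hbad : ∀ v, μ (bad v) ≤ ENNReal.ofReal ((Fintype.card B * 2 + 2 : ℕ) * x v) := fun v => by
    obtain ⟨h1, h2⟩ := hdev n u v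
    have h2 := h2 γ hγ
    have hx0 : 0 ≤ x v := Real.exp_nonneg _
    refine (measure_union_le _ _).trans ?_
    have e1 : μ (⋃ b ∈ (Finset.univ : Finset B).filter (fun b => b.1 ≠ b.2),
      ({X | δ * S.ξ n * S.design.wt u v < 1 * S.countDev u v b.1 b.2 X} ∪
        {X | δ * S.ξ n * S.design.wt u v < -1 * S.countDev u v b.1 b.2 X})) ≤
        (Fintype.card B : ℝ≥0∞) * (2 * ENNReal.ofReal (x v)) := by
      refine (measure_biUnion_finset_le _ _).trans ?_
      refine (Finset.sum_le_card_nsmul _ _ (2 * ENNReal.ofReal (x v)) fun b hb => ?_).trans ?_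
      · refine (measure_union_le _ _).trans ?_
        rw [two_mul]
        have hb := (Finset.mem_filter.1 hb).2
        exact add_le_add (h1 _ _ hb 1 (Or.inl rfl)) (h1 _ _ hb (-1) (Or.inr rfl))
      · rw [nsmul_eq_mul]
        gcongr
        exact Finset.card_le_univ _
    have e2 : μ ({X | δ * S.ξ n * S.design.wt u v < 1 * S.weightDev γ u v X} ∪
        {X | δ * S.ξ n * S.design.wt u v < -1 * S.weightDev γ u v X}) ≤
          2 * ENNReal.ofReal (x v) := by
      refine (measure_union_le _ _).trans ?_
      rw [two_mul]
      exact add_le_add (h2 1 (Or.inl rfl)) (h2 (-1) (Or.inr rfl))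
    refine (add_le_add e1 e2).trans (le_of_eq ?_)
    rw [ENNReal.ofReal_mul (Nat.cast_nonneg _), ENNReal.ofReal_natCast]
    push_cast
    ring
  have hsub : (S.regularData δ n γ u)ᶜ ⊆
      {X | ¬ ∀ p, X p ≠ 0 → ∀ q l, 0 < S.f (γ q l) (X p)} ∪
        ⋃ v ∈ (S.design.configs n).filter (fun v => v ≠ u), bad v := by
    intro X hX
    by_contra hcon
    rw [Set.mem_union, not_or] at hcon
    obtain ⟨hc1, hc2⟩ := hcon
    refine hX ⟨not_not.1 hc1, fun v hv => ?_⟩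
    -- For `v = u` all deviations and the weight vanish, so the union bound runs over `v ≠ u`, which
    -- is where `exp (rate) - 1` comes from.
    by_cases hvu : v = u
    · subst hvu
      have z1 : ∀ e e', e ≠ e' → S.countDev v v e e' X = 0 := fun e e' hee =>
        Finset.sum_eq_zero fun p _ => if_neg fun hp => hee (hp.1.symm.trans hp.2)
      have z2 : S.weightDev γ v v X = 0 := Finset.sum_eq_zero fun p _ => if_pos rfl
      have z3 : S.design.wt v v = 0 := by simp [Design.wt]
      refine ⟨fun e e' hee => ?_, ?_, ?_⟩
      · rw [z1 e e' hee, z3]; simp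
      · rw [z2, z3]; simp
      · rw [z2, z3]; simp
    · have hb : X ∉ bad v := fun hb => hc2 <| Set.mem_biUnion
        (Finset.mem_filter.2 ⟨hv, hvu⟩ : v ∈ (S.design.configs n).filter (fun v => v ≠ u)) hb
      simp only [bad, Set.mem_union, not_or, Set.mem_iUnion, not_exists,
        Set.mem_ofPred_eq, not_lt, one_mul, neg_one_mul] at hb
      obtain ⟨b1, b2, b3⟩ := hb
      refine ⟨fun e e' hee => ?_, ?_, ?_⟩
      · obtain ⟨c1, c2⟩ := b1 (e, e') (Finset.mem_filter.2 ⟨Finset.mem_univ _, hee⟩)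
        exact ⟨c1, c2⟩
      · exact b2
      · exact b3
  have hN : μ {X | ¬ ∀ p, X p ≠ 0 → ∀ q l, 0 < S.f (γ q l) (X p)} = 0 :=
    ae_iff.1 (ae_regular_density hpar hdens hKL hsparse hγ u)
  have hsum : ∑ v ∈ S.design.configs n with v ≠ u, x v ≤
      Real.exp ((S.Q + S.L) * S.design.rate n (h * S.ξ n) 0) - 1 := by
    refine le_trans (le_of_eq ?_) (S.design.sum_exp_wt_le hu (h * S.ξ n) 0)
    exact Finset.sum_congr rfl fun v _ => by simp [hx]
  have hcompl : μ (S.regularData δ n γ u)ᶜ ≤ ENNReal.ofReal ((Fintype.card B * 2 + 2 : ℕ) *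
      (Real.exp ((S.Q + S.L) * S.design.rate n (h * S.ξ n) 0) - 1)) := by
    calc _ ≤ _ := measure_mono hsub
      _ ≤ 0 + ∑ v ∈ S.design.configs n with v ≠ u,
            ENNReal.ofReal ((Fintype.card B * 2 + 2 : ℕ) * x v) := by
          refine (measure_union_le _ _).trans (add_le_add hN.le ?_)
          exact (measure_biUnion_finset_le _ _).trans (Finset.sum_le_sum fun v _ => hbad v)
      _ = ENNReal.ofReal ((Fintype.card B * 2 + 2 : ℕ) *
            ∑ v ∈ S.design.configs n with v ≠ u, x v) := by
          rw [zero_add, Finset.mul_sum, ENNReal.ofReal_sum_of_nonneg]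
          exact fun v _ => mul_nonneg (Nat.cast_nonneg _) (Real.exp_nonneg _)
      _ ≤ _ := ENNReal.ofReal_le_ofReal (mul_le_mul_of_nonneg_left hsum (Nat.cast_nonneg _))
  have hreal : μ.real (S.regularData δ n γ u)ᶜ ≤ (Fintype.card B * 2 + 2 : ℕ) *
      (Real.exp ((S.Q + S.L) * S.design.rate n (h * S.ξ n) 0) - 1) := by
    refine ENNReal.toReal_le_of_le_ofReal (mul_nonneg (Nat.cast_nonneg _) ?_) hcompl
    exact le_trans (Finset.sum_nonneg fun v _ => Real.exp_nonneg _) hsum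
  have := probReal_compl_eq_one_sub (μ := μ) (measurableSet_regularData hpar hdens δ hγ u)
  linarith

/-! ### The event -/

/-- Balanced configurations with regular observations. -/
def goodEvent (S : WeightedModel 𝓧 E) (δ : ℝ) (n : ℕ) (γ : Fin S.Q → Fin S.L → E) :
    Set (S.Config n × S.Data n) :=
  {ω | ω.1 ∈ S.design.configs n ∧ Design.Balanced (19 / 20 * S.μmin) ω.1 ∧
    ω.2 ∈ S.regularData δ n γ ω.1}

theorem measurableSet_goodEvent (hpar : S.IsParametrized) (hdens : S.HasDensities) (δ : ℝ) {n : ℕ}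
    {γ : Fin S.Q → Fin S.L → E} (hγ : γ ∈ S.GammaMat) : MeasurableSet (S.goodEvent δ n γ) := by
  have h : S.goodEvent δ n γ = ⋃ u ∈ {u : S.Config n | u ∈ S.design.configs n ∧
      Design.Balanced (19 / 20 * S.μmin) u}, {u} ×ˢ S.regularData δ n γ u := by
    ext ⟨u, X⟩
    simp only [goodEvent, Set.mem_ofPred_eq, Set.mem_iUnion, Set.mem_prod, Set.mem_singleton_iff]
    constructor
    · rintro ⟨h1, h2, h3⟩
      exact ⟨u, ⟨h1, h2⟩, rfl, h3⟩
    · rintro ⟨_, ⟨h1, h2⟩, rfl, h3⟩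
      exact ⟨h1, h2, h3⟩
  rw [h]
  exact MeasurableSet.biUnion (Set.to_countable _) fun u _ =>
    (measurableSet_singleton u).prod (measurableSet_regularData hpar hdens δ hγ u)

/-- Condition on the configuration: it is unbalanced with small prior probability, and given any
configuration the data are irregular with small probability. The bound does not depend on `γ`. -/
theorem exists_rate_goodEvent (hpar : S.IsParametrized) (hdens : S.HasDensities)
    (hKL : S.HasBoundedKL) (hsparse : S.IsSparse) (hconc : S.HasConcentration) {δ : ℝ}
    (hδ : 0 < δ) :
    ∃ h C : ℝ, 0 < h ∧ 0 ≤ C ∧ ∀ n : ℕ, ∀ γ ∈ S.GammaMat,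
      1 - (S.Q * Real.exp (-(S.μmin * n / 2000)) + S.L * Real.exp (-(S.μmin * S.m n / 2000)) +
          C * (Real.exp ((S.Q + S.L) * S.design.rate n (h * S.ξ n) 0) - 1)) ≤
        (S.trueLaw n).real (S.goodEvent δ n γ) := by
  classical
  obtain ⟨h, C, hh, hC, hreg⟩ := exists_rate_regularData hpar hdens hKL hsparse hconc hδ
  refine ⟨h, C, hh, hC, fun n γ hγ => ?_⟩
  have hprop := hpar.true_mem.1
  obtain ⟨hα, hα1, hβ, hβ1, hT⟩ := hprop
  have hμ := μmin_pos hpar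
  have hα' : ∀ q, S.μmin ≤ S.αs q := fun q => (min_le_left _ _).trans (hα q)
  have hβ' : ∀ q, S.μmin ≤ S.βs q := fun q => (min_le_right _ _).trans (hβ q)
  have hnn := fun u => S.design.prior_nonneg n (fun q => hμ.le.trans (hα' q))
    (fun q => hμ.le.trans (hβ' q)) u
  have hprob : ∀ u : S.Config n, IsProbabilityMeasure (S.dataLaw n S.πs S.γs u) := fun u => by
    have : ∀ p : {p // p ∈ S.design.cells n}, IsProbabilityMeasure (S.mixLaw
        (S.ξ n * S.πs (u.1 p.1.1) (u.2 p.1.2)) (S.γs (u.1 p.1.1) (u.2 p.1.2))) := fun p =>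
      isProbabilityMeasure_cellLaw hpar hdens hsparse n (S.block u p)
    rw [dataLaw]; infer_instance
  have hreal : (S.trueLaw n).real (S.goodEvent δ n γ) = ∑ u ∈ S.design.configs n,
      S.design.prior n S.αs S.βs u *
        (S.dataLaw n S.πs S.γs u).real (Prod.mk u ⁻¹' S.goodEvent δ n γ) := by
    rw [measureReal_def, trueLaw, Measure.finsetSum_apply, ENNReal.toReal_sum]
    · refine Finset.sum_congr rfl fun u _ => ?_
      rw [Measure.smul_apply, smul_eq_mul, ENNReal.toReal_mul, ENNReal.toReal_ofReal (hnn u),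
        Measure.dirac_prod, Measure.map_apply measurable_prodMk_left
          (measurableSet_goodEvent hpar hdens δ hγ), measureReal_def]
    · exact fun u _ => ENNReal.mul_ne_top ENNReal.ofReal_ne_top (measure_ne_top _ _)
  set b := Real.exp ((S.Q + S.L) * S.design.rate n (h * S.ξ n) 0) - 1 with hb
  have h1 : ∀ u ∈ S.design.configs n, S.design.prior n S.αs S.βs u * (1 - C * b) -
      (if ¬ Design.Balanced (19 / 20 * S.μmin) u then S.design.prior n S.αs S.βs u else 0) ≤
      S.design.prior n S.αs S.βs u *
        (S.dataLaw n S.πs S.γs u).real (Prod.mk u ⁻¹' S.goodEvent δ n γ) := fun u hu => by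
    have hCb : 0 ≤ C * b := by
      have h2 := S.design.rate_nonneg n (h * S.ξ n) 0
      have h3 : 1 ≤ Real.exp ((S.Q + S.L) * S.design.rate n (h * S.ξ n) 0) :=
        Real.one_le_exp (by positivity)
      exact mul_nonneg hC (by rw [hb]; linarith)
    by_cases hbal : Design.Balanced (19 / 20 * S.μmin) u
    · rw [if_neg (not_not.2 hbal), sub_zero]
      refine mul_le_mul_of_nonneg_left ((hreg n γ hγ u hu).trans (measureReal_mono ?_)) (hnn u)
      exact fun X hX => ⟨hu, hbal, hX⟩
    · rw [if_pos hbal]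
      have := mul_nonneg (hnn u) hCb
      have h4 : 0 ≤ S.design.prior n S.αs S.βs u *
        (S.dataLaw n S.πs S.γs u).real (Prod.mk u ⁻¹' S.goodEvent δ n γ) :=
        mul_nonneg (hnn u) measureReal_nonneg
      linarith
  rw [hreal]
  refine le_trans ?_ (Finset.sum_le_sum h1)
  rw [Finset.sum_sub_distrib, ← Finset.sum_mul, S.design.sum_prior n hα1 hβ1, ← Finset.sum_filter]
  have h5 := S.design.sum_prior_not_balanced_le n hα1 hβ1 hT hμ.le hα' hβ'
  linarith

end WeightedModel

namespace WeightedModel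

variable {𝓧 E : Type*} [MeasurableSpace 𝓧] {S : WeightedModel 𝓧 E}

/-! ### The separation -/

theorem sparsityGap_nonneg (hpar : S.IsParametrized) (e e' : Fin S.Q × Fin S.L) :
    0 ≤ S.sparsityGap e e' := by
  have := lt_of_lt_of_le hpar.a_pos
    (mem_Icc_of_mem_PiSet hpar (true_mem_PiSet hpar e.1 e.2)).1
  rw [sparsityGap]
  positivity

theorem weightGap_nonneg (e e' : Fin S.Q × Fin S.L) : 0 ≤ S.weightGap e e' :=
  ENNReal.toReal_nonneg

theorem gap_nonneg (hpar : S.IsParametrized) (e e' : Fin S.Q × Fin S.L) :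
    0 ≤ S.sparsityGap e e' + S.a * S.weightGap e e' :=
  add_nonneg (sparsityGap_nonneg hpar e e') (mul_nonneg hpar.a_pos.le (weightGap_nonneg e e'))

theorem separation_le (hpar : S.IsParametrized) {e e' : Fin S.Q × Fin S.L}
    (h : (S.πs e.1 e.2, S.γs e.1 e.2) ≠ (S.πs e'.1 e'.2, S.γs e'.1 e'.2)) :
    S.separation ≤ S.sparsityGap e e' + S.a * S.weightGap e e' :=
  csInf_le ⟨0, by
    rintro x ⟨e, e', -, rfl⟩
    exact gap_nonneg hpar e e'⟩ ⟨e, e', h, rfl⟩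

/-- Under this hypothesis every pair of blocks in the minimum `separation` is also a pair in both
`cMin` and `κMin`. If there is no such pair, all three infima are over the empty set and equal 0. -/
theorem c_ge (hpar : S.IsParametrized)
    (h : ∀ e e' : Fin S.Q × Fin S.L,
        S.πs e.1 e.2 ≠ S.πs e'.1 e'.2 ↔ S.γs e.1 e.2 ≠ S.γs e'.1 e'.2) :
    S.μmin ^ 2 * (S.cMin + S.a * S.κMin) / 16 ≤ S.c := by
  have hsep : S.cMin + S.a * S.κMin ≤ S.separation := by
    rw [separation]
    set A := {x | ∃ e e' : Fin S.Q × Fin S.L,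
      (S.πs e.1 e.2, S.γs e.1 e.2) ≠ (S.πs e'.1 e'.2, S.γs e'.1 e'.2) ∧
        x = S.sparsityGap e e' + S.a * S.weightGap e e'} with hA
    rcases A.eq_empty_or_nonempty with h0 | hne
    · have hno : ∀ e e' : Fin S.Q × Fin S.L, S.γs e.1 e.2 = S.γs e'.1 e'.2 := fun e e' => by
        by_contra hg
        have : S.sparsityGap e e' + S.a * S.weightGap e e' ∈ A :=
          ⟨e, e', fun heq => hg (Prod.ext_iff.1 heq).2, rfl⟩
        rw [h0] at this
        exact this
      have hno' : ∀ e e' : Fin S.Q × Fin S.L, S.πs e.1 e.2 = S.πs e'.1 e'.2 := fun e e' => by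
        by_contra hg
        exact (h e e').1 hg (hno e e')
      have e1 : S.cMin = 0 := by
        have : {x | ∃ e e' : Fin S.Q × Fin S.L, S.πs e.1 e.2 ≠ S.πs e'.1 e'.2 ∧
            x = S.sparsityGap e e'} = ∅ :=
          Set.eq_empty_of_forall_notMem fun x ⟨e, e', hx, _⟩ => hx (hno' e e')
        rw [cMin, this, Real.sInf_empty]
      have e2 : S.κMin = 0 := by
        have : {x | ∃ e e' : Fin S.Q × Fin S.L, S.γs e.1 e.2 ≠ S.γs e'.1 e'.2 ∧
            x = S.weightGap e e'} = ∅ :=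
          Set.eq_empty_of_forall_notMem fun x ⟨e, e', hx, _⟩ => hx (hno e e')
        rw [κMin, this, Real.sInf_empty]
      rw [h0, Real.sInf_empty, e1, e2, mul_zero, add_zero]
    · refine le_csInf hne ?_
      rintro x ⟨e, e', hee, rfl⟩
      have hπ : S.πs e.1 e.2 ≠ S.πs e'.1 e'.2 := fun hp => by
        have hg : S.γs e.1 e.2 = S.γs e'.1 e'.2 := by
          by_contra hg
          exact (h e e').2 hg hp
        exact hee (Prod.ext hp hg)
      have h1 : S.cMin ≤ S.sparsityGap e e' := csInf_le ⟨0, by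
        rintro x ⟨e, e', -, rfl⟩
        exact sparsityGap_nonneg hpar e e'⟩ ⟨e, e', hπ, rfl⟩
      have h2 : S.κMin ≤ S.weightGap e e' := csInf_le ⟨0, by
        rintro x ⟨e, e', -, rfl⟩
        exact weightGap_nonneg e e'⟩ ⟨e, e', (h e e').1 hπ, rfl⟩
      have := mul_le_mul_of_nonneg_left h2 hpar.a_pos.le
      linarith
  rw [c]
  have : 0 ≤ S.μmin ^ 2 := sq_nonneg _
  have := mul_le_mul_of_nonneg_left hsep this
  linarith

variable [Zero 𝓧]

/-! ### The likelihood -/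

theorem mixDensity_pos (hpar : S.IsParametrized) (hsparse : S.IsSparse) (n : ℕ) {p : ℝ}
    (hp : p ∈ S.PiSet) {g : E} {x : 𝓧} (hx : x ≠ 0 → 0 < S.f g x) :
    0 < S.mixDensity (S.ξ n * p) g x := by
  obtain ⟨h1, h2⟩ := mul_mem_Ioo hpar (hsparse.ξ_pos n) (hsparse.ξ_le n) hp
  rw [mixDensity]
  split_ifs with h
  · linarith
  · exact mul_pos h1 (hx h)

theorem likelihood_pos (hpar : S.IsParametrized) (hsparse : S.IsSparse) {n : ℕ}
    {π : Fin S.Q → Fin S.L → ℝ} (hπ : π ∈ S.PiMat) {γ : Fin S.Q → Fin S.L → E} {X : S.Data n}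
    (hX : ∀ p, X p ≠ 0 → ∀ q l, 0 < S.f (γ q l) (X p)) (u : S.Config n) :
    0 < S.likelihood n π γ X u :=
  Finset.prod_pos fun p _ => mixDensity_pos hpar hsparse n (hpar.PiMat_mem _ hπ _ _) fun h =>
    hX p h _ _

theorem likelihood_relabel {n : ℕ} {π : Fin S.Q → Fin S.L → ℝ} {γ : Fin S.Q → Fin S.L → E}
    {g : Equiv.Perm (Fin S.Q) × Equiv.Perm (Fin S.L)} (hπ : permuteMatrix g π = π)
    (hγ : permuteMatrix g γ = γ) (X : S.Data n) (u : S.Config n) :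
    S.likelihood n π γ X (relabel g u) = S.likelihood n π γ X u :=
  Finset.prod_congr rfl fun p _ => by
    rw [permuteMatrix_apply_relabel g hπ, permuteMatrix_apply_relabel g hγ]

/-- The log-likelihood ratio of one observation, for the blocks `e` and `e'`. -/
noncomputable def cellRatio (S : WeightedModel 𝓧 E) (n : ℕ) (π : Fin S.Q → Fin S.L → ℝ)
    (γ : Fin S.Q → Fin S.L → E) (e e' : Fin S.Q × Fin S.L) (x : 𝓧) : ℝ :=
  Real.log (S.mixDensity (S.ξ n * π e.1 e.2) (γ e.1 e.2) x /
    S.mixDensity (S.ξ n * π e'.1 e'.2) (γ e'.1 e'.2) x)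

/-- The coefficient of the centered indicator of a nonzero observation. -/
noncomputable def presenceCoef (S : WeightedModel 𝓧 E) (n : ℕ) (π : Fin S.Q → Fin S.L → ℝ)
    (γ : Fin S.Q → Fin S.L → E) (e e' : Fin S.Q × Fin S.L) : ℝ :=
  Real.log (π e.1 e.2 / π e'.1 e'.2) -
    Real.log ((1 - S.ξ n * π e.1 e.2) / (1 - S.ξ n * π e'.1 e'.2)) +
    ∫ y, S.logRatio (γ e.1 e.2) (γ e'.1 e'.2) y ∂S.weightLaw (S.γs e.1 e.2)

/-- The log-ratio takes one value at 0 and is a constant plus the weight log-ratio elsewhere, so it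
is affine in the presence indicator once the weight log-ratio is centered. Here `π` enters only the
mean and the coefficient; the random terms involve `γ` alone. This is what makes the event
independent of `π`. -/
theorem cellRatio_eq (hpar : S.IsParametrized) (hsparse : S.IsSparse) (n : ℕ)
    {π : Fin S.Q → Fin S.L → ℝ} (hπ : π ∈ S.PiMat) {γ : Fin S.Q → Fin S.L → E}
    (e e' : Fin S.Q × Fin S.L) {x : 𝓧} (hx : x ≠ 0 → ∀ q l, 0 < S.f (γ q l) x) :
    S.cellRatio n π γ e e' x = S.blockMean n π γ e e' +
      S.presenceCoef n π γ e e' * (present x - S.ξ n * S.πs e.1 e.2) +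
      present x * S.centeredLogRatio γ e e' x := by
  have hξ := hsparse.ξ_pos n
  rw [cellRatio, blockMean, cellMean, presenceMean, presenceCoef, centeredLogRatio, mixDensity,
    mixDensity, present]
  split_ifs with h
  · ring
  · have hp := fun e : Fin S.Q × Fin S.L =>
      lt_of_lt_of_le hpar.a_pos (mem_Icc_of_mem_PiSet hpar (hpar.PiMat_mem _ hπ e.1 e.2)).1
    have h1 := hx h e.1 e.2
    have h2 := hx h e'.1 e'.2
    have h3 := hp e
    have h4 := hp e'
    rw [mul_assoc, mul_assoc, mul_div_mul_left _ _ hξ.ne', mul_div_mul_comm,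
      Real.log_mul (div_pos h3 h4).ne' (div_pos h1 h2).ne', logRatio]
    ring

theorem log_likelihood_div (hpar : S.IsParametrized) (hsparse : S.IsSparse) {n : ℕ}
    {π : Fin S.Q → Fin S.L → ℝ} (hπ : π ∈ S.PiMat) {γ : Fin S.Q → Fin S.L → E} {X : S.Data n}
    (hX : ∀ p, X p ≠ 0 → ∀ q l, 0 < S.f (γ q l) (X p)) (u v : S.Config n) :
    Real.log (S.likelihood n π γ X u / S.likelihood n π γ X v) =
      ∑ p, S.cellRatio n π γ (S.block u p) (S.block v p) (X p) := by
  have hpos : ∀ (u : S.Config n) p, 0 < S.mixDensity (S.ξ n * π (u.1 p.1.1) (u.2 p.1.2))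
      (γ (u.1 p.1.1) (u.2 p.1.2)) (X p) := fun u p =>
    mixDensity_pos hpar hsparse n (hpar.PiMat_mem _ hπ _ _) fun h => hX p h _ _
  rw [likelihood, likelihood, ← Finset.prod_div_distrib, Real.log_prod]
  · rfl
  · exact fun p _ => (div_pos (hpos u p) (hpos v p)).ne'

/-- The factor `ξ` cancels in the ratio of the presence probabilities, so the bound is uniform in
`n`, `π` and `γ`. -/
theorem abs_presenceCoef_le (hbase : SigmaFinite S.base) (hpar : S.IsParametrized)
    (hdens : S.HasDensities) (hKL : S.HasBoundedKL) (hsparse : S.IsSparse) (n : ℕ)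
    {π : Fin S.Q → Fin S.L → ℝ} (hπ : π ∈ S.PiMat) {γ : Fin S.Q → Fin S.L → E}
    (hγ : γ ∈ S.GammaMat) (e e' : Fin S.Q × Fin S.L) :
    |S.presenceCoef n π γ e e'| ≤ 2 * -Real.log S.a +
      (⨆ g ∈ S.GammaSet, ⨆ g' ∈ S.GammaSet, S.weightKL g g').toReal := by
  have ha := hpar.a_pos
  have hmem := fun e : Fin S.Q × Fin S.L =>
    mem_Icc_of_mem_PiSet hpar (hpar.PiMat_mem _ hπ e.1 e.2)
  have hle := fun e : Fin S.Q × Fin S.L => one_sub_mul_mem ha (hsparse.ξ_pos n) (hsparse.ξ_le n)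
    (hmem e)
  have h1 := abs_log_div_le ha (hmem e).1 (by linarith [(hmem e).2]) (hmem e').1
    (by linarith [(hmem e').2])
  have h2 := abs_log_div_le ha (hle e).1 (hle e).2 (hle e').1 (hle e').2
  have hs := true_mem_GammaSet hpar e.1 e.2
  have hg := fun e : Fin S.Q × Fin S.L => hpar.GammaMat_mem _ hγ e.1 e.2
  rw [presenceCoef, integral_logRatio hbase hdens hKL hs (hg e) (hg e')]
  have h3 := weightKL_toReal_le hKL hs (hg e)
  have h4 := weightKL_toReal_le hKL hs (hg e')
  have h5 : 0 ≤ (S.weightKL (S.γs e.1 e.2) (γ e.1 e.2)).toReal := ENNReal.toReal_nonneg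
  have h6 : 0 ≤ (S.weightKL (S.γs e.1 e.2) (γ e'.1 e'.2)).toReal := ENNReal.toReal_nonneg
  rw [abs_le] at h1 h2 ⊢
  constructor <;> linarith [h1.1, h1.2, h2.1, h2.2]

/-- The log-likelihood ratio is close to its mean at the regular observations. -/
theorem exists_abs_log_likelihood_sub_le (hbase : SigmaFinite S.base) (hpar : S.IsParametrized)
    (hdens : S.HasDensities) (hKL : S.HasBoundedKL) (hsparse : S.IsSparse) :
    ∃ D : ℝ, 0 < D ∧ ∀ (δ : ℝ) (n : ℕ), ∀ π ∈ S.PiMat, ∀ γ ∈ S.GammaMat, ∀ (u : S.Config n),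
      ∀ X ∈ S.regularData δ n γ u, ∀ v ∈ S.design.configs n,
      |Real.log (S.likelihood n π γ X u / S.likelihood n π γ X v) -
        ∑ p ∈ S.design.changed u v, S.blockMean n π γ (S.block u p) (S.block v p)| ≤
        D * (δ * S.ξ n * S.design.wt u v) := by
  classical
  set M := 2 * -Real.log S.a +
      (⨆ g ∈ S.GammaSet, ⨆ g' ∈ S.GammaSet, S.weightKL g g').toReal with hM
  have hM0 : 0 ≤ M := by
    have h1 := Real.log_nonpos hpar.a_pos.le (by linarith [hpar.a_lt])
    have h2 : 0 ≤ (⨆ g ∈ S.GammaSet, ⨆ g' ∈ S.GammaSet, S.weightKL g g').toReal :=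
      ENNReal.toReal_nonneg
    linarith
  set B := (Fin S.Q × Fin S.L) × (Fin S.Q × Fin S.L)
  refine ⟨Fintype.card B * M + 1, by positivity, fun δ n π hπ γ hγ u X hX v hv => ?_⟩
  obtain ⟨hX1, hX2⟩ := hX
  obtain ⟨hc, hw1, hw2⟩ := hX2 v hv
  set t := δ * S.ξ n * S.design.wt u v with ht
  -- The coefficient depends on a cell only through its pair of blocks. Grouping the cells by pairs
  -- reduces the presence part to finitely many count deviations, each multiplied by a bounded
  -- number.
  have hterm : ∀ p, S.cellRatio n π γ (S.block u p) (S.block v p) (X p) =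
      (if p ∈ S.design.changed u v then S.blockMean n π γ (S.block u p) (S.block v p) else 0) +
      (∑ b ∈ (Finset.univ : Finset B).filter (fun b => b.1 ≠ b.2),
        S.presenceCoef n π γ b.1 b.2 * (if S.block u p = b.1 ∧ S.block v p = b.2 then
          present (X p) - S.ξ n * S.πs b.1.1 b.1.2 else 0)) +
      (if S.block u p = S.block v p then 0 else
        present (X p) * S.centeredLogRatio γ (S.block u p) (S.block v p) (X p)) := fun p => by
    by_cases hp : S.block u p = S.block v p
    · rw [if_neg (by rw [mem_changed]; exact not_not.2 hp), if_pos hp, Finset.sum_eq_zero]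
      · rw [hp, cellRatio, div_self, Real.log_one]
        · simp
        · exact (mixDensity_pos hpar hsparse n (hpar.PiMat_mem _ hπ _ _) fun h =>
            hX1 p h _ _).ne'
      · intro b hb
        rw [if_neg, mul_zero]
        rintro ⟨h1, h2⟩
        exact (Finset.mem_filter.1 hb).2 (by rw [← h1, ← h2, hp])
    · rw [if_pos (by rw [mem_changed]; exact hp), if_neg hp,
        cellRatio_eq hpar hsparse n hπ _ _ (hX1 p)]
      congr 2
      rw [Finset.sum_eq_single (S.block u p, S.block v p)]
      · simp
      · intro b _ hb
        rw [if_neg, mul_zero]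
        rintro ⟨h1, h2⟩
        exact hb (Prod.ext h1.symm h2.symm)
      · intro h
        exact (h (Finset.mem_filter.2 ⟨Finset.mem_univ _, hp⟩)).elim
  have hsum : Real.log (S.likelihood n π γ X u / S.likelihood n π γ X v) -
        ∑ p ∈ S.design.changed u v, S.blockMean n π γ (S.block u p) (S.block v p) =
      ∑ b ∈ (Finset.univ : Finset B).filter (fun b => b.1 ≠ b.2),
        S.presenceCoef n π γ b.1 b.2 * S.countDev u v b.1 b.2 X + S.weightDev γ u v X := by
    rw [log_likelihood_div hpar hsparse hπ hX1, Finset.sum_congr rfl fun p _ => hterm p,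
      Finset.sum_add_distrib, Finset.sum_add_distrib, ← Finset.sum_filter,
      Finset.filter_mem_eq_inter, Finset.univ_inter, Finset.sum_comm]
    simp only [countDev, weightDev, Finset.mul_sum]
    ring
  rw [hsum]
  have hcount : ∀ b ∈ (Finset.univ : Finset B).filter (fun b => b.1 ≠ b.2),
      |S.presenceCoef n π γ b.1 b.2 * S.countDev u v b.1 b.2 X| ≤ M * t := fun b hb => by
    obtain ⟨c1, c2⟩ := hc b.1 b.2 (Finset.mem_filter.1 hb).2
    rw [abs_mul]
    exact mul_le_mul (abs_presenceCoef_le hbase hpar hdens hKL hsparse n hπ hγ b.1 b.2)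
      (abs_le.2 ⟨by linarith, c1⟩) (abs_nonneg _) hM0
  have ht0 : 0 ≤ t := by linarith
  calc _ ≤ |∑ b ∈ (Finset.univ : Finset B).filter (fun b => b.1 ≠ b.2),
        S.presenceCoef n π γ b.1 b.2 * S.countDev u v b.1 b.2 X| + |S.weightDev γ u v X| :=
        abs_add_le _ _
    _ ≤ Fintype.card B * (M * t) + t := by
        refine add_le_add ((Finset.abs_sum_le_sum_abs _ _).trans
          ((Finset.sum_le_card_nsmul _ _ _ hcount).trans ?_)) (abs_le.2 ⟨by linarith, hw1⟩)
        rw [nsmul_eq_mul]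
        gcongr
        exact Finset.card_le_univ _
    _ = _ := by ring

/-- The minimum is over a finite set, nonempty since two rows or two columns differ, so it is
attained. If the attaining blocks have the same `π`, their weight laws differ by identifiability and
the divergence is positive. -/
theorem c_pos (hpar : S.IsParametrized) (hdens : S.HasDensities) (hid : S.IsIdentifiable)
    (hKL : S.HasBoundedKL) (h : 2 ≤ S.Q ∨ 2 ≤ S.L) : 0 < S.c := by
  have hμ := μmin_pos hpar
  have hsep : 0 < S.separation := by
    set A := {x | ∃ e e' : Fin S.Q × Fin S.L,
      (S.πs e.1 e.2, S.γs e.1 e.2) ≠ (S.πs e'.1 e'.2, S.γs e'.1 e'.2) ∧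
        x = S.sparsityGap e e' + S.a * S.weightGap e e'} with hA
    have hfin : A.Finite := by
      refine (Set.finite_range fun b : (Fin S.Q × Fin S.L) × (Fin S.Q × Fin S.L) =>
        S.sparsityGap b.1 b.2 + S.a * S.weightGap b.1 b.2).subset ?_
      rintro x ⟨e, e', -, rfl⟩
      exact ⟨(e, e'), rfl⟩
    have hne : A.Nonempty := by
      rcases h with h | h
      · obtain ⟨l, hl⟩ := hid.rows _ hpar.true_mem.2.1 _ hpar.true_mem.2.2 ⟨0, by omega⟩ ⟨1, by omega⟩
          (by simp)
        exact ⟨_, (_, l), (_, l), hl, rfl⟩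
      · obtain ⟨q, hq⟩ := hid.columns _ hpar.true_mem.2.1 _ hpar.true_mem.2.2 ⟨0, by omega⟩
          ⟨1, by omega⟩ (by simp)
        exact ⟨_, (q, _), (q, _), hq, rfl⟩
    obtain ⟨e, e', hee, hx⟩ := hne.csInf_mem hfin
    change S.separation = _ at hx
    rw [hx]
    have hπ : ∀ e : Fin S.Q × Fin S.L, 0 < S.πs e.1 e.2 := fun e => lt_of_lt_of_le hpar.a_pos
      (mem_Icc_of_mem_PiSet hpar (true_mem_PiSet hpar e.1 e.2)).1
    have ha := hpar.a_pos
    have ha1 : 0 < 1 - S.a := by linarith [hpar.a_lt]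
    by_cases hp : S.πs e.1 e.2 = S.πs e'.1 e'.2
    · have hg : S.γs e.1 e.2 ≠ S.γs e'.1 e'.2 := fun hg => hee (Prod.ext hp hg)
      have m1 := true_mem_GammaSet hpar e.1 e.2
      have m2 := true_mem_GammaSet hpar e'.1 e'.2
      have := hdens.prob _ m1
      have := hdens.prob _ m2
      have hw : 0 < S.weightGap e e' := by
        refine ENNReal.toReal_pos (fun h0 => hg (hid.law_injective m1 m2 ?_))
          (weightKL_ne_top hKL m1 m2)
        exact InformationTheory.klDiv_eq_zero_iff.1 h0
      exact add_pos_of_nonneg_of_pos (sparsityGap_nonneg hpar e e') (mul_pos ha hw)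
    · refine add_pos_of_pos_of_nonneg ?_ (mul_nonneg ha.le (weightGap_nonneg e e'))
      have h1 : 0 < (S.πs e.1 e.2 - S.πs e'.1 e'.2) ^ 2 := by
        have := sub_ne_zero.2 hp
        positivity
      have := hπ e
      rw [sparsityGap]
      positivity
  rw [c]
  positivity

end WeightedModel

/-! ### Change of the prior, neighbours, comparison of rates -/

namespace Design

variable {Q L : ℕ} {m : ℕ → ℕ}

theorem compatible_prodMk (D : Design Q L m) {T T' : Type*} {M : Fin Q → Fin L → T}
    {M' : Fin Q → Fin L → T'} (h : D.Compatible M) (h' : D.Compatible M') :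
    D.Compatible fun q l => (M q l, M' q l) := by
  cases D with
  | lbm => trivial
  | sbm G => exact fun hG q l => Prod.ext (h hG q l) (h' hG q l)

/-- Change of the prior probability with the configuration. -/
theorem prior_le_mul_exp (D : Design Q L m) (n : ℕ) {α : Fin Q → ℝ} {β : Fin L → ℝ} {K : ℝ}
    (hα : ∀ q, 0 ≤ α q) (hβ : ∀ l, 0 ≤ β l) (hαK : ∀ q q', α q ≤ α q' * Real.exp K)
    (hβK : ∀ l l', β l ≤ β l' * Real.exp K) (u v : LabelPair Q L n (m n)) :
    D.prior n α β u ≤ D.prior n α β v * Real.exp (K * D.ham n u v) := by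
  cases D with
  | lbm =>
    have h1 := prod_le_prod_mul_pow_hammingDist α hα hαK u.1 v.1
    have h2 := prod_le_prod_mul_pow_hammingDist β hβ hβK u.2 v.2
    refine (mul_le_mul h1 h2 (Finset.prod_nonneg fun j _ => hβ _) (mul_nonneg
      (Finset.prod_nonneg fun i _ => hα _) (by positivity))).trans (le_of_eq ?_)
    rw [prior, ham, ← Real.exp_nat_mul, ← Real.exp_nat_mul, mul_mul_mul_comm, ← Real.exp_add]
    push_cast
    ring_nf
  | sbm G =>
    have h1 := prod_le_prod_mul_pow_hammingDist α hα hαK u.1 v.1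
    rw [← Real.exp_nat_mul, mul_comm _ K] at h1
    exact h1

theorem prior_pos (D : Design Q L m) (n : ℕ) {α : Fin Q → ℝ} {β : Fin L → ℝ} (hα : ∀ q, 0 < α q)
    (hβ : ∀ l, 0 < β l) (u : LabelPair Q L n (m n)) : 0 < D.prior n α β u := by
  cases D with
  | lbm => exact mul_pos (Finset.prod_pos fun i _ => hα _) (Finset.prod_pos fun i _ => hβ _)
  | sbm G => exact Finset.prod_pos fun i _ => hα _

theorem rate_le (D : Design Q L m) {n : ℕ} (hmn : m n ≤ n) {κ : ℝ}
    (hκ : 0 ≤ κ) (K : ℝ) : D.rate n κ K ≤ 2 * n * Real.exp (-(κ * m n) + K) := by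
  cases D with
  | lbm =>
    have hmn' : (m n : ℝ) ≤ n := by exact_mod_cast hmn
    have h2 : (m n : ℝ) * Real.exp (-(κ * n) + K) ≤ n * Real.exp (-(κ * m n) + K) := by
      gcongr
    rw [rate]
    linarith
  | sbm G =>
    rw [rate]
    have h2 : Real.exp (-(2 * κ * n) + K) ≤ Real.exp (-(κ * n) + K) := by
      apply Real.exp_le_exp.2
      have : 0 ≤ κ * n := by positivity
      linarith
    have h3 : (n : ℝ) * Real.exp (-(2 * κ * n) + K) ≤ n * Real.exp (-(κ * n) + K) := by gcongr
    have h4 : 0 ≤ (n : ℝ) * Real.exp (-(κ * n) + K) := by positivity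
    linarith

/-- Every configuration has a neighbour with one different row. -/
theorem exists_neighbour (D : Design Q L m) {n : ℕ} (hn : 0 < n) (hQ : 2 ≤ Q)
    {u : LabelPair Q L n (m n)} (hu : u ∈ D.configs n) :
    ∃ v ∈ D.configs n, hammingDist u.1 v.1 = 1 ∧ D.ham n u v = 1 ∧ ∀ κ K : ℝ, 0 ≤ κ → m n ≤ n →
      D.rate n κ K ≤ 2 * n * Real.exp (-(κ * m n) + K) ∧ ∀ κ' ≤ κ,
      D.rate n κ K ≤ 2 * n * Real.exp (-((κ - κ') * m n)) * Real.exp (-(κ' * D.wt u v) + K) := by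
  classical
  set i₀ : Fin n := ⟨0, hn⟩
  obtain ⟨q, hq⟩ : ∃ q, q ≠ u.1 i₀ := by
    have : Nontrivial (Fin Q) := Fin.nontrivial_iff_two_le.2 hQ
    exact exists_ne _
  have hdist : hammingDist u.1 (Function.update u.1 i₀ q) = 1 := by
    rw [hammingDist, Finset.card_eq_one]
    refine ⟨i₀, ?_⟩
    ext i
    simp only [Finset.mem_filter, Finset.mem_univ, true_and, Finset.mem_singleton]
    constructor
    · intro h
      by_contra hi
      exact h (by rw [Function.update_of_ne hi])
    · rintro rfl
      rw [Function.update_self]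
      exact hq.symm
  cases D with
  | lbm =>
    refine ⟨(Function.update u.1 i₀ q, u.2), by simp [configs], hdist, by simp [ham, hdist],
      fun κ K hκ hmn => ?_⟩
    have h1 := (lbm L m : Design Q L m).rate_le hmn hκ K
    refine ⟨h1, fun κ' hκ' => h1.trans (le_of_eq ?_)⟩
    rw [mul_assoc (2 * (n : ℝ)), ← Real.exp_add, wt]
    simp only [hdist, hammingDist_self]
    push_cast
    ring_nf
  | sbm G =>
    have hu' : u.1 = u.2 := by
      simpa only [configs, Finset.mem_filter, Finset.mem_univ, true_and] using hu
    refine ⟨(Function.update u.1 i₀ q, Function.update u.1 i₀ q), by simp [configs], hdist, hdist,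
      fun κ K hκ hmn => ⟨(sbm G : Design Q Q _).rate_le hmn hκ K, fun κ' hκ' => ?_⟩⟩
    -- A change of one node has weight `2 n`, matching the exponent `2 κ n` of the rate; only half
    -- of the spare `2 (κ - κ') n` is needed.
    rw [mul_assoc (2 * (n : ℝ)), ← Real.exp_add, wt]
    dsimp only
    rw [← hu', hdist, rate]
    push_cast
    have h2 : Real.exp (-(2 * κ * n) + K) ≤
        Real.exp (-((κ - κ') * n) + (-(κ' * (n * 1 + n * 1)) + K)) := by
      apply Real.exp_le_exp.2
      have : 0 ≤ (κ - κ') * n := mul_nonneg (sub_nonneg.2 hκ') (Nat.cast_nonneg _)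
      linarith
    have h3 : (n : ℝ) * Real.exp (-(2 * κ * n) + K) ≤
        n * Real.exp (-((κ - κ') * n) + (-(κ' * (n * 1 + n * 1)) + K)) := by gcongr
    have h4 : 0 ≤ (n : ℝ) * Real.exp (-((κ - κ') * n) + (-(κ' * (n * 1 + n * 1)) + K)) := by
      positivity
    linarith

/-- Comparison of the rates for two exponents. -/
theorem mul_rate_le (D : Design Q L m) (n : ℕ) {κ κ' K M : ℝ} (hmn : m n ≤ n) (hκ : κ ≤ κ')
    (hM : M ≤ Real.exp ((κ' - κ) * m n)) : M * D.rate n κ' K ≤ D.rate n κ K := by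
  have hmn' : (m n : ℝ) ≤ n := by exact_mod_cast hmn
  have key : ∀ t : ℝ, m n ≤ t → M * Real.exp (-(κ' * t) + K) ≤ Real.exp (-(κ * t) + K) := by
    intro t ht
    calc M * Real.exp (-(κ' * t) + K) ≤ Real.exp ((κ' - κ) * t) * Real.exp (-(κ' * t) + K) := by
          refine mul_le_mul_of_nonneg_right (hM.trans (Real.exp_le_exp.2 ?_)) (Real.exp_nonneg _)
          exact mul_le_mul_of_nonneg_left ht (sub_nonneg.2 hκ)
      _ = _ := by
          rw [← Real.exp_add]
          ring_nf
  cases D with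
  | lbm =>
    have h1 := mul_le_mul_of_nonneg_left (key (m n) le_rfl) (Nat.cast_nonneg n)
    have h2 := mul_le_mul_of_nonneg_left (key n hmn') (Nat.cast_nonneg (m n))
    rw [rate, rate]
    linarith
  | sbm G =>
    have h1 := mul_le_mul_of_nonneg_left (key (2 * n) (by
      have : (0 : ℝ) ≤ n := Nat.cast_nonneg n
      linarith)) (Nat.cast_nonneg n)
    rw [rate, rate]
    have e : ∀ κ : ℝ, κ * (2 * (n : ℝ)) = 2 * κ * n := fun κ => by ring
    rw [e, e] at h1
    linarith

end Design

namespace WeightedModel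

variable {𝓧 E : Type*} [MeasurableSpace 𝓧] {S : WeightedModel 𝓧 E}

/-! ### The prior probabilities -/

theorem le_one_of_sum_eq_one {k : ℕ} {p : Fin k → ℝ} (hp : ∀ q, 0 ≤ p q) (h : ∑ q, p q = 1)
    (q : Fin k) : p q ≤ 1 := by
  rw [← h]
  exact Finset.single_le_sum (fun q _ => hp q) (Finset.mem_univ q)

/-- Compare through `αmax = αmin * (αmax / αmin)`. The supremum is finite because proportions are at
most 1. -/
theorem le_mul_exp_K (hpar : S.IsParametrized) {α : Fin S.Q → ℝ} {β : Fin S.L → ℝ}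
    (h : (α, β) ∈ S.proportions) :
    (∀ q q', α q ≤ α q' * Real.exp S.K) ∧ ∀ l l', β l ≤ β l' * Real.exp S.K := by
  have hα := hpar.αmin_pos
  have hβ := hpar.βmin_pos
  constructor
  · intro q q'
    have h1 : α q ≤ S.αmax := le_csSup ⟨1, by
      rintro x ⟨p, hp, q, rfl⟩
      exact le_one_of_sum_eq_one (fun q => hα.le.trans (hp.1 q)) hp.2.1 q⟩ ⟨_, h, q, rfl⟩
    have h2 : 0 < S.αmax := lt_of_lt_of_le (lt_of_lt_of_le hα (h.1 q)) h1
    have h3 : S.αmax / S.αmin ≤ Real.exp S.K := by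
      rw [← Real.exp_log (div_pos h2 hα)]
      exact Real.exp_le_exp.2 (le_max_left _ _)
    calc α q ≤ S.αmin * (S.αmax / S.αmin) := by rwa [mul_div_cancel₀ _ hα.ne']
      _ ≤ α q' * Real.exp S.K := mul_le_mul (h.1 q') h3 (by positivity) (hα.le.trans (h.1 q'))
  · intro q q'
    have h1 : β q ≤ S.βmax := le_csSup ⟨1, by
      rintro x ⟨p, hp, q, rfl⟩
      exact le_one_of_sum_eq_one (fun q => hβ.le.trans (hp.2.2.1 q)) hp.2.2.2.1 q⟩ ⟨_, h, q, rfl⟩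
    have h2 : 0 < S.βmax := lt_of_lt_of_le (lt_of_lt_of_le hβ (h.2.2.1 q)) h1
    have h3 : S.βmax / S.βmin ≤ Real.exp S.K := by
      rw [← Real.exp_log (div_pos h2 hβ)]
      exact Real.exp_le_exp.2 (le_max_right _ _)
    calc β q ≤ S.βmin * (S.βmax / S.βmin) := by rwa [mul_div_cancel₀ _ hβ.ne']
      _ ≤ β q' * Real.exp S.K :=
        mul_le_mul (h.2.2.1 q') h3 (by positivity) (hβ.le.trans (h.2.2.1 q'))

/-- Without distinct blocks `separation` would be the infimum of the empty set, which is 0. -/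
theorem exists_ne_of_c_pos (hc : 0 < S.c) : ∃ e e' : Fin S.Q × Fin S.L,
    (S.πs e.1 e.2, S.γs e.1 e.2) ≠ (S.πs e'.1 e'.2, S.γs e'.1 e'.2) := by
  by_contra! h
  have : {x | ∃ e e' : Fin S.Q × Fin S.L,
    (S.πs e.1 e.2, S.γs e.1 e.2) ≠ (S.πs e'.1 e'.2, S.γs e'.1 e'.2) ∧
      x = S.sparsityGap e e' + S.a * S.weightGap e e'} = ∅ :=
    Set.eq_empty_of_forall_notMem fun x ⟨e, e', hx, _⟩ => hx (h e e')
  rw [c, separation, this, Real.sInf_empty] at hc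
  simp at hc

theorem μmin_le_one (hpar : S.IsParametrized) (hc : 0 < S.c) : S.μmin ≤ 1 := by
  obtain ⟨e, -, -⟩ := exists_ne_of_c_pos hc
  obtain ⟨hα, hα1, -⟩ := hpar.true_mem.1
  exact (min_le_left _ _).trans ((hα e.1).trans
    (le_one_of_sum_eq_one (fun q => hpar.αmin_pos.le.trans (hα q)) hα1 e.1))

theorem separation_pos (hpar : S.IsParametrized) (hc : 0 < S.c) :
    0 < S.separation ∧ 16 * S.c ≤ S.separation := by
  have h1 := μmin_le_one hpar hc
  have h2 := μmin_pos hpar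
  have h3 : 0 < S.separation := by
    by_contra! h
    rw [c] at hc
    have : S.μmin ^ 2 * S.separation ≤ 0 := mul_nonpos_of_nonneg_of_nonpos (sq_nonneg _) h
    linarith
  refine ⟨h3, ?_⟩
  have h4 : S.μmin ^ 2 * S.separation ≤ 1 * S.separation := by
    gcongr
    exact pow_le_one₀ h2.le h1
  rw [c]
  linarith

/-! ### Two-sided bounds for likelihood ratios -/

variable [Zero 𝓧] [NormedAddCommGroup E]

/-- The divergence between two distinct true blocks is at least `ξ * separation`, and `16 c ≤
separation` because `μmin ≤ 1`. Hence the deviations, of order `ξ c`, are small against `C`. -/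
theorem κMax_ge (hbase : SigmaFinite S.base) (hpar : S.IsParametrized)
    (hdens : S.HasDensities) (hKL : S.HasBoundedKL) (hLip : S.IsLipschitz) (hsparse : S.IsSparse)
    [MeasurableSingletonClass 𝓧] (hc : 0 < S.c) (n : ℕ) : 16 * (S.ξ n * S.c) ≤ S.κMax n := by
  obtain ⟨e, e', hee⟩ := exists_ne_of_c_pos hc
  have hξ := hsparse.ξ_pos n
  have h1 := blockMean_ge hbase hpar hdens hKL hLip hsparse n hpar.true_mem.2.1 hpar.true_mem.2.2
    e e'
  rw [sub_self, norm_zero, mul_zero, mul_zero, mul_zero, sub_zero] at h1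
  have h2 : S.blockMean n S.πs S.γs e e' ≤ S.κMax n :=
    cellMean_le_κMax hbase hpar hdens hKL hsparse n (true_mem_GammaSet hpar _ _)
      (true_mem_GammaSet hpar _ _) (true_mem_GammaSet hpar _ _) (true_mem_PiSet hpar _ _)
      (true_mem_PiSet hpar _ _) (true_mem_PiSet hpar _ _)
  have h3 := separation_le hpar hee
  have h4 := (separation_pos hpar hc).2
  have h5 : S.ξ n * (16 * S.c) ≤ S.ξ n * (S.sparsityGap e e' + S.a * S.weightGap e e') := by
    gcongr
    linarith
  linarith

variable [MeasurableSingletonClass 𝓧]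

/-- Two-sided bounds for the likelihood ratios on the event, with room to spare. -/
theorem exists_log_likelihood_bounds (hbase : SigmaFinite S.base) (hpar : S.IsParametrized)
    (hdens : S.HasDensities) (hid : S.IsIdentifiable) (hsym : S.HasSymmetries)
    (hKL : S.HasBoundedKL) (hLip : S.IsLipschitz) (hsparse : S.IsSparse) (hc : 0 < S.c) :
    ∃ δ : ℝ, 0 < δ ∧ ∀ n : ℕ, 0 < n → 0 < S.m n → 50 ≤ S.μmin ^ 2 * n →
      ∀ π ∈ S.PiMat, ∀ γ ∈ S.GammaMat, ∀ u X, (u, X) ∈ S.goodEvent δ n γ →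
        ∀ v ∈ S.design.configs n,
          (∀ h, S.Attains u v h →
            S.ξ n * (53 / 50 * S.c - 2 * S.L0 * ‖((π, γ) : _ × _) - (S.πs, S.γs)‖) *
                S.design.wt u (relabel h v) ≤
              Real.log (S.likelihood n π γ X u / S.likelihood n π γ X (relabel h v))) ∧
          Real.log (S.likelihood n π γ X u / S.likelihood n π γ X v) ≤
            3 / 4 * S.C n * S.design.wt u v := by
  classical
  obtain ⟨D, hD, hlog⟩ := exists_abs_log_likelihood_sub_le hbase hpar hdens hKL hsparse
  -- This `δ` makes the total deviation at most `3/50 c ξ wt`.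
  refine ⟨3 / 50 * S.c / D, by positivity, fun n hn hm hμn π hπ γ hγ u X hω v hv => ?_⟩
  obtain ⟨hu, hbal, hX⟩ := hω
  have hu : u ∈ S.design.configs n := hu
  have hξ := hsparse.ξ_pos n
  set d := ‖((π, γ) : _ × _) - (S.πs, S.γs)‖ with hd
  have hd0 : 0 ≤ d := norm_nonneg _
  have hL0 : 0 ≤ S.L0 := by
    have := hpar.a_pos
    have := hLip.1
    rw [L0]
    positivity
  have hδ : ∀ w : ℝ, D * (3 / 50 * S.c / D * S.ξ n * w) = 3 / 50 * S.c * S.ξ n * w := fun w => by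
    field_simp
  set A : Fin S.Q → Fin S.L → ℝ × E := fun q l => (S.πs q l, S.γs q l) with hA
  obtain ⟨hsep, hsep16⟩ := separation_pos hpar hc
  refine ⟨fun h hatt => ?_, ?_⟩
  · have hh := hatt.1
    have hinv : ∀ g ∈ S.Sig, permuteMatrix g A = A := fun g hg => by
      obtain ⟨h1, h2⟩ := hsym.invariant g hg _ hpar.true_mem.2.1 _ hpar.true_mem.2.2
      funext q l
      exact Prod.ext (congrFun (congrFun h1 q) l) (congrFun (congrFun h2 q) l)
    have hmax : ∀ g ∈ S.design.relabellings, permuteMatrix g A = A → g ∈ S.Sig :=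
      fun g hg hgA => by
        by_contra hgS
        refine hsym.maximal g hg hgS _ hpar.true_mem.2.1 _ hpar.true_mem.2.2 ⟨?_, ?_⟩
        · funext q l
          exact congrArg Prod.fst (congrFun (congrFun hgA q) l)
        · funext q l
          exact congrArg Prod.snd (congrFun (congrFun hgA q) l)
    have hcard := S.design.card_separated_ge A
      (hid.rows _ hpar.true_mem.2.1 _ hpar.true_mem.2.2)
      (hid.columns _ hpar.true_mem.2.1 _ hpar.true_mem.2.2) S.Sig hinv hmax
      (S.design.compatible_prodMk (hpar.PiMat_compatible _ hpar.true_mem.2.1)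
        (hpar.GammaMat_compatible _ hpar.true_mem.2.2)) u v hu hv (μmin_pos hpar)
      (μmin_le_one hpar hc) hn hm hμn hbal h hh (hsym.le hh) hatt.2
    have hv' : relabel h v ∈ S.design.configs n := S.design.relabel_mem_configs (hsym.le hh) hv
    generalize relabel h v = v' at hcard hv' ⊢
    have h1 := (abs_le.1 (hlog _ n π hπ γ hγ u X hX v' hv')).1
    rw [hδ] at h1
    set w : ℝ := (S.design.wt u v' : ℝ) with hw
    -- A changed cell with equal true parameters gains nothing but still pays for the distance of
    -- the parameters, so the loss is summed over all changed cells and the gain over the separated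
    -- ones.
    have hcell : ∀ p ∈ S.design.changed u v',
        (if p ∈ S.design.separated A u v' then S.ξ n * S.separation else 0) -
          2 * (S.ξ n * (S.L0 * d)) ≤ S.blockMean n π γ (S.block u p) (S.block v' p) :=
      fun p _ => by
        refine le_trans ?_ (blockMean_ge hbase hpar hdens hKL hLip hsparse n hπ hγ _ _)
        gcongr
        split_ifs with hp
        · gcongr
          exact separation_le hpar ((S.design.mem_separated A u v' p).1 hp)
        · exact mul_nonneg hξ.le (gap_nonneg hpar _ _)
    have h2 := Finset.sum_le_sum hcell
    rw [Finset.sum_sub_distrib, ← Finset.sum_filter, Finset.filter_mem_eq_inter,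
      Finset.inter_eq_right.2 (S.design.separated_subset_changed A u v'), Finset.sum_const,
      Finset.sum_const, nsmul_eq_mul, nsmul_eq_mul] at h2
    have h3 : ((S.design.changed u v').card : ℝ) ≤ w :=
      Nat.cast_le.2 (S.design.card_changed_le u v')
    have h4 : ((S.design.changed u v').card : ℝ) * (2 * (S.ξ n * (S.L0 * d))) ≤
        w * (2 * (S.ξ n * (S.L0 * d))) := by gcongr
    have h5 : 7 / 100 * S.μmin ^ 2 * w * (S.ξ n * S.separation) ≤
        ((S.design.separated A u v').card : ℝ) * (S.ξ n * S.separation) := by gcongr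
    -- `7/100` is `28/25` of the `1/16` in the definition of `c`; after the deviation `3/50` there
    -- remains `53/50`.
    have h6 : 7 / 100 * S.μmin ^ 2 * w * (S.ξ n * S.separation) =
        28 / 25 * (S.c * S.ξ n * w) := by
      rw [c]; ring
    rw [h6] at h5
    linarith
  · have h1 := (abs_le.1 (hlog _ n π hπ γ hγ u X hX v hv)).2
    rw [hδ] at h1
    set w : ℝ := (S.design.wt u v : ℝ) with hw
    have hw0 : 0 ≤ w := Nat.cast_nonneg _
    have hκ := κMax_ge hbase hpar hdens hKL hLip hsparse hc n
    have hκ0 : 0 ≤ S.κMax n := le_trans (by positivity) hκ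
    have h2 : ∑ p ∈ S.design.changed u v, S.blockMean n π γ (S.block u p) (S.block v p) ≤
        (S.design.changed u v).card • S.κMax n := Finset.sum_le_card_nsmul _ _ _ fun p _ =>
      cellMean_le_κMax hbase hpar hdens hKL hsparse n (true_mem_GammaSet hpar _ _)
      (hpar.GammaMat_mem _ hγ _ _) (hpar.GammaMat_mem _ hγ _ _) (true_mem_PiSet hpar _ _)
      (hpar.PiMat_mem _ hπ _ _) (hpar.PiMat_mem _ hπ _ _)
    rw [nsmul_eq_mul] at h2
    have h3 : ((S.design.changed u v).card : ℝ) ≤ w :=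
      Nat.cast_le.2 (S.design.card_changed_le u v)
    have h4 : ((S.design.changed u v).card : ℝ) * S.κMax n ≤ w * S.κMax n := by gcongr
    -- The deviation is at most `3/800 κMax wt`, whereas `3/4 C` is `3/2 κMax`.
    have h5 : 16 * (S.ξ n * S.c) * w ≤ S.κMax n * w := by gcongr
    have h6 : 0 ≤ S.ξ n * S.c * w := by positivity
    rw [C]
    linarith

end WeightedModel

/-! ### Relabellings of configurations with large classes -/

theorem exists_labelCount_pos {n k : ℕ} {z : Fin n → Fin k} {q : Fin k} (h : 0 < labelCount z q) :
    ∃ i, z i = q := by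
  obtain ⟨i, hi⟩ := Finset.card_pos.1 h
  exact ⟨i, (Finset.mem_filter.1 hi).2⟩

theorem relabel_left_injective {Q L n m : ℕ} {u : LabelPair Q L n m}
    (h1 : ∀ q, 0 < labelCount u.1 q) (h2 : ∀ l, 0 < labelCount u.2 l) :
    Function.Injective fun g : Equiv.Perm (Fin Q) × Equiv.Perm (Fin L) => relabel g u := by
  intro g g' h
  refine Prod.ext (Equiv.ext fun q => ?_) (Equiv.ext fun l => ?_)
  · obtain ⟨i, rfl⟩ := exists_labelCount_pos (h1 q)
    exact congrFun (congrArg Prod.fst h) i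
  · obtain ⟨i, rfl⟩ := exists_labelCount_pos (h2 l)
    exact congrFun (congrArg Prod.snd h) i

/-- A nontrivial row permutation changes the labels of a whole class, hence of at least two rows. So
a neighbour with one changed row is never equivalent to `u`. -/
theorem relabel_fst_ne_of_hammingDist_eq_one {Q L n m : ℕ} {u v : LabelPair Q L n m}
    (h1 : ∀ q, 1 < labelCount u.1 q) (h : hammingDist u.1 v.1 = 1)
    (g : Equiv.Perm (Fin Q) × Equiv.Perm (Fin L)) : relabel g u ≠ v := by
  rintro rfl
  by_cases hg : g.1 = 1
  · have : (relabel g u).1 = u.1 := by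
      simp [relabel, hg]
    rw [this, hammingDist_self] at h
    exact one_ne_zero h.symm
  · obtain ⟨q, hq⟩ : ∃ q, g.1 q ≠ q := by
      by_contra! h'
      exact hg (Equiv.ext h')
    have hle : labelCount u.1 q ≤ hammingDist u.1 (relabel g u).1 := by
      refine Finset.card_le_card fun i hi => Finset.mem_filter.2 ⟨Finset.mem_univ _, fun h' => ?_⟩
      have hi := (Finset.mem_filter.1 hi).2
      apply hq
      rw [← hi]
      exact h'.symm
    have := h1 q
    omega

/-! ### Posterior probabilities on the event -/

namespace WeightedModel

variable {𝓧 E : Type*} [MeasurableSpace 𝓧] {S : WeightedModel 𝓧 E}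

theorem proportions_pos (hpar : S.IsParametrized) {α : Fin S.Q → ℝ} {β : Fin S.L → ℝ}
    (h : (α, β) ∈ S.proportions) : (∀ q, 0 < α q) ∧ ∀ l, 0 < β l :=
  ⟨fun q => lt_of_lt_of_le hpar.αmin_pos (h.1 q),
    fun l => lt_of_lt_of_le hpar.βmin_pos (h.2.2.1 l)⟩

theorem exists_attains {n : ℕ} (u v : S.Config n) : ∃ h, S.Attains u v h := by
  classical
  obtain ⟨h, hh, hmin⟩ := Set.exists_min_image (S.Sig : Set _)
    (fun g => hammingDist u.1 (relabel g v).1 + hammingDist u.2 (relabel g v).2)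
    (Set.toFinite _) ⟨1, S.Sig.one_mem⟩
  exact ⟨h, hh, hmin⟩

variable [Zero 𝓧] [NormedAddCommGroup E]

/-- The properties of a configuration and an array of observations that are used for the bounds of
the posterior probabilities. -/
structure HasLikelihoodBounds (S : WeightedModel 𝓧 E) (n : ℕ) (θ : S.Param) (u : S.Config n)
    (X : S.Data n) : Prop where
  mem : u ∈ S.design.configs n
  params : θ ∈ S.params
  balanced : Design.Balanced (19 / 20 * S.μmin) u
  density : ∀ p, X p ≠ 0 → ∀ q l, 0 < S.f (θ.2.2 q l) (X p)
  lower : ∀ v ∈ S.design.configs n, ∀ h, S.Attains u v h →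
    S.ξ n * (53 / 50 * S.c - 2 * S.L0 * ‖θ.2 - (S.πs, S.γs)‖) * S.design.wt u (relabel h v) ≤
      Real.log (S.likelihood n θ.2.1 θ.2.2 X u / S.likelihood n θ.2.1 θ.2.2 X (relabel h v))
  upper : ∀ v ∈ S.design.configs n,
    Real.log (S.likelihood n θ.2.1 θ.2.2 X u / S.likelihood n θ.2.1 θ.2.2 X v) ≤
      3 / 4 * S.C n * S.design.wt u v

/-- The sizes for which the bounds of the posterior probabilities hold. -/
structure IsLarge (S : WeightedModel 𝓧 E) (n : ℕ) : Prop where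
  n_pos : 0 < n
  m_pos : 0 < S.m n
  one_lt : 1 < 19 / 20 * S.μmin * n
  groups_le : (S.Q + S.L : ℝ) ≤ Real.exp (S.ξ n * (3 / 50 * S.c) * S.m n)
  card_le : 6 * n * (Nat.card S.Sig : ℝ) ^ 2 ≤ Real.exp (S.ξ n * S.c * S.m n)
  bSeq_le : S.bSeq n ≤ 1

namespace HasLikelihoodBounds

variable {n : ℕ} {θ : S.Param} {u : S.Config n} {X : S.Data n}

section

variable (H : S.HasLikelihoodBounds n θ u X) (hpar : S.IsParametrized) (hsparse : S.IsSparse)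

include H hpar hsparse

theorem likelihood_pos (v : S.Config n) : 0 < S.likelihood n θ.2.1 θ.2.2 X v :=
  WeightedModel.likelihood_pos hpar hsparse H.params.2.1 H.density v

theorem weight_pos (v : S.Config n) :
    0 < S.design.prior n θ.1.1 θ.1.2 v * S.likelihood n θ.2.1 θ.2.2 X v := by
  obtain ⟨h1, h2⟩ := proportions_pos hpar H.params.1
  exact mul_pos (S.design.prior_pos n h1 h2 v) (H.likelihood_pos hpar hsparse v)

theorem sum_weight_pos : 0 < ∑ v ∈ S.design.configs n,
    S.design.prior n θ.1.1 θ.1.2 v * S.likelihood n θ.2.1 θ.2.2 X v :=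
  Finset.sum_pos (fun v _ => H.weight_pos hpar hsparse v) ⟨u, H.mem⟩

theorem posterior_pos (v : S.Config n) : 0 < S.posterior n θ X v :=
  div_pos (H.weight_pos hpar hsparse v) (H.sum_weight_pos hpar hsparse)

theorem sum_posterior : ∑ v ∈ S.design.configs n, S.posterior n θ X v = 1 := by
  simp only [posterior]
  rw [← Finset.sum_div, div_self (H.sum_weight_pos hpar hsparse).ne']

omit hsparse in
theorem prior_pos (v : S.Config n) : 0 < S.design.prior n θ.1.1 θ.1.2 v := by
  obtain ⟨h1, h2⟩ := proportions_pos hpar H.params.1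
  exact S.design.prior_pos n h1 h2 v

theorem log_posterior_div (v w : S.Config n) :
    Real.log (S.posterior n θ X v / S.posterior n θ X w) =
      Real.log (S.design.prior n θ.1.1 θ.1.2 v / S.design.prior n θ.1.1 θ.1.2 w) +
        Real.log (S.likelihood n θ.2.1 θ.2.2 X v / S.likelihood n θ.2.1 θ.2.2 X w) := by
  have h1 := H.prior_pos hpar v
  have h2 := H.prior_pos hpar w
  have h3 := H.likelihood_pos hpar hsparse v
  have h4 := H.likelihood_pos hpar hsparse w
  rw [posterior, posterior, div_div_div_cancel_right₀ (H.sum_weight_pos hpar hsparse).ne',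
    mul_div_mul_comm, Real.log_mul (div_pos h1 h2).ne' (div_pos h3 h4).ne']

omit hsparse in
theorem log_prior_div_le (v w : S.Config n) :
    Real.log (S.design.prior n θ.1.1 θ.1.2 v / S.design.prior n θ.1.1 θ.1.2 w) ≤
      S.K * S.design.ham n v w := by
  obtain ⟨h1, h2⟩ := proportions_pos hpar H.params.1
  obtain ⟨h3, h4⟩ := le_mul_exp_K hpar H.params.1
  rw [Real.log_le_iff_le_exp (div_pos (H.prior_pos hpar v) (H.prior_pos hpar w)),
    div_le_iff₀ (H.prior_pos hpar w), mul_comm]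
  exact S.design.prior_le_mul_exp n (fun q => (h1 q).le) (fun l => (h2 l).le) h3 h4 v w

omit hsparse in
theorem neg_le_log_prior_div (v w : S.Config n) :
    -(S.K * S.design.ham n v w) ≤
      Real.log (S.design.prior n θ.1.1 θ.1.2 v / S.design.prior n θ.1.1 θ.1.2 w) := by
  have := H.log_prior_div_le hpar w v
  rw [← inv_div, Real.log_inv, S.design.ham_comm] at this
  linarith

theorem posterior_le_of_log_le {v w : S.Config n} {t : ℝ}
    (h : Real.log (S.posterior n θ X v / S.posterior n θ X w) ≤ t) :
    S.posterior n θ X v ≤ S.posterior n θ X w * Real.exp t := by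
  have h1 := H.posterior_pos hpar hsparse v
  have h2 := H.posterior_pos hpar hsparse w
  rwa [Real.log_le_iff_le_exp (div_pos h1 h2), div_le_iff₀ h2, mul_comm] at h

omit hpar hsparse in
theorem likelihood_relabel (hsym : S.HasSymmetries)
    {g : Equiv.Perm (Fin S.Q) × Equiv.Perm (Fin S.L)} (hg : g ∈ S.Sig)
    (v : S.Config n) :
    S.likelihood n θ.2.1 θ.2.2 X (relabel g v) = S.likelihood n θ.2.1 θ.2.2 X v := by
  obtain ⟨h1, h2⟩ := hsym.invariant g hg _ H.params.2.1 _ H.params.2.2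
  exact WeightedModel.likelihood_relabel h1 h2 X v

/-- The bounds for the ratios of posterior probabilities, with room to spare. -/
theorem log_posterior_bounds (hsym : S.HasSymmetries) {v : S.Config n}
    (hv : v ∈ S.design.configs n) {g h : Equiv.Perm (Fin S.Q) × Equiv.Perm (Fin S.L)}
    (hg : g ∈ S.Sig) (hh : S.Attains u v h) :
    S.ξ n * (53 / 50 * S.c - 2 * S.L0 * ‖θ.2 - (S.πs, S.γs)‖) * S.design.wt u (relabel h v)
          - S.K * S.design.ham n (relabel g u) v
        ≤ Real.log (S.posterior n θ X (relabel g u) / S.posterior n θ X v) ∧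
      Real.log (S.posterior n θ X (relabel g u) / S.posterior n θ X v)
        ≤ 3 / 4 * S.C n * S.design.wt u (relabel h v) +
          S.K * S.design.ham n (relabel g u) v := by
  have h1 := H.lower v hv h hh
  have h2 := H.upper _ (S.design.relabel_mem_configs (hsym.le hh.1) hv)
  have h3 := H.log_prior_div_le hpar (relabel g u) v
  have h4 := H.neg_le_log_prior_div hpar (relabel g u) v
  rw [H.likelihood_relabel hsym hh.1] at h1 h2
  rw [H.log_posterior_div hpar hsparse, H.likelihood_relabel hsym hg]
  constructor <;> linarith

theorem ratioBounds (hsym : S.HasSymmetries) (hc : 0 < S.c) (hC : 0 ≤ S.C n) :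
    S.RatioBounds n θ u X := fun v hv =>
  ⟨H.posterior_pos hpar hsparse v, fun g hg h hh => by
    obtain ⟨h1, h2⟩ := H.log_posterior_bounds hpar hsparse hsym hv hg hh
    have hξ := hsparse.ξ_pos n
    have e1 : (0 : ℝ) ≤ S.design.wt u (relabel h v) := Nat.cast_nonneg _
    have e2 : 0 ≤ S.ξ n * S.c * S.design.wt u (relabel h v) := by positivity
    have e3 : 0 ≤ S.C n * S.design.wt u (relabel h v) := by positivity
    change S.ξ n * (S.c - 2 * S.L0 * ‖θ.2 - (S.πs, S.γs)‖) * (S.design.wt u (relabel h v) : ℕ) -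
      _ ≤ _ ∧ _ ≤ S.C n * (S.design.wt u (relabel h v) : ℕ) + _
    constructor <;> linarith⟩

omit hsparse in
open scoped Classical in
/-- Sums over the class of a configuration. -/
theorem sum_class (hsym : S.HasSymmetries) (hL : S.IsLarge n) (F : S.Config n → ℝ) :
    ∑ v ∈ S.design.configs n with S.Equivalent v u, F v = ∑ g : S.Sig, F (relabel g.1 u) := by
  have hμ := μmin_pos hpar
  have hn : (0 : ℝ) < n := by exact_mod_cast hL.n_pos
  have hm : (0 : ℝ) < S.m n := by exact_mod_cast hL.m_pos
  have c1 : ∀ q, 0 < labelCount u.1 q := fun q => by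
    have := lt_of_lt_of_le (by positivity) (H.balanced.1 q)
    exact_mod_cast this
  have c2 : ∀ q, 0 < labelCount u.2 q := fun q => by
    have := lt_of_lt_of_le (by positivity) (H.balanced.2 q)
    exact_mod_cast this
  symm
  refine Finset.sum_bij (fun g _ => relabel g.1 u) (fun g _ => ?_) (fun g _ g' _ h => ?_)
    (fun v hv => ?_) fun g _ => rfl
  · exact Finset.mem_filter.2 ⟨S.design.relabel_mem_configs (hsym.le g.2) H.mem, g.1, g.2, rfl⟩
  · exact Subtype.ext (relabel_left_injective c1 c2 h)
  · obtain ⟨g, hg, rfl⟩ := (Finset.mem_filter.1 hv).2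
    exact ⟨⟨g, hg⟩, Finset.mem_univ _, rfl⟩

open scoped Classical in
theorem classPosterior_add :
    S.classPosterior n θ X u + ∑ v ∈ S.design.configs n with ¬ S.Equivalent v u,
      S.posterior n θ X v = 1 := by
  rw [classPosterior, Finset.sum_filter_add_sum_filter_not, H.sum_posterior hpar hsparse]

open scoped Classical in
/-- The other classes have a small posterior probability. -/
theorem sum_not_equivalent_le (hsym : S.HasSymmetries) (hL : S.IsLarge n) {η : ℝ} (hL0 : 0 ≤ S.L0)
    (hη : ‖θ.2 - (S.πs, S.γs)‖ ≤ η) (hc : 0 < S.c) :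
    ∑ v ∈ S.design.configs n with ¬ S.Equivalent v u, S.posterior n θ X v ≤
      S.classPosterior n θ X u * (S.aSeq η n * Real.exp (S.aSeq η n)) := by
  choose h hh using fun v => exists_attains u v
  have hξ := hsparse.ξ_pos n
  set κ := S.ξ n * (53 / 50 * S.c - 2 * S.L0 * η) with hκ
  set e : S.Config n → ℝ := fun v => Real.exp (-(κ * S.design.wt u v) + S.K * S.design.ham n u v)
    with he
  -- Compare `v` with the member of the class of `u` nearest to it; the ratio then depends only on
  -- the optimally relabelled `v`.
  have step : ∀ v ∈ S.design.configs n, S.posterior n θ X v ≤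
      S.posterior n θ X (relabel (h v)⁻¹ u) * e (relabel (h v) v) := fun v hv => by
    refine H.posterior_le_of_log_le hpar hsparse ?_
    have h1 := (H.log_posterior_bounds hpar hsparse hsym hv (S.Sig.inv_mem (hh v).1) (hh v)).1
    rw [S.design.ham_relabel_inv] at h1
    rw [← inv_div, Real.log_inv]
    have h2 : κ * S.design.wt u (relabel (h v) v) ≤
        S.ξ n * (53 / 50 * S.c - 2 * S.L0 * ‖θ.2 - (S.πs, S.γs)‖) *
          S.design.wt u (relabel (h v) v) := by
      rw [hκ]
      gcongr
    linarith
  -- Summing over all symmetries, instead of the one selected by `v`, allows the sums to be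
  -- exchanged. For a fixed `g` the relabelled configurations are distinct and differ from `u`.
  have step2 : ∀ v ∈ S.design.configs n, S.posterior n θ X v ≤
      ∑ g : S.Sig, S.posterior n θ X (relabel g⁻¹.1 u) * e (relabel g.1 v) := fun v hv => by
    refine (step v hv).trans ?_
    exact Finset.single_le_sum (f := fun g : S.Sig => S.posterior n θ X (relabel g⁻¹.1 u) *
      e (relabel g.1 v)) (fun g _ => mul_nonneg (H.posterior_pos hpar hsparse _).le
        (Real.exp_nonneg _)) (Finset.mem_univ (⟨h v, (hh v).1⟩ : S.Sig))
  have step3 : ∀ g : S.Sig, ∑ v ∈ S.design.configs n with ¬ S.Equivalent v u, e (relabel g.1 v) ≤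
      ∑ v ∈ S.design.configs n with v ≠ u, e v := fun g => by
    rw [← Finset.sum_image (f := e) (g := relabel g.1) fun v _ w _ hvw => relabel_injective _ hvw]
    refine Finset.sum_le_sum_of_subset_of_nonneg (fun w hw => ?_) fun _ _ _ => Real.exp_nonneg _
    obtain ⟨v, hv, rfl⟩ := Finset.mem_image.1 hw
    obtain ⟨hv, hvu⟩ := Finset.mem_filter.1 hv
    refine Finset.mem_filter.2 ⟨S.design.relabel_mem_configs (hsym.le g.2) hv, fun heq => hvu ?_⟩
    exact ⟨g.1⁻¹, S.Sig.inv_mem g.2, by rw [← heq, relabel_inv_relabel]⟩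
  have hsum : ∑ v ∈ S.design.configs n with v ≠ u, e v ≤ S.aSeq η n * Real.exp (S.aSeq η n) := by
    refine (S.design.sum_exp_wt_le H.mem κ S.K).trans ?_
    -- The excess `3/50 c` of the exponent over that of `aSeq` absorbs `Q + L`. After this `exp a -
    -- 1 ≤ a exp a` finishes the bound.
    have h1 : (S.Q + S.L : ℝ) * S.design.rate n κ S.K ≤ S.aSeq η n := by
      refine S.design.mul_rate_le n (hsparse.m_le n) ?_ ?_
      · rw [hκ]
        gcongr
        linarith
      · refine hL.groups_le.trans (le_of_eq ?_)
        rw [hκ]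
        ring_nf
    have h2 := Real.exp_le_exp.2 h1
    have h3 := Real.one_sub_le_exp_neg (S.aSeq η n)
    have h4 : Real.exp (S.aSeq η n) * Real.exp (-S.aSeq η n) = 1 := by
      rw [← Real.exp_add, add_neg_cancel, Real.exp_zero]
    have h5 := mul_le_mul_of_nonneg_left h3 (Real.exp_nonneg (S.aSeq η n))
    linarith
  calc _ ≤ ∑ v ∈ S.design.configs n with ¬ S.Equivalent v u,
        ∑ g : S.Sig, S.posterior n θ X (relabel g⁻¹.1 u) * e (relabel g.1 v) :=
        Finset.sum_le_sum fun v hv => step2 v (Finset.mem_filter.1 hv).1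
    _ = ∑ g : S.Sig, S.posterior n θ X (relabel g⁻¹.1 u) *
          ∑ v ∈ S.design.configs n with ¬ S.Equivalent v u, e (relabel g.1 v) := by
        rw [Finset.sum_comm]
        simp only [Finset.mul_sum]
    _ ≤ ∑ g : S.Sig, S.posterior n θ X (relabel g⁻¹.1 u) *
          (S.aSeq η n * Real.exp (S.aSeq η n)) := by
        refine Finset.sum_le_sum fun g _ => mul_le_mul_of_nonneg_left ((step3 g).trans hsum)
          (H.posterior_pos hpar hsparse _).le
    _ = _ := by
        rw [← Finset.sum_mul, classPosterior, H.sum_class hpar hsym hL]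
        congr 1
        exact Equiv.sum_comp (Equiv.inv S.Sig) fun g : S.Sig => S.posterior n θ X (relabel g.1 u)

theorem classPosterior_le_one : S.classPosterior n θ X u ≤ 1 := by
  classical
  rw [← H.classPosterior_add hpar hsparse]
  exact le_add_of_nonneg_right (Finset.sum_nonneg fun v _ => (H.posterior_pos hpar hsparse v).le)

/-- The mass outside the class is at most `a exp a` times the mass of the class, which is at most 1.
No factor `|Sig|` is lost. -/
theorem one_sub_le_classPosterior (hsym : S.HasSymmetries) (hL : S.IsLarge n) {η : ℝ}
    (hL0 : 0 ≤ S.L0) (hη : ‖θ.2 - (S.πs, S.γs)‖ ≤ η) (hc : 0 < S.c) :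
    1 - S.aSeq η n * Real.exp (S.aSeq η n) ≤ S.classPosterior n θ X u := by
  classical
  have h1 := H.sum_not_equivalent_le hpar hsparse hsym hL hL0 hη hc
  have h2 := H.classPosterior_add hpar hsparse
  have h3 := H.classPosterior_le_one hpar hsparse
  have h4 : 0 ≤ S.aSeq η n * Real.exp (S.aSeq η n) :=
    mul_nonneg (S.design.rate_nonneg _ _ _) (Real.exp_nonneg _)
  have h5 := mul_le_mul_of_nonneg_right h3 h4
  linarith

open scoped Classical in
/-- The other classes do not have a too small posterior probability. -/
theorem le_sum_not_equivalent (hsym : S.HasSymmetries) (hL : S.IsLarge n) (hc : 0 < S.c)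
    (hC : 32 * (S.ξ n * S.c) ≤ S.C n) (hQ : 2 ≤ S.Q) :
    S.classPosterior n θ X u * (Nat.card S.Sig * (S.bSeq n * Real.exp (S.bSeq n))) ≤
      ∑ v ∈ S.design.configs n with ¬ S.Equivalent v u, S.posterior n θ X v := by
  have hξ := hsparse.ξ_pos n
  have hξc : 0 < S.ξ n * S.c := mul_pos hξ hc
  obtain ⟨v, hv, hv1, hv2, hv3⟩ := S.design.exists_neighbour hL.n_pos hQ H.mem
  have hcount : ∀ q, 1 < labelCount u.1 q := fun q => by
    have := lt_of_lt_of_le hL.one_lt (H.balanced.1 q)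
    exact_mod_cast this
  set R := ∑ v ∈ S.design.configs n with ¬ S.Equivalent v u, S.posterior n θ X v with hR
  -- All relabellings of the neighbour `v` lie outside the class of `u`, so each has posterior at
  -- most the total `R` of the other classes.
  have hgv : ∀ g ∈ S.Sig, S.posterior n θ X (relabel g v) ≤ R := fun g hg => by
    refine Finset.single_le_sum (f := fun v => S.posterior n θ X v)
      (fun v _ => (H.posterior_pos hpar hsparse v).le) (Finset.mem_filter.2
        ⟨S.design.relabel_mem_configs (hsym.le hg) hv, ?_⟩)
    rintro ⟨g', -, hg'⟩
    refine relabel_fst_ne_of_hammingDist_eq_one hcount hv1 (g⁻¹ * g') ?_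
    rw [relabel_mul, hg', relabel_inv_relabel]
  set t := 3 / 4 * S.C n * S.design.wt u v + S.K with ht
  have hgu : ∀ g : S.Sig, S.posterior n θ X (relabel g.1 u) ≤ R * Real.exp t := fun g => by
    have h1 : S.posterior n θ X (relabel g.1 u) ≤
        S.posterior n θ X (relabel g.1 v) * Real.exp t := by
      refine H.posterior_le_of_log_le hpar hsparse ?_
      rw [H.log_posterior_div hpar hsparse, H.likelihood_relabel hsym g.2,
        H.likelihood_relabel hsym g.2]
      have h2 := H.upper v hv
      have h3 := H.log_prior_div_le hpar (relabel g.1 u) (relabel g.1 v)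
      rw [S.design.ham_relabel, hv2, Nat.cast_one, mul_one] at h3
      linarith
    exact h1.trans (mul_le_mul_of_nonneg_right (hgv g.1 g.2) (Real.exp_nonneg _))
  have hclass : S.classPosterior n θ X u ≤ Nat.card S.Sig * (R * Real.exp t) := by
    rw [classPosterior, H.sum_class hpar hsym hL]
    refine (Finset.sum_le_card_nsmul _ _ _ fun g _ => hgu g).trans (le_of_eq ?_)
    rw [nsmul_eq_mul, Finset.card_univ, Nat.card_eq_fintype_card]
  have hR0 : 0 ≤ R := Finset.sum_nonneg fun v _ => (H.posterior_pos hpar hsparse v).le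
  have hC0 : 0 ≤ S.C n := le_trans (by positivity) hC
  -- The rate is compared at the exponent `3/4 C`. Its last factor is the inverse of `exp t`, and
  -- the remaining `C / 4 ≥ ξ c` gives the decay `exp (-ξ c m)`.
  have hb := (hv3 (S.C n) (-S.K) hC0 (hsparse.m_le n)).2 (3 / 4 * S.C n) (by linarith)
  change S.bSeq n ≤ _ at hb
  have hb0 : 0 ≤ S.bSeq n := S.design.rate_nonneg _ _ _
  have hexp : Real.exp (S.bSeq n) ≤ 3 := by
    have h1 := Real.exp_le_exp.2 hL.bSeq_le
    have h2 := Real.exp_one_lt_d9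
    linarith
  have hbt : S.bSeq n * Real.exp t ≤ 2 * n * Real.exp (-(S.ξ n * S.c * S.m n)) := by
    have h1 := mul_le_mul_of_nonneg_right hb (Real.exp_nonneg t)
    have h2 : Real.exp (-(3 / 4 * S.C n * S.design.wt u v) + -S.K) * Real.exp t = 1 := by
      rw [← Real.exp_add, ht]
      ring_nf
      exact Real.exp_zero
    rw [mul_assoc, h2, mul_one] at h1
    refine h1.trans ?_
    gcongr
    linarith
  -- One factor `|Sig|` comes from the size of the class, the other from the claimed bound; 3 bounds
  -- `exp (bSeq n)`.
  have hfin : (Nat.card S.Sig : ℝ) ^ 2 * (3 * (2 * n * Real.exp (-(S.ξ n * S.c * S.m n)))) ≤ 1 := by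
    have h1 := mul_le_mul_of_nonneg_right hL.card_le (Real.exp_nonneg (-(S.ξ n * S.c * S.m n)))
    rw [← Real.exp_add, add_neg_cancel, Real.exp_zero] at h1
    linarith
  have hN : (0 : ℝ) ≤ Nat.card S.Sig := Nat.cast_nonneg _
  calc S.classPosterior n θ X u * (Nat.card S.Sig * (S.bSeq n * Real.exp (S.bSeq n)))
      ≤ (Nat.card S.Sig * (R * Real.exp t)) * (Nat.card S.Sig * (S.bSeq n * 3)) := by gcongr
    _ = R * ((Nat.card S.Sig : ℝ) ^ 2 * (3 * (S.bSeq n * Real.exp t))) := by ring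
    _ ≤ R * ((Nat.card S.Sig : ℝ) ^ 2 * (3 * (2 * n * Real.exp (-(S.ξ n * S.c * S.m n))))) := by
        gcongr
    _ ≤ R * 1 := by gcongr
    _ = R := mul_one R

theorem classPosterior_le (hsym : S.HasSymmetries) (hL : S.IsLarge n) (hc : 0 < S.c)
    (hC : 32 * (S.ξ n * S.c) ≤ S.C n) (hQ : 2 ≤ S.Q) :
    S.classPosterior n θ X u ≤
      (1 + Nat.card S.Sig * (S.bSeq n * Real.exp (S.bSeq n)))⁻¹ := by
  classical
  have h1 := H.le_sum_not_equivalent hpar hsparse hsym hL hc hC hQ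
  have h2 := H.classPosterior_add hpar hsparse
  have hb0 : 0 ≤ S.bSeq n := S.design.rate_nonneg _ _ _
  rw [← one_div, le_div_iff₀ (by positivity)]
  linarith

theorem classBounds (hsym : S.HasSymmetries) (hL : S.IsLarge n) {η : ℝ}
    (hL0 : 0 ≤ S.L0) (hη : ‖θ.2 - (S.πs, S.γs)‖ ≤ η) (hc : 0 < S.c)
    (hC : 32 * (S.ξ n * S.c) ≤ S.C n) : S.ClassBounds η n θ u X := by
  refine ⟨?_, fun hQ => H.classPosterior_le hpar hsparse hsym hL hc hC hQ⟩
  refine le_trans ?_ (H.one_sub_le_classPosterior hpar hsparse hsym hL hL0 hη hc)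
  have h1 : (1 : ℝ) ≤ Nat.card S.Sig := by exact_mod_cast Nat.card_pos
  have h4 : 0 ≤ S.aSeq η n * Real.exp (S.aSeq η n) :=
    mul_nonneg (S.design.rate_nonneg _ _ _) (Real.exp_nonneg _)
  have := mul_le_mul_of_nonneg_right h1 h4
  linarith

omit hpar hsparse in
theorem classPosterior_of_trivial (hS : S.Sig = ⊥) :
    S.classPosterior n θ X u = S.posterior n θ X u := by
  classical
  rw [classPosterior, Finset.sum_eq_single u]
  · intro v hv hvu
    obtain ⟨g, hg, rfl⟩ := (Finset.mem_filter.1 hv).2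
    rw [hS, Subgroup.mem_bot] at hg
    exact absurd (by rw [hg, relabel_one]) hvu
  · intro hu
    exact absurd (Finset.mem_filter.2 ⟨H.mem, 1, S.Sig.one_mem, relabel_one u⟩) hu

theorem trivialBounds (hsym : S.HasSymmetries) (hL : S.IsLarge n) {η : ℝ}
    (hL0 : 0 ≤ S.L0) (hη : ‖θ.2 - (S.πs, S.γs)‖ ≤ η) (hc : 0 < S.c)
    (hC : 32 * (S.ξ n * S.c) ≤ S.C n) (hS : S.Sig = ⊥) : S.TrivialBounds η n θ u X := by
  have h := H.classBounds hpar hsparse hsym hL hL0 hη hc hC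
  rw [ClassBounds, H.classPosterior_of_trivial hS, hS] at h
  simpa [TrivialBounds] using h

omit hsparse in
-- The likelihood is invariant under the symmetries, and `K = 0` makes the prior constant.
theorem isUniformOnClass (hsym : S.HasSymmetries) (hL : S.IsLarge n) (hK : S.K = 0) :
    S.IsUniformOnClass n θ u X := by
  classical
  have h : ∀ g : S.Sig, S.posterior n θ X (relabel g.1 u) = S.posterior n θ X u := fun g => by
    obtain ⟨h1, h2⟩ := proportions_pos hpar H.params.1
    obtain ⟨h3, h4⟩ := le_mul_exp_K hpar H.params.1
    have hp := fun v w => S.design.prior_le_mul_exp n (fun q => (h1 q).le) (fun l => (h2 l).le)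
      h3 h4 v w
    simp only [hK, zero_mul, Real.exp_zero, mul_one] at hp
    rw [posterior, posterior, H.likelihood_relabel hsym g.2,
      le_antisymm (hp (relabel g.1 u) u) (hp u (relabel g.1 u))]
  rw [IsUniformOnClass, classPosterior, H.sum_class hpar hsym hL,
    Finset.sum_congr rfl fun g _ => h g, Finset.sum_const, nsmul_eq_mul, Finset.card_univ,
    ← Nat.card_eq_fintype_card]
  have h1 : (Nat.card S.Sig : ℝ) ≠ 0 := by exact_mod_cast Nat.card_pos.ne'
  field_simp

/-- Another maximizer would also exceed `1/2`, and the total would exceed 1. -/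
theorem eq_of_isMAP (hu : 1 / 2 < S.posterior n θ X u) {v : S.Config n}
    (hv : S.IsMAP n θ X v) : v = u := by
  classical
  by_contra hne
  have h1 := hv.2 u H.mem
  have h2 := H.sum_posterior hpar hsparse
  have h3 := Finset.sum_le_sum_of_subset_of_nonneg (s := {u, v}) (t := S.design.configs n)
    (f := S.posterior n θ X) (by
      intro w hw
      rcases Finset.mem_insert.1 hw with rfl | hw
      · exact H.mem
      · rw [Finset.mem_singleton.1 hw]; exact hv.1)
    fun w _ _ => (H.posterior_pos hpar hsparse w).le
  rw [Finset.sum_pair (Ne.symm hne), h2] at h3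
  linarith

end

end HasLikelihoodBounds

end WeightedModel

/-! ### Asymptotics of the rates and of the failure probability -/

theorem eventually_le_mul_natCast {c : ℝ} (hc : 0 < c) (b : ℝ) : ∀ᶠ n : ℕ in atTop, b < c * n :=
  (tendsto_natCast_atTop_atTop.const_mul_atTop hc).eventually_gt_atTop b

namespace WeightedModel

variable {𝓧 E : Type*} [MeasurableSpace 𝓧] {S : WeightedModel 𝓧 E}

namespace IsSparse

theorem eventually_m_pos (hsparse : S.IsSparse) : ∀ᶠ n in atTop, 0 < S.m n :=
  hsparse.m_tendsto.eventually_gt_atTop 0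

/-- This is `log n = o(m ξ)` in exponential form: `exp (k ξ m)` eventually beats every power of `n`.
Dividing by `A + 1` also covers `A = 0`. -/
theorem eventually_pow_le_exp (hsparse : S.IsSparse) {k : ℝ} (hk : 0 < k) (A : ℕ) :
    ∀ᶠ n : ℕ in atTop, (n : ℝ) ^ A ≤ Real.exp (S.ξ n * k * S.m n) := by
  have h := hsparse.log_div.eventually (eventually_lt_nhds (b := k / (A + 1)) (by positivity))
  filter_upwards [h, hsparse.eventually_m_pos, eventually_gt_atTop 0] with n h1 h2 h3
  have hm : (0 : ℝ) < S.m n := by exact_mod_cast h2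
  have hn : (1 : ℝ) ≤ n := by exact_mod_cast h3
  have hlog := Real.log_nonneg hn
  rw [div_lt_div_iff₀ (mul_pos hm (hsparse.ξ_pos n)) (by positivity)] at h1
  rw [← Real.log_le_iff_le_exp (by positivity), Real.log_pow]
  linarith

/-- The exponential is compared with the power `A + 1` because the rate has a factor `n` in front.
Uniformity in `κ` lets one bound serve all the exponents that occur. -/
theorem eventually_rate_le (hsparse : S.IsSparse) {k : ℝ} (hk : 0 < k) (K : ℝ) (A : ℕ) :
    ∀ᶠ n : ℕ in atTop, ∀ κ, S.ξ n * k ≤ κ →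
      S.design.rate n κ K ≤ 2 * Real.exp K * ((n : ℝ) ^ A)⁻¹ := by
  filter_upwards [hsparse.eventually_pow_le_exp hk (A + 1), eventually_gt_atTop 0]
    with n h1 h2 κ hκ
  have hn : (0 : ℝ) < n := by exact_mod_cast h2
  have hξ := hsparse.ξ_pos n
  refine (S.design.rate_le (hsparse.m_le n) (le_trans (by positivity) hκ) K).trans ?_
  have h3 : (n : ℝ) ^ (A + 1) ≤ Real.exp (κ * S.m n) :=
    h1.trans (Real.exp_le_exp.2 (mul_le_mul_of_nonneg_right hκ (Nat.cast_nonneg _)))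
  calc 2 * n * Real.exp (-(κ * S.m n) + K) = 2 * n * Real.exp K * (Real.exp (κ * S.m n))⁻¹ := by
        rw [Real.exp_add, Real.exp_neg]
        ring
    _ ≤ 2 * n * Real.exp K * ((n : ℝ) ^ (A + 1))⁻¹ := by gcongr
    _ = _ := by
        rw [pow_succ]
        field_simp

theorem tendsto_rate (hsparse : S.IsSparse) {k : ℝ} (hk : 0 < k) (K : ℝ) {κ : ℕ → ℝ}
    (hκ : ∀ n, S.ξ n * k ≤ κ n) :
    Tendsto (fun n => S.design.rate n (κ n) K) atTop (𝓝 0) := by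
  have h : Tendsto (fun n : ℕ => 2 * Real.exp K * ((n : ℝ) ^ 1)⁻¹) atTop (𝓝 0) := by
    simpa using (tendsto_inv_atTop_nhds_zero_nat (𝕜 := ℝ)).const_mul (2 * Real.exp K)
  refine squeeze_zero' (Eventually.of_forall fun n => S.design.rate_nonneg _ _ _) ?_ h
  filter_upwards [hsparse.eventually_rate_le hk K 1] with n hn
  exact hn _ (hκ n)

end IsSparse

variable [Zero 𝓧]

theorem eventually_isLarge (hpar : S.IsParametrized) (hsparse : S.IsSparse) (hc : 0 < S.c)
    (hb : Tendsto S.bSeq atTop (𝓝 0)) : ∀ᶠ n in atTop, S.IsLarge n := by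
  have hμ := μmin_pos hpar
  filter_upwards [eventually_gt_atTop 0, hsparse.eventually_m_pos,
    eventually_le_mul_natCast (show 0 < 19 / 20 * S.μmin by positivity) 1,
    hsparse.eventually_pow_le_exp (show 0 < 3 / 50 * S.c by positivity) 1,
    eventually_le_mul_natCast one_pos (S.Q + S.L : ℝ), hsparse.eventually_pow_le_exp hc 2,
    eventually_le_mul_natCast one_pos (6 * (Nat.card S.Sig : ℝ) ^ 2),
    hb.eventually (eventually_lt_nhds one_pos)] with n h1 h2 h3 h4 h5 h6 h7 h8
  refine ⟨h1, h2, h3, ?_, ?_, h8.le⟩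
  · rw [pow_one] at h4
    linarith
  · refine le_trans ?_ h6
    have := mul_le_mul_of_nonneg_right h7.le (Nat.cast_nonneg (α := ℝ) n)
    linarith

variable [MeasurableSingletonClass 𝓧]

/-- The regular configurations and observations have a summable probability of failure. -/
theorem exists_failure_le (hpar : S.IsParametrized) (hdens : S.HasDensities)
    (hKL : S.HasBoundedKL) (hsparse : S.IsSparse) (hconc : S.HasConcentration) {δ : ℝ}
    (hδ : 0 < δ) : ∃ B : ℝ, 0 ≤ B ∧ ∀ᶠ n : ℕ in atTop, ∀ γ ∈ S.GammaMat,
      1 - B * ((n : ℝ) ^ 2)⁻¹ ≤ (S.trueLaw n).real (S.goodEvent δ n γ) := by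
  obtain ⟨h, C, hh, hC, hP⟩ := exists_rate_goodEvent hpar hdens hKL hsparse hconc hδ
  have hμ := μmin_pos hpar
  have ht : Tendsto (fun n => (S.Q + S.L : ℝ) * S.design.rate n (h * S.ξ n) 0) atTop (𝓝 0) := by
    have := (hsparse.tendsto_rate hh 0 (κ := fun n => h * S.ξ n)
      fun n => (mul_comm _ _).le).const_mul (S.Q + S.L : ℝ)
    rwa [mul_zero] at this
  -- The factor 4 combines `exp x - 1 ≤ 2 x` for `x ≤ 1` with the 2 in the bound of the rate.
  refine ⟨S.Q + S.L + C * (4 * (S.Q + S.L)), by positivity, ?_⟩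
  filter_upwards [hsparse.eventually_pow_le_exp (show 0 < S.μmin / 2000 by positivity) 2,
    hsparse.eventually_rate_le hh 0 2, ht.eventually (eventually_le_nhds one_pos),
    eventually_gt_atTop 0] with n h1 h2 h3 h4 γ hγ
  refine le_trans ?_ (hP n γ hγ)
  have hn : (0 : ℝ) < n := by exact_mod_cast h4
  have hmn : (S.m n : ℝ) ≤ n := by exact_mod_cast hsparse.m_le n
  -- Balancedness is a statement about the labels, without sparsity, so its exponent exceeds a
  -- multiple of `ξ m` because `ξ ≤ 1`.
  have key : ∀ t : ℝ, S.m n ≤ t → Real.exp (-(S.μmin * t / 2000)) ≤ ((n : ℝ) ^ 2)⁻¹ := by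
    intro t ht
    rw [Real.exp_neg]
    refine inv_anti₀ (by positivity) (h1.trans (Real.exp_le_exp.2 ?_))
    have e1 : S.ξ n * (S.μmin / 2000 * S.m n) ≤ 1 * (S.μmin / 2000 * t) := by
      have := hsparse.ξ_le n
      have := hsparse.ξ_pos n
      gcongr
    linarith
  have k1 := mul_le_mul_of_nonneg_left (key n hmn) (Nat.cast_nonneg (α := ℝ) S.Q)
  have k2 := mul_le_mul_of_nonneg_left (key _ le_rfl) (Nat.cast_nonneg (α := ℝ) S.L)
  have h5 := h2 (h * S.ξ n) (mul_comm _ _).le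
  rw [Real.exp_zero, mul_one] at h5
  have h6 := mul_nonneg (show (0 : ℝ) ≤ S.Q + S.L by positivity)
    (S.design.rate_nonneg n (h * S.ξ n) 0)
  have h7 := Real.abs_exp_sub_one_le (x := (S.Q + S.L) * S.design.rate n (h * S.ξ n) 0)
    (by rwa [abs_of_nonneg h6])
  rw [abs_of_nonneg h6] at h7
  have h8 := (le_abs_self _).trans h7
  have h9 := mul_le_mul_of_nonneg_left h5 (show (0 : ℝ) ≤ S.Q + S.L by positivity)
  have h10 := mul_le_mul_of_nonneg_left
    (h8.trans (mul_le_mul_of_nonneg_left h9 zero_le_two)) hC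
  linarith

end WeightedModel

/-- Bounds that hold for large `n` hold for all `n`, up to a positive summable sequence. -/
theorem exists_summable_bound {B : ℝ} (hB : 0 ≤ B) (N : ℕ) : ∃ ε : ℕ → ℝ, (∀ n, 0 < ε n) ∧
    Summable ε ∧ (∀ n < N, 1 ≤ ε n) ∧ ∀ n : ℕ, B * ((n : ℝ) ^ 2)⁻¹ ≤ ε n := by
  -- The geometric term is positive, summable, and at least 1 for `n < N`.
  refine ⟨fun n => B * ((n : ℝ) ^ 2)⁻¹ + (2 ^ N * (1 / 2) ^ n), fun n => by positivity,
    (((Real.summable_nat_pow_inv (p := 2)).2 one_lt_two).mul_left B).add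
      (summable_geometric_two.mul_left _), fun n hn => ?_, fun n => ?_⟩
  · have h1 : 0 ≤ B * ((n : ℝ) ^ 2)⁻¹ := by positivity
    have h2 : (1 : ℝ) ≤ 2 ^ N * (1 / 2) ^ n := by
      rw [one_div, inv_pow, ← div_eq_mul_inv, one_le_div (by positivity)]
      exact pow_le_pow_right₀ one_le_two hn.le
    dsimp only
    linarith
  · have : (0 : ℝ) ≤ 2 ^ N * (1 / 2) ^ n := by positivity
    dsimp only
    linarith

/-! ### Assembly of the theorem -/

theorem mainTheorem8 {𝓧 E : Type*} [MeasurableSpace 𝓧] [MeasurableSingletonClass 𝓧] [Zero 𝓧]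
    [NormedAddCommGroup E] (S : WeightedModel 𝓧 E) (hbase : SigmaFinite S.base)
    (hpar : S.IsParametrized) (hdens : S.HasDensities) (hid : S.IsIdentifiable)
    (hsym : S.HasSymmetries) (hKL : S.HasBoundedKL) (hLip : S.IsLipschitz)
    (hconc : S.HasConcentration) (hsparse : S.IsSparse) :
    ((∀ e e' : Fin S.Q × Fin S.L,
        S.πs e.1 e.2 ≠ S.πs e'.1 e'.2 ↔ S.γs e.1 e.2 ≠ S.γs e'.1 e'.2) →
      S.μmin ^ 2 * (S.cMin + S.a * S.κMin) / 16 ≤ S.c) ∧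
    (2 ≤ S.Q ∨ 2 ≤ S.L → 0 < S.c) ∧
    ∀ η : ℝ, 0 < η → η < S.c / (2 * S.L0) →
      Tendsto (S.aSeq η) atTop (𝓝 0) ∧ Tendsto S.bSeq atTop (𝓝 0) ∧
      ∃ (ε : ℕ → ℝ)
        (Ω₁ : (n : ℕ) → (Fin S.Q → Fin S.L → E) → Set (S.Config n × S.Data n)),
        (∀ n, 0 < ε n) ∧ Summable ε ∧
        (∀ n, ∀ γ ∈ S.GammaMat, ‖γ - S.γs‖ ≤ η →
          MeasurableSet (Ω₁ n γ) ∧ 1 - ε n ≤ (S.trueLaw n).real (Ω₁ n γ) ∧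
          ∀ θ ∈ S.params, θ.2.2 = γ → ‖θ.2 - (S.πs, S.γs)‖ ≤ η →
            ∀ u X, (u, X) ∈ Ω₁ n γ →
              u ∈ S.design.configs n ∧
              S.RatioBounds n θ u X ∧
              (S.Sig = ⊥ → S.TrivialBounds η n θ u X) ∧
              (S.K = 0 → S.ClassBounds η n θ u X ∧ S.IsUniformOnClass n θ u X) ∧
              S.ClassBounds η n θ u X) ∧
        (S.Sig = ⊥ →
          ∀ (T : (n : ℕ) → S.Data n → S.Param) (u : (n : ℕ) → S.Config n)
            (X : (n : ℕ) → S.Data n),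
            (∀ n, T n (X n) ∈ S.params) →
            Tendsto (fun n => (T n (X n)).2) atTop (𝓝 (S.πs, S.γs)) →
            ∀ᶠ n in atTop, (u n, X n) ∈ Ω₁ n (T n (X n)).2.2 →
              ∀ v, S.IsMAP n (T n (X n)) (X n) v → S.design.ham n v (u n) = 0) := by
  refine ⟨WeightedModel.c_ge hpar, WeightedModel.c_pos hpar hdens hid hKL, fun η hη0 hη => ?_⟩
  have hL0 : 0 < S.L0 := add_pos (inv_pos.2 hpar.a_pos) hLip.1
  have hgap : 0 < S.c - 2 * S.L0 * η := by
    rw [lt_div_iff₀ (by positivity)] at hη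
    linarith
  -- A positive `η` below `c / (2 L0)` already forces `c > 0`.
  have hc : 0 < S.c := by
    have : 0 < 2 * S.L0 * η := by positivity
    linarith
  have hC : ∀ n, 32 * (S.ξ n * S.c) ≤ S.C n := fun n => by
    have := WeightedModel.κMax_ge hbase hpar hdens hKL hLip hsparse hc n
    rw [WeightedModel.C]
    linarith
  have hξc : ∀ n, 0 < S.ξ n * S.c := fun n => mul_pos (hsparse.ξ_pos n) hc
  have ha : Tendsto (S.aSeq η) atTop (𝓝 0) := hsparse.tendsto_rate hgap S.K fun n => le_rfl
  have hb : Tendsto S.bSeq atTop (𝓝 0) := hsparse.tendsto_rate hc (-S.K) fun n => by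
    have := hC n
    have := hξc n
    linarith
  obtain ⟨δ, hδ, hlik⟩ := WeightedModel.exists_log_likelihood_bounds hbase hpar hdens hid hsym hKL
    hLip hsparse hc
  obtain ⟨B, hB, hprob⟩ := WeightedModel.exists_failure_le hpar hdens hKL hsparse hconc hδ
  have hμ := WeightedModel.μmin_pos hpar
  obtain ⟨N, hN⟩ := eventually_atTop.1 (hprob.and
    ((WeightedModel.eventually_isLarge hpar hsparse hc hb).and
      (eventually_le_mul_natCast (pow_pos hμ 2) 50)))
  obtain ⟨ε, hε0, hε, hεN, hεB⟩ := exists_summable_bound hB N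
  have hbounds : ∀ n, N ≤ n → ∀ θ ∈ S.params, ∀ u X, (u, X) ∈ S.goodEvent δ n θ.2.2 →
      S.HasLikelihoodBounds n θ u X := fun n hn θ hθ u X hω => by
    obtain ⟨-, hl, h50⟩ := hN n hn
    have := hlik n hl.n_pos hl.m_pos h50.le θ.2.1 hθ.2.1 θ.2.2 hθ.2.2 u X hω
    exact ⟨hω.1, hθ, hω.2.1, hω.2.2.1, fun v hv => (this v hv).1, fun v hv => (this v hv).2⟩
  -- For `n < N` the event is empty and `ε n ≥ 1`, so the probability bound is trivial there.
  -- Membership in the event thus carries `N ≤ n`.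
  refine ⟨ha, hb, ε, fun n γ => {ω | N ≤ n ∧ ω ∈ S.goodEvent δ n γ}, hε0, hε,
    fun n γ hγ _ => ?_, fun hS T u X hT hlim => ?_⟩
  · by_cases hn : N ≤ n
    · have he : {ω | N ≤ n ∧ ω ∈ S.goodEvent δ n γ} = S.goodEvent δ n γ := by
        ext ω
        exact and_iff_right hn
      obtain ⟨hp, hl, -⟩ := hN n hn
      dsimp only
      rw [he]
      refine ⟨WeightedModel.measurableSet_goodEvent hpar hdens δ hγ, ?_, ?_⟩
      · have := hp γ hγ
        have := hεB n
        linarith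
      · rintro θ hθ rfl hθη u X hω
        have H := hbounds n hn θ hθ u X hω
        have hCn : 0 ≤ S.C n := by
          have := hC n
          have := hξc n
          linarith
        have hcl := H.classBounds hpar hsparse hsym hl hL0.le hθη hc (hC n)
        exact ⟨H.mem, H.ratioBounds hpar hsparse hsym hc hCn,
          fun hS => H.trivialBounds hpar hsparse hsym hl hL0.le hθη hc (hC n) hS,
          fun hK => ⟨hcl, H.isUniformOnClass hpar hsym hl hK⟩, hcl⟩
    · have he : {ω | N ≤ n ∧ ω ∈ S.goodEvent δ n γ} = ∅ := by
        ext ω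
        exact iff_of_false (fun h => hn h.1) (Set.notMem_empty ω)
      dsimp only
      rw [he]
      refine ⟨MeasurableSet.empty, ?_, fun θ _ _ _ u X hω => (Set.notMem_empty _ hω).elim⟩
      rw [measureReal_empty]
      have := hεN n (not_le.1 hn)
      linarith
  · have hdist : Tendsto (fun n => ‖(T n (X n)).2 - (S.πs, S.γs)‖) atTop (𝓝 0) :=
      tendsto_iff_norm_sub_tendsto_zero.1 hlim
    have hae : Tendsto (fun n => S.aSeq η n * Real.exp (S.aSeq η n)) atTop (𝓝 0) := by
      have := ha.mul (Real.continuous_exp.continuousAt.tendsto.comp ha)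
      rwa [zero_mul] at this
    -- The estimated parameter is eventually within `η` and `a exp a < 1/2`, so the true
    -- configuration has posterior probability above `1/2` and is the only maximizer.
    filter_upwards [hdist.eventually (eventually_le_nhds hη0),
      hae.eventually (eventually_lt_nhds one_half_pos)] with n h1 h2 hω v hv
    have H := hbounds n hω.1 _ (hT n) _ _ hω.2
    have h3 := H.one_sub_le_classPosterior hpar hsparse hsym (hN n hω.1).2.1 hL0.le h1 hc
    rw [H.classPosterior_of_trivial hS] at h3
    rw [H.eq_of_isMAP hpar hsparse (by linarith) hv]
    exact S.design.ham_self _
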